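/- Let $M$ be a smooth manifold of dimension $n\ge 1$ and let $Y\to Y_0\to M$ be a graded bundle: $Y_0\to M$ is a fibred manifold and $Y\to Y_0$ is a graded vector bundle with finitely many nonzero degrees and finite ranks. Let $(x^\mu,\Phi^a)$ be local coordinates of $Y$ and let $\Omega_{loc}^{p,q,r}$ be the local forms of horizontal degree $p$, vertical degree $q$ and ghost degree $r$ of the variational (tri)complex of $Y$: their coefficients are smooth in $x^\mu$ and finitely many jet coordinates $\Phi^a_I$ of degree $0$, and polynomial in the jet coordinates of nonzero degree. Let $d_h=dx^\mu\wedge D_\mu$ and $d_v=\delta\Phi^a_I\wedge\partial/\partial\Phi^a_I$ be the horizontal and vertical differentials, with signs such that $d_hd_v=d_vd_h$, and for a vertical local vector field $\Xi$ of degree $d(\Xi)$ put $\mathrm{Lie}_\Xi=\iota_\Xi d_v+(-1)^{d(\Xi)}d_v\iota_\Xi$. Write $\alpha\simeq\beta$ if $\alpha-\beta$ is $d_h$ of a local form ($\alpha=\beta$ if the horizontal degree is $0$). Let $\mathcal I\omega=\frac1q\,\delta\Phi^a\wedge\sum_I(-D)_I\,\iota_{\partial/\partial\Phi^a_I}\omega$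 be the interior Euler operator on $\Omega_{loc}^{n,q}$, $q\ge1$. Let $0\le m\le n$. An $m$-extended BV-BFV Lagrangian field theory on $Y$ consists of a vertical local vector field $Q$ of degree $1$ with $Q^2=0$ and of local forms $\mathcal L^{(p)}\in\Omega_{loc}^{n-p,0,p}$, $\gamma^{(p)}\in\Omega_{loc}^{n-p,1,p-1}$, $\omega^{(p)}\in\Omega_{loc}^{n-p,2,p-1}$, $0\le p\le n$, such that 1. $\mathrm{Lie}_Q\mathcal L^{(0)}\simeq0$; 2. $\omega^{(0)}$ is a BV symplectic local form: $d_v\omega^{(0)}\simeq0$, $\mathcal I\omega^{(0)}=\omega^{(0)}$, and $\iota_\Xi\omega^{(0)}\simeq0$ implies $\Xi=0$ for every vertical local vector field $\Xi$; 3. $\mathrm{Lie}_Q\omega^{(p)}+d_h\omega^{(p+1)}=0$ for $0\le p<n$, and $\mathrm{Lie}_Q\omega^{(n)}=0$; 4. $\omega^{(p)}=d_v\gamma^{(p)}$ for $p\le m$ and $\omega^{(p)}=0$ for $p>m$; 5. $\iota_Q\omega^{(p)}=d_v\mathcal L^{(p)}+d_h\gamma^{(p+1)}$ for $0\le p<n$,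 and $\iota_Q\omega^{(n)}=d_v\mathcal L^{(n)}$. A boundary form of $\mathcal L^{(0)}$ is a form $\gamma\in\Omega_{loc}^{n-1,1,0}$ with $d_v\mathcal L^{(0)}=EL+d_h\gamma$, where $EL=\mathcal I\,d_v\mathcal L^{(0)}$ is the Euler-Lagrange form. **Lemma.** Suppose that, for a volume form $\nu$ on $M$, in all local coordinates $\omega^{(0)}=\omega_{ab}\,\delta\Phi^a\wedge\delta\Phi^b\wedge\nu$ with local functions $\omega_{ab}$. Then every boundary form $\gamma$ of $\mathcal L^{(0)}$ satisfies $$\gamma\simeq-\gamma^{(1)},$$ that is, $\gamma+\gamma^{(1)}=d_h\beta$ for some $\beta\in\Omega_{loc}^{n-2,1,0}$ (and $\gamma=-\gamma^{(1)}$ if $n=1$). -/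

import Mathlib

open scoped Manifold ContDiff TensorProduct

set_option linter.checkUnivs false

noncomputable section

/-! ### Coordinates, jets and the graded algebra of vertical local forms -/

/-- Numerical data of a graded bundle `Y → Y₀ → M`: the fibre dimension `m` of `Y₀ → M`, the finite
set of (nonzero) degrees of the graded vector bundle `Y → Y₀`, and the rank in each degree. -/
structure FibreType where
  m : ℕ
  degs : Finset ℤ
  zero_notMem : (0 : ℤ) ∉ degs
  rk : ℤ → ℕ

namespace FibreType

/-- Labels `a` of the fibre coordinates `θ^a` of nonzero degree. -/
abbrev Graded (s : FibreType) : Type := Σ k : {k : ℤ // k ∈ s.degs}, Fin (s.rk k.1)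

/-- Labels of all fibre coordinates `u^a`: those of degree zero (`inl`) and the others (`inr`). -/
abbrev Field (s : FibreType) : Type := Fin s.m ⊕ s.Graded

/-- The degree `d(u^a)` of a fibre coordinate. -/
def deg (s : FibreType) : s.Field → ℤ
  | Sum.inl _ => 0
  | Sum.inr a => a.1.1

end FibreType

/-- Coordinate space of the base. -/
abbrev Base (n : ℕ) : Type := EuclideanSpace ℝ (Fin n)

/-- Multi-indices. -/
abbrev MIdx (n : ℕ) : Type := Fin n →₀ ℕ

/-- Points of the infinite jet space of `Y₀` in coordinates: `(x, (u^a_I)_{a, I})`, `d(u^a) = 0`. -/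
abbrev Jet (n : ℕ) (s : FibreType) : Type := Base n × (Fin s.m → MIdx n → ℝ)

/-- Generators of the algebra of local forms over the functions on the jet space of `Y₀`, apart from
the `dx^μ`: the jet coordinates `θ^a_I` of nonzero degree (`inl`), and the vertical one-forms
`δu^a_I` (`inr`). -/
abbrev Gen (n : ℕ) (s : FibreType) : Type := (s.Graded × MIdx n) ⊕ (s.Field × MIdx n)

namespace Gen

variable {n : ℕ} {s : FibreType}

/-- Vertical form degree. -/
def vdeg : Gen n s → ℕ
  | Sum.inl _ => 0
  | Sum.inr _ => 1

/-- Ghost number degree. -/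
def gdeg : Gen n s → ℤ
  | Sum.inl p => s.deg (Sum.inr p.1)
  | Sum.inr p => s.deg p.1

/-- The sign of a generator is governed by the sum of its vertical and its ghost degree. -/
def IsEven (g : Gen n s) : Prop := Even ((g.vdeg : ℤ) + g.gdeg)

/-- `u^a_I ↦ u^a_{I + μ}` and `δu^a_I ↦ δu^a_{I + μ}`. -/
def shift (μ : Fin n) : Gen n s → Gen n s
  | Sum.inl p => Sum.inl (p.1, p.2 + Finsupp.single μ 1)
  | Sum.inr p => Sum.inr (p.1, p.2 + Finsupp.single μ 1)

end Gen

/-- The free graded commutative real algebra on the generators: polynomials in the even ones tensor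
the exterior algebra on the odd ones. -/
abbrev VAlg (n : ℕ) (s : FibreType) : Type :=
  MvPolynomial {g : Gen n s // g.IsEven} ℝ ⊗[ℝ]
    ExteriorAlgebra ℝ ({g : Gen n s // ¬ g.IsEven} →₀ ℝ)

section Coordinates

variable {n : ℕ} {s : FibreType}

open Classical in
/-- A generator, as an element of the algebra. -/
def gen (g : Gen n s) : VAlg n s :=
  if h : g.IsEven then MvPolynomial.X ⟨g, h⟩ ⊗ₜ[ℝ] 1
  else 1 ⊗ₜ[ℝ] ExteriorAlgebra.ι ℝ (Finsupp.single ⟨g, h⟩ 1)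

open Classical in
/-- The left partial derivative with respect to a generator: the graded derivation that sends `g` to
`1` and all other generators to `0`. -/
def pd (g : Gen n s) : VAlg n s →ₗ[ℝ] VAlg n s :=
  if h : g.IsEven then
    TensorProduct.map (MvPolynomial.pderiv ⟨g, h⟩ : Derivation ℝ _ _).toLinearMap LinearMap.id
  else
    TensorProduct.map LinearMap.id
      (CliffordAlgebra.contractLeft (Q := (0 : QuadraticForm ℝ ({g : Gen n s // ¬ g.IsEven} →₀ ℝ)))
        (Finsupp.lapply ⟨g, h⟩))

/-- Elements of vertical degree `q` and ghost degree `r`. -/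
def bideg (n : ℕ) (s : FibreType) (q : ℕ) (r : ℤ) : Submodule ℝ (VAlg n s) :=
  Submodule.span ℝ {b | ∃ l : List (Gen n s),
    (l.map Gen.vdeg).sum = q ∧ (l.map Gen.gdeg).sum = r ∧ b = (l.map gen).prod}

/-- The point of (a coordinate chart of) `Y₀` under a jet. -/
def Jet.pt (j : Jet n s) : ModelProd (Base n) (Base s.m) :=
  (j.1, WithLp.toLp 2 fun a => j.2 a 0)

/-- The finitely many jet coordinates in `S`, together with the base coordinates. -/
def Jet.trunc (S : Finset (Fin s.m × MIdx n)) (j : Jet n s) : Base n × (S → ℝ) :=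
  (j.1, fun i => j.2 i.1.1 i.1.2)

/-- `f` is a finite sum of constant vectors with coefficients that are smooth functions of the base
coordinates and of finitely many jet coordinates. -/
def IsLocalOn {F : Type*} [AddCommGroup F] [Module ℝ F] (W : Set (Jet n s)) (f : Jet n s → F) :
    Prop :=
  ∃ (S : Finset (Fin s.m × MIdx n)) (N : ℕ) (G : Fin N → Base n × (S → ℝ) → ℝ) (b : Fin N → F),
    (∀ i, ContDiffOn ℝ ∞ (G i) (Jet.trunc S '' W)) ∧
    ∀ j ∈ W, f j = ∑ i, G i (j.trunc S) • b i

open Classical in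
/-- Directional derivative of a function with values in a real vector space without topology (the
derivative is taken after composition with linear functionals, which determines it). -/
def dirDeriv (f : Jet n s → VAlg n s) (j w : Jet n s) : VAlg n s :=
  if h : ∃ b : VAlg n s, ∀ l : VAlg n s →ₗ[ℝ] ℝ, HasLineDerivAt ℝ (fun j' => l (f j')) (l b) j w
  then h.choose else 0

/-- The jet coordinates of the Cartan lift of the constant vector field `v` on the base:
`v^ν (∂_ν + u^a_{I+ν} ∂/∂u^a_I)`, restricted to the coordinates of degree `0`. -/
def cartanLift (v : Base n) (j : Jet n s) : Jet n s :=
  (v, fun a I => ∑ ν, v ν * j.2 a (I + Finsupp.single ν 1))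

/-- Total derivative of a real function on the jet space. -/
def totalDeriv₀ (v : Base n) (f : Jet n s → ℝ) : Jet n s → ℝ :=
  fun j => lineDeriv ℝ f j (cartanLift v j)

/-- Total derivative (Lie derivative along the Cartan lift of `v`) on local forms. -/
def totalDeriv (v : Base n) (f : Jet n s → VAlg n s) : Jet n s → VAlg n s :=
  fun j => dirDeriv f j (cartanLift v j) +
    ∑ᶠ g : Gen n s, (∑ ν, v ν • gen (g.shift ν)) * pd g (f j)

/-- `D_0^{I_0} ⋯ D_{n-1}^{I_{n-1}} f`. -/
def iterMulti {F : Type*} (D : Fin n → F → F) (I : MIdx n) (f : F) : F :=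
  (List.finRange n).foldr (fun μ h => (D μ)^[I μ] h) f

/-- `D_I`, in the given base coordinates. -/
def totalDerivMulti (I : MIdx n) (f : Jet n s → VAlg n s) : Jet n s → VAlg n s :=
  iterMulti (fun μ => totalDeriv (EuclideanSpace.single μ 1)) I f

/-- Vertical differential, `δu^a_I ∧ ∂/∂u^a_I`. -/
def vertD (f : Jet n s → VAlg n s) : Jet n s → VAlg n s := fun j =>
  (∑ᶠ p : Fin s.m × MIdx n, gen (Sum.inr (Sum.inl p.1, p.2)) *
      dirDeriv f j (0, Pi.single p.1 (Pi.single p.2 1))) +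
    ∑ᶠ p : s.Graded × MIdx n, gen (Sum.inr (Sum.inr p.1, p.2)) * pd (Sum.inl p) (f j)

/-- Contraction with the vertical local vector field
`X^a ∂/∂u^a + D_I(X^a) ∂/∂u^a_I` (sum over `|I| ≥ 1` in the second term). -/
def contr (X : s.Field → Jet n s → VAlg n s) (f : Jet n s → VAlg n s) : Jet n s → VAlg n s :=
  fun j => ∑ᶠ p : s.Field × MIdx n, totalDerivMulti p.2 (X p.1) j * pd (Sum.inr p) (f j)

/-- Lie derivative along a vertical local vector field of ghost degree `d`:
`ι_X d_v + (-1)^d d_v ι_X`. -/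
def lieD (d : ℤ) (X : s.Field → Jet n s → VAlg n s) (f : Jet n s → VAlg n s) :
    Jet n s → VAlg n s :=
  contr X (vertD f) + ((Int.negOnePow d : ℤˣ) : ℤ) • vertD (contr X f)

/-- Interior Euler operator on vertical degree `q`:
`(1/q) δu^a ∧ ∑_I (-D)_I (ι_{∂/∂u^a_I} f)`. -/
def euler (q : ℕ) (f : Jet n s → VAlg n s) : Jet n s → VAlg n s := fun j =>
  (q : ℝ)⁻¹ • ∑ a : s.Field, gen (Sum.inr (a, 0)) *
    ∑ᶠ I : MIdx n, (-1 : ℝ) ^ I.degree • totalDerivMulti I (fun j' => pd (Sum.inr (a, I)) (f j')) j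

end Coordinates

/-! ### Graded bundles and adapted charts -/

/-- A graded bundle `Y → Y₀ → M` over an `n`-manifold: a fibred manifold `Y₀ → M`
with fibre dimension `s.m`, and a graded vector bundle `⊕_k E_k` over `Y₀`, with `E_k` in degree `k`
(so that the linear coordinates of `E_k` have degree `k`). -/
structure GradedBundle (n : ℕ) (s : FibreType) (M : Type*) [TopologicalSpace M]
    [ChartedSpace (Base n) M] where
  Y₀ : Type*
  [top : TopologicalSpace Y₀]
  [t2 : T2Space Y₀]
  [sc : SecondCountableTopology Y₀]
  [charted : ChartedSpace (ModelProd (Base n) (Base s.m)) Y₀]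
  [mfd : IsManifold ((𝓡 n).prod (𝓡 s.m)) ∞ Y₀]
  proj : Y₀ → M
  proj_surjective : Function.Surjective proj
  /-- every point of `Y₀` has fibred coordinates `(x, u)` around it -/
  fibred : ∀ y : Y₀, ∃ φ ∈ IsManifold.maximalAtlas (𝓡 n) ∞ M,
    ∃ ψ ∈ IsManifold.maximalAtlas ((𝓡 n).prod (𝓡 s.m)) ∞ Y₀, y ∈ ψ.source ∧
      ∀ z ∈ ψ.source, proj z ∈ φ.source ∧ (ψ z).1 = φ (proj z)
  E : {k : ℤ // k ∈ s.degs} → Y₀ → Type*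
  [grp : ∀ k y, AddCommGroup (E k y)]
  [mod : ∀ k y, Module ℝ (E k y)]
  [topE : ∀ k y, TopologicalSpace (E k y)]
  [topTot : ∀ k, TopologicalSpace (Bundle.TotalSpace (Fin (s.rk k.1) → ℝ) (E k))]
  [fib : ∀ k, FiberBundle (Fin (s.rk k.1) → ℝ) (E k)]
  [vec : ∀ k, VectorBundle ℝ (Fin (s.rk k.1) → ℝ) (E k)]
  [smooth : ∀ k, ContMDiffVectorBundle ∞ (Fin (s.rk k.1) → ℝ) (E k) ((𝓡 n).prod (𝓡 s.m))]

attribute [instance] GradedBundle.top GradedBundle.t2 GradedBundle.sc GradedBundle.charted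
  GradedBundle.mfd GradedBundle.grp GradedBundle.mod GradedBundle.topE GradedBundle.topTot
  GradedBundle.fib GradedBundle.vec GradedBundle.smooth

section Bundle

variable {n : ℕ} {s : FibreType} {M : Type*} [TopologicalSpace M] [ChartedSpace (Base n) M]

/-- Adapted coordinates of `Y → Y₀ → M`: a chart of `M`, a fibred chart of `Y₀` over it, and linear
coordinates of each `E_k` over the domain of the latter. -/
structure AdaptedChart (Y : GradedBundle n s M) where
  φ : OpenPartialHomeomorph M (Base n)
  φ_mem : φ ∈ IsManifold.maximalAtlas (𝓡 n) ∞ M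
  ψ : OpenPartialHomeomorph Y.Y₀ (ModelProd (Base n) (Base s.m))
  ψ_mem : ψ ∈ IsManifold.maximalAtlas ((𝓡 n).prod (𝓡 s.m)) ∞ Y.Y₀
  fibred : ∀ z ∈ ψ.source, Y.proj z ∈ φ.source ∧ (ψ z).1 = φ (Y.proj z)
  triv : ∀ k, Bundle.Trivialization (Fin (s.rk k.1) → ℝ)
    (Bundle.TotalSpace.proj : Bundle.TotalSpace (Fin (s.rk k.1) → ℝ) (Y.E k) → Y.Y₀)
  triv_mem : ∀ k, MemTrivializationAtlas (triv k)
  source_subset : ∀ k, ψ.source ⊆ (triv k).baseSet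

namespace AdaptedChart

variable {Y : GradedBundle n s M}

/-- The jets of `Y₀` over the chart, in coordinates. -/
def dom (c : AdaptedChart Y) : Set (Jet n s) := {j | j.pt ∈ c.ψ.target}

/-- The point of `Y₀` under a jet. -/
def toY₀ (c : AdaptedChart Y) (j : Jet n s) : Y.Y₀ := c.ψ.symm j.pt

/-- The jets over the intersection of two charts, in the coordinates of the first one. -/
def overlap (c c' : AdaptedChart Y) : Set (Jet n s) := {j ∈ c.dom | c.toY₀ j ∈ c'.ψ.source}

/-- The change of base coordinates from `c` to `c'`. -/
def baseChange (c c' : AdaptedChart Y) (x : Base n) : Base n := c'.φ (c.φ.symm x)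

/-- The vector field `∂/∂x'^μ` of the chart `c'`, in the coordinates of `c`. -/
def partial' (c c' : AdaptedChart Y) (μ : Fin n) (x : Base n) : Base n :=
  fderiv ℝ (c'.baseChange c) (c.baseChange c' x) (EuclideanSpace.single μ 1)

/-- The coordinate `u'^a` of degree zero of `c'`, in the coordinates of `c`. -/
def coord₀ (c c' : AdaptedChart Y) (a : Fin s.m) (j : Jet n s) : ℝ := (c'.ψ (c.toY₀ j)).2 a

/-- The coordinate `θ'^a` of nonzero degree of `c'`, in the coordinates of `c`: `g^a_b θ^b`. -/
def coord₁ (c c' : AdaptedChart Y) (a : s.Graded) (j : Jet n s) : VAlg n s :=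
  ∑ b : Fin (s.rk a.1.1),
    ((c'.triv a.1) ((c.triv a.1).toOpenPartialHomeomorph.symm (c.toY₀ j, Pi.single b 1))).2 a.2 •
      gen (Sum.inl (⟨a.1, b⟩, 0))

/-- All fibre coordinates of `c'`, as local functions in the coordinates of `c`. -/
def coord (c c' : AdaptedChart Y) : s.Field → Jet n s → VAlg n s
  | Sum.inl a => fun j => algebraMap ℝ (VAlg n s) (c.coord₀ c' a j)
  | Sum.inr a => c.coord₁ c' a

/-- The jet coordinates `u'^a_I` of degree zero of `c'`, in the coordinates of `c`. -/
def jetCoord₀ (c c' : AdaptedChart Y) (a : Fin s.m) (I : MIdx n) : Jet n s → ℝ :=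
  iterMulti (fun μ f j => totalDeriv₀ (c.partial' c' μ j.1) f j) I (c.coord₀ c' a)

/-- The jet coordinates `θ'^a_I` of nonzero degree of `c'`, in the coordinates of `c`. -/
def jetCoord₁ (c c' : AdaptedChart Y) (a : s.Graded) (I : MIdx n) : Jet n s → VAlg n s :=
  iterMulti (fun μ f j => totalDeriv (c.partial' c' μ j.1) f j) I (c.coord₁ c' a)

/-- The change of jet coordinates from `c` to `c'`. -/
def jetChange (c c' : AdaptedChart Y) (j : Jet n s) : Jet n s :=
  (c.baseChange c' j.1, fun a I => c.jetCoord₀ c' a I j)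

/-- The generators `θ'^a_I` and `δu'^a_I` of `c'`, in the coordinates of `c`. -/
def genChange (c c' : AdaptedChart Y) : Gen n s → Jet n s → VAlg n s
  | Sum.inl (a, I) => c.jetCoord₁ c' a I
  | Sum.inr (Sum.inl a, I) => vertD fun j => algebraMap ℝ (VAlg n s) (c.jetCoord₀ c' a I j)
  | Sum.inr (Sum.inr a, I) => vertD (c.jetCoord₁ c' a I)

/-- `T` is the substitution of the generators of `c'` by their expressions in the coordinates of
`c` at the jet `j`. (The generators generate, so there is at most one such `T`.) -/
def IsSubst (c c' : AdaptedChart Y) (j : Jet n s) (T : VAlg n s →ₐ[ℝ] VAlg n s) : Prop :=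
  ∀ g, T (gen g) = c.genChange c' g j

end AdaptedChart

/-! ### Local forms and local vector fields -/

/-- A family of coordinate expressions, one for each adapted chart. The vectors in `Fin p → Base n`
are the horizontal arguments. -/
abbrev RawForm (Y : GradedBundle n s M) (p : ℕ) : Type _ :=
  AdaptedChart Y → Jet n s → (Fin p → Base n) → VAlg n s

/-- A local form of horizontal degree `p`: coordinate expressions in all adapted charts that agree
on overlaps. -/
structure LocalForm (Y : GradedBundle n s M) (p : ℕ) where
  rep : AdaptedChart Y → Jet n s → (Base n) [⋀^Fin p]→ₗ[ℝ] VAlg n s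
  isLocal : ∀ c, IsLocalOn c.dom (rep c)
  compat : ∀ c c' : AdaptedChart Y, ∀ j ∈ c.overlap c', ∃ T, c.IsSubst c' j T ∧
    ∀ v, rep c j v =
      T (rep c' (c.jetChange c' j) fun i => fderiv ℝ (c.baseChange c') j.1 (v i))

/-- A vertical local vector field of ghost degree `d`, through its components `X^a` in all adapted
charts; they are local functions of ghost degree `d(u^a) + d` and transform as `X'^a = X(u'^a)`. -/
structure VertField (Y : GradedBundle n s M) (d : ℤ) where
  comp : AdaptedChart Y → s.Field → Jet n s → VAlg n s
  isLocal : ∀ c a, IsLocalOn c.dom (comp c a)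
  degree : ∀ c a, ∀ j ∈ c.dom, comp c a j ∈ bideg n s 0 (s.deg a + d)
  compat : ∀ c c' : AdaptedChart Y, ∀ j ∈ c.overlap c', ∃ T, c.IsSubst c' j T ∧
    ∀ a, T (comp c' a (c.jetChange c' j)) = contr (comp c) (vertD (c.coord c' a)) j

variable {Y : GradedBundle n s M} {p : ℕ}

/-- The coordinate expressions of a local form. -/
def LocalForm.raw (α : LocalForm Y p) : RawForm Y p := fun c j v => α.rep c j v

namespace RawForm

/-- Equality of coordinate expressions over the domains of the charts. -/
def Agree (α β : RawForm Y p) : Prop := ∀ c, ∀ j ∈ c.dom, ∀ v, α c j v = β c j v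

/-- Horizontal differential, `dx^μ ∧ D_μ`. -/
def dh (α : RawForm Y p) : RawForm Y (p + 1) := fun c j v =>
  ∑ i : Fin (p + 1), (-1 : ℝ) ^ (i : ℕ) •
    totalDeriv (v i) (fun j' => α c j' fun l => v (i.succAbove l)) j

/-- Vertical differential. -/
def dv (α : RawForm Y p) : RawForm Y p := fun c j v => vertD (fun j' => α c j' v) j

/-- Contraction with a vertical local vector field. -/
def ins {d : ℤ} (X : VertField Y d) (α : RawForm Y p) : RawForm Y p := fun c j v =>
  contr (X.comp c) (fun j' => α c j' v) j

/-- Lie derivative along a vertical local vector field. -/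
def lie {d : ℤ} (X : VertField Y d) (α : RawForm Y p) : RawForm Y p := fun c j v =>
  lieD d (X.comp c) (fun j' => α c j' v) j

/-- Interior Euler operator on forms of vertical degree `q` (and of top horizontal degree). -/
def interiorEuler (q : ℕ) (α : RawForm Y n) : RawForm Y n := fun c j v =>
  euler q (fun j' => α c j' v) j

/-- `α` has vertical degree `q` and ghost degree `r`. -/
def HasDegree (q : ℕ) (r : ℤ) (α : RawForm Y p) : Prop :=
  ∀ c, ∀ j ∈ c.dom, ∀ v, α c j v ∈ bideg n s q r

/-- `α` is `d_h` of a local form of vertical degree `q` and ghost degree `r`. There are no forms of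
negative horizontal degree, so that in horizontal degree `0` only zero is exact. -/
def IsExact (q : ℕ) (r : ℤ) : {p : ℕ} → RawForm Y p → Prop
  | 0, α => Agree α 0
  | p + 1, α => ∃ β : LocalForm Y p, HasDegree q r β.raw ∧ Agree (dh β.raw) α

/-- Equality up to a `d_h`-exact term (for forms of vertical degree `q` and ghost degree `r`). -/
def DhEquiv (q : ℕ) (r : ℤ) (α β : RawForm Y p) : Prop := IsExact q r (α - β)

end RawForm

open RawForm

/-- `X² = 0`, that is, `X(X^a) = 0` for all components (for a field `X` of degree one). -/
def VertField.IsCohomological (X : VertField Y 1) : Prop :=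
  ∀ c a, ∀ j ∈ c.dom, contr (X.comp c) (vertD (X.comp c a)) j = 0

/-- `X = 0`. -/
def VertField.IsZero {d : ℤ} (X : VertField Y d) : Prop :=
  ∀ c a, ∀ j ∈ c.dom, X.comp c a j = 0

/-- BV symplectic local forms: functional forms of degree `(n, 2, -1)` that are `d_v`-closed up to
`d_h`-exact terms and nondegenerate with respect to vertical local vector fields. -/
structure IsBVSymplectic (Ω : LocalForm Y n) : Prop where
  degree : HasDegree 2 (-1) Ω.raw
  closed : DhEquiv 3 (-1) (dv Ω.raw) 0
  functional : Agree (interiorEuler 2 Ω.raw) Ω.raw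
  nondegenerate : ∀ (d : ℤ) (X : VertField Y d), DhEquiv 1 (-1 + d) (ins X Ω.raw) 0 → X.IsZero

/-- The ascent equations `(Lie_Q - (-1)^{q+r} d_h) ∑_p α^{(p)} = 0` for a sequence of forms
`α^{(p)}` of degree `(n-p, q, p+r)`. The sequence is indexed by the horizontal degree `h = n - p`. -/
structure IsAscendant (Q : VertField Y 1) (q : ℕ) (r : ℤ) (α : ∀ h : ℕ, LocalForm Y h) : Prop where
  degree : ∀ h ≤ n, HasDegree q ((n : ℤ) - h + r) (α h).raw
  ascent : ∀ h < n, Agree (lie Q (α (h + 1)).raw -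
    ((Int.negOnePow (q + r) : ℤˣ) : ℤ) • dh (α h).raw) 0
  ascent_zero : Agree (lie Q (α 0).raw) 0

variable (Y) in
/-- An `m`-extended BV-BFV Lagrangian field theory on `Y`. All sequences are indexed by the
horizontal degree `h = n - p`; that is, `L h`, `γ h`, `Ω h` are `𝓛^{(n-h)}`, `γ^{(n-h)}`,
`ω^{(n-h)}`, and `L n` is the Lagrangian. -/
structure ExtendedBVBFV (m : ℕ) where
  m_le : m ≤ n
  /-- the cohomological vector field -/
  Q : VertField Y 1
  L : ∀ h : ℕ, LocalForm Y h
  γ : ∀ h : ℕ, LocalForm Y h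
  Ω : ∀ h : ℕ, LocalForm Y h
  L_degree : ∀ h ≤ n, HasDegree 0 ((n : ℤ) - h) (L h).raw
  γ_degree : ∀ h ≤ n, HasDegree 1 ((n : ℤ) - h - 1) (γ h).raw
  cohomological : Q.IsCohomological
  /-- `Q` is a Noether symmetry of the Lagrangian -/
  noether : DhEquiv 0 1 (lie Q (L n).raw) 0
  symplectic : IsBVSymplectic (Ω n)
  ascendant : IsAscendant Q 2 (-1) Ω
  /-- `ω^{(p)} = d_v γ^{(p)}` for `p ≤ m` -/
  potential : ∀ h ≤ n, n ≤ h + m → Agree (Ω h).raw (dv (γ h).raw)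
  /-- `ω^{(p)} = 0` for `p > m` -/
  vanishing : ∀ h, h + m < n → Agree (Ω h).raw 0
  /-- `ι_Q ω^{(p)} = d_v 𝓛^{(p)} + d_h γ^{(p+1)}` for `p = 0, …, n - 1` -/
  structural : ∀ h < n, Agree (ins Q (Ω (h + 1)).raw) (dv (L (h + 1)).raw + dh (γ h).raw)
  /-- `ι_Q ω^{(n)} = d_v 𝓛^{(n)}` -/
  structural_zero : Agree (ins Q (Ω 0).raw) (dv (L 0).raw)

variable (n M) in
/-- A volume form on `M`: a smooth nowhere vanishing `n`-form. -/
structure VolumeForm where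
  form : ∀ x : M, (TangentSpace (𝓡 n) x) [⋀^Fin n]→ₗ[ℝ] ℝ
  ne_zero : ∀ x, form x ≠ 0
  /-- the expression of the form in a chart of `M` is smooth -/
  smooth : ∀ φ ∈ IsManifold.maximalAtlas (𝓡 n) ∞ M, ∀ v : Fin n → Base n,
    ContDiffOn ℝ ∞
      (fun x : Base n => form (φ.symm x) fun i => mfderiv (𝓡 n) (𝓡 n) φ.symm x (v i)) φ.target

/-- In all adapted coordinates, `ω = ω_{ab} δu^a ∧ δu^b ∧ ν` with local functions `ω_{ab}`. -/
def HasCanonicalForm (Ω : LocalForm Y n) (ν : VolumeForm n M) : Prop :=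
  ∀ c : AdaptedChart Y, ∃ w : s.Field → s.Field → Jet n s → VAlg n s,
    (∀ a b, IsLocalOn c.dom (w a b)) ∧
    (∀ a b, ∀ j ∈ c.dom, w a b j ∈ bideg n s 0 (-1 - s.deg a - s.deg b)) ∧
    ∀ j ∈ c.dom, ∀ v, Ω.raw c j v =
      ν.form (c.φ.symm j.1) (fun i => mfderiv (𝓡 n) (𝓡 n) c.φ.symm j.1 (v i)) •
        ∑ a, ∑ b, w a b j * gen (Sum.inr (a, 0)) * gen (Sum.inr (b, 0))

end Bundle

section Boundary

variable {k : ℕ} {s : FibreType} {M : Type*} [TopologicalSpace M] [ChartedSpace (Base (k + 1)) M]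
  {Y : GradedBundle (k + 1) s M}

open RawForm

/-- The Euler-Lagrange form `𝓘(d_v L)`. -/
def eulerLagrange (L : LocalForm Y (k + 1)) : RawForm Y (k + 1) := interiorEuler 1 (dv L.raw)

/-- `γ` is a boundary form of the Lagrangian `L`: it has degree `(n-1, 1, 0)`, where `n = k + 1`, and
`d_v L = EL + d_h γ`. -/
structure IsBoundaryForm (L : LocalForm Y (k + 1)) (γ : LocalForm Y k) : Prop where
  degree : HasDegree 1 0 γ.raw
  eq : Agree (dv L.raw) (eulerLagrange L + dh γ.raw)

end Boundary

end

noncomputable section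

namespace Variational

/-! ### The graded algebra of vertical forms -/

section Instances

variable {n : ℕ} {s : FibreType}

/-! The proof shows that `γ + γ^{(1)}` is `d_h`-closed and then that closed local forms of vertical
degree one and horizontal degree `n - 1` are `d_h`-exact on all of `Y` (and zero if `n = 1`).

Closedness. Since `ω^{(0)}` contains only the undifferentiated `δu^a`, and the components of `Q` and
their total derivatives have vertical degree zero, `ι_Q ω^{(0)}` is a source form: it involves no
`δu^a_I` with `I ≠ 0`. The interior Euler operator in vertical degree one fixes source forms and
kills `d_h`-exact forms. Applied to `ι_Q ω^{(0)} = d_v L + d_h γ^{(1)}` it gives `EL = ι_Q ω^{(0)}`,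
and comparison with `d_v L = EL + d_h γ` leaves `d_h (γ + γ^{(1)}) = 0`. This is
`dh_boundaryForm_add`.

Exactness. Contract a form of horizontal degree `p + 1` by `K = ∑_μ Λ_μ ι_{∂_μ}`, where `Λ_μ` sends
`δu_I` to `I_μ δu_{I-μ}` plus terms of lower order. For a closed form `a` of order at most `r` in
the `δu_I`, a computation of Koszul type with the leading coefficients (`symbol_identity`,
`altDh_lowK_sub_mem`) gives `d_h K a = (r + n - (p + 1)) a` modulo order below `r`. For `n = p + 2`
the factor is `r + 1`, so `1 - d_h K / (r + 1)` lowers the order of closed forms. All these factors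
are polynomials in `d_h K`, hence commute, and the product over `1 ≤ i ≤ N` annihilates every closed
form of order below `N` (`hiter_eq_zero`). Expanding the product as a telescoping sum exhibits `a`
as `d_h` of an explicit finite sum (`altDh_hprim`).

Globalization. Primitives cannot simply be glued, so `K` itself is made independent of coordinates.
For a function `f` on the base, the derivation `δu^a_I ↦ D_I (f δu^a)` commutes with total
derivatives and is multiplication by `f` on the `δu'^a` of any adapted chart; hence it is natural,
and so is its lowering part, obtained by subtracting multiplication by `f` (`lowOp_subst`). With a
partition of unity `ρ_i` subordinate to charts with coordinates `y_i^κ`, the sum over `i` and `κ` of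
`ρ_i` times the lowering part of `y_i^κ` after contraction with `∂/∂y_i^κ` is a global `K` with the
required leading term (`puZeta_lead`, `lowK_subst`). Since `d_h` is natural as well (`altDh_subst`),
the chartwise primitives agree on overlaps (`exists_primitive`).

The remaining effort is calculus on the infinite jet space with values in an algebra without
topology: everything reduces to smooth functions of finitely many coordinates and to finite sums of
constant vectors. -/

set_option synthInstance.maxHeartbeats 200000 in
instance instRingVAlg : Ring (VAlg n s) := inferInstance

set_option synthInstance.maxHeartbeats 200000 in
instance instAlgebraVAlg : Algebra ℝ (VAlg n s) := inferInstance

set_option synthInstance.maxHeartbeats 200000 in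
instance instAddCommGroupVAlg : AddCommGroup (VAlg n s) := inferInstance

set_option synthInstance.maxHeartbeats 200000 in
instance instModuleVAlg : Module ℝ (VAlg n s) := inferInstance

instance instAddCommMonoidVAlg : AddCommMonoid (VAlg n s) := inferInstance

instance instSMulVAlg : SMul ℝ (VAlg n s) := inferInstance

end Instances

section Algebra

variable {n : ℕ} {s : FibreType}

open Classical in
/-- The sign picked up when two generators are exchanged. -/
def koszulSign (g h : Gen n s) : ℝ := if ¬ g.IsEven ∧ ¬ h.IsEven then -1 else 1

theorem koszulSign_mul_self (g h : Gen n s) : koszulSign g h * koszulSign g h = 1 := by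
  unfold koszulSign; split_ifs <;> norm_num

open Classical in
theorem koszulSign_congr {g g' h h' : Gen n s} (hg : g.IsEven ↔ g'.IsEven)
    (hh : h.IsEven ↔ h'.IsEven) : koszulSign g h = koszulSign g' h' := by
  unfold koszulSign; exact if_congr (by rw [hg, hh]) rfl rfl

theorem gen_of_even {g : Gen n s} (h : g.IsEven) :
    gen g = MvPolynomial.X ⟨g, h⟩ ⊗ₜ[ℝ] 1 := by simp [gen, h]

theorem gen_of_odd {g : Gen n s} (h : ¬ g.IsEven) :
    gen g = 1 ⊗ₜ[ℝ] ExteriorAlgebra.ι ℝ (Finsupp.single ⟨g, h⟩ 1) := by simp [gen, h]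

theorem gen_mul_gen (g h : Gen n s) : gen g * gen h = koszulSign g h • (gen h * gen g) := by
  by_cases hg : g.IsEven <;> by_cases hh : h.IsEven
  · simp [gen_of_even hg, gen_of_even hh, koszulSign, hg, mul_comm]
  · simp [gen_of_even hg, gen_of_odd hh, koszulSign, hg]
  · simp [gen_of_odd hg, gen_of_even hh, koszulSign, hh]
  · simp only [gen_of_odd hg, gen_of_odd hh, koszulSign, hg, hh, not_false_eq_true, and_self,
      if_true, Algebra.TensorProduct.tmul_mul_tmul, mul_one, neg_smul, one_smul]
    rw [← TensorProduct.tmul_neg, eq_neg_of_add_eq_zero_left (ExteriorAlgebra.ι_add_mul_swap _ _)]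

theorem pd_even_tmul {g : Gen n s} (hg : g.IsEven) (p : MvPolynomial {g : Gen n s // g.IsEven} ℝ)
    (e : ExteriorAlgebra ℝ ({g : Gen n s // ¬ g.IsEven} →₀ ℝ)) :
    pd g (p ⊗ₜ[ℝ] e) = MvPolynomial.pderiv ⟨g, hg⟩ p ⊗ₜ[ℝ] e := by
  rw [pd, dif_pos hg]; rfl

theorem pd_odd_tmul {g : Gen n s} (hg : ¬ g.IsEven)
    (p : MvPolynomial {g : Gen n s // g.IsEven} ℝ)
    (e : ExteriorAlgebra ℝ ({g : Gen n s // ¬ g.IsEven} →₀ ℝ)) :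
    pd g (p ⊗ₜ[ℝ] e) = p ⊗ₜ[ℝ] (CliffordAlgebra.contractLeft
      (Q := (0 : QuadraticForm ℝ ({g : Gen n s // ¬ g.IsEven} →₀ ℝ)))
        (Finsupp.lapply ⟨g, hg⟩) e) := by
  rw [pd, dif_neg hg]; rfl

theorem gen_even_mul_tmul {g : Gen n s} (hg : g.IsEven)
    (p : MvPolynomial {g : Gen n s // g.IsEven} ℝ)
    (e : ExteriorAlgebra ℝ ({g : Gen n s // ¬ g.IsEven} →₀ ℝ)) :
    gen g * (p ⊗ₜ[ℝ] e) = (MvPolynomial.X ⟨g, hg⟩ * p) ⊗ₜ[ℝ] e := by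
  rw [gen_of_even hg, Algebra.TensorProduct.tmul_mul_tmul, one_mul]

theorem gen_odd_mul_tmul {g : Gen n s} (hg : ¬ g.IsEven)
    (p : MvPolynomial {g : Gen n s // g.IsEven} ℝ)
    (e : ExteriorAlgebra ℝ ({g : Gen n s // ¬ g.IsEven} →₀ ℝ)) :
    gen g * (p ⊗ₜ[ℝ] e) = p ⊗ₜ[ℝ] (ExteriorAlgebra.ι ℝ (Finsupp.single ⟨g, hg⟩ 1) * e) := by
  rw [gen_of_odd hg, Algebra.TensorProduct.tmul_mul_tmul, one_mul]

theorem contractLeft_exteriorι_mul {M : Type*} [AddCommGroup M] [Module ℝ M] (d : Module.Dual ℝ M)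
    (a : M) (e : ExteriorAlgebra ℝ M) :
    CliffordAlgebra.contractLeft (Q := (0 : QuadraticForm ℝ M)) d (ExteriorAlgebra.ι ℝ a * e) =
      d a • e - ExteriorAlgebra.ι ℝ a *
        CliffordAlgebra.contractLeft (Q := (0 : QuadraticForm ℝ M)) d e :=
  CliffordAlgebra.contractLeft_ι_mul d a e

open Classical in
-- Polynomial partial derivatives are derivations and contractions are antiderivations of the
-- exterior algebra, whence the sign. This graded Leibniz rule is the only property of `pd` on
-- products that is needed: together with `pd_one` and induction over products of generators it
-- determines everything.
theorem pd_gen_mul (g h : Gen n s) (x : VAlg n s) :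
    pd g (gen h * x) = (if g = h then x else 0) + koszulSign g h • (gen h * pd g x) := by
  induction x using TensorProduct.induction_on with
  | zero => simp
  | add x y hx hy =>
    rw [mul_add, map_add, hx, hy, map_add, mul_add, smul_add]
    split_ifs
    · abel
    · abel
  | tmul p e =>
    by_cases hg : g.IsEven
    · have hs : koszulSign g h = 1 := by simp [koszulSign, hg]
      rw [hs, one_smul, pd_even_tmul hg]
      by_cases hh : h.IsEven
      · rw [gen_even_mul_tmul hh, gen_even_mul_tmul hh, pd_even_tmul hg, Derivation.leibniz,
          smul_eq_mul, smul_eq_mul, TensorProduct.add_tmul, add_comm]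
        congr 1
        split_ifs with he
        · subst he; rw [MvPolynomial.pderiv_X_self, mul_one]
        · rw [MvPolynomial.pderiv_X_of_ne (by simpa using Ne.symm he), mul_zero,
            TensorProduct.zero_tmul]
      · have he : g ≠ h := by rintro rfl; exact hh hg
        rw [gen_odd_mul_tmul hh, gen_odd_mul_tmul hh, pd_even_tmul hg, if_neg he, zero_add]
    · rw [pd_odd_tmul hg]
      by_cases hh : h.IsEven
      · have he : g ≠ h := by rintro rfl; exact hg hh
        have hs : koszulSign g h = 1 := by simp [koszulSign, hh]
        rw [gen_even_mul_tmul hh, gen_even_mul_tmul hh, pd_odd_tmul hg, if_neg he, zero_add, hs,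
          one_smul]
      · have hs : koszulSign g h = -1 := by simp [koszulSign, hg, hh]
        rw [gen_odd_mul_tmul hh, gen_odd_mul_tmul hh, pd_odd_tmul hg, contractLeft_exteriorι_mul,
          TensorProduct.tmul_sub, sub_eq_add_neg, hs, neg_smul, one_smul]
        congr 1
        split_ifs with he
        · subst he; simp
        · rw [Finsupp.lapply_apply, Finsupp.single_eq_of_ne (by simpa using he), zero_smul,
            TensorProduct.tmul_zero]

theorem pd_one (g : Gen n s) : pd g (1 : VAlg n s) = 0 := by
  by_cases hg : g.IsEven
  · simp [pd, hg, Algebra.TensorProduct.one_def]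
  · simp [pd, hg, Algebra.TensorProduct.one_def]

open Classical in
theorem pd_gen (g h : Gen n s) : pd g (gen h) = if g = h then (1 : VAlg n s) else 0 := by
  have := pd_gen_mul g h 1
  simpa [pd_one] using this

/-- Each tensor factor is generated by its variables, and a pure tensor is the product of its two
factors; hence the subalgebra generated by the `gen g` is everything. -/
theorem span_prod_gen :
    Submodule.span ℝ (Set.range fun l : List (Gen n s) => (l.map gen).prod) = ⊤ := by
  set A : Subalgebra ℝ (VAlg n s) := Algebra.adjoin ℝ (Set.range gen) with hA
  have h1 : ∀ p : MvPolynomial {g : Gen n s // g.IsEven} ℝ, p ⊗ₜ[ℝ] 1 ∈ A := by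
    intro p
    have : (Algebra.TensorProduct.includeLeft : _ →ₐ[ℝ] VAlg n s) p ∈
        (⊤ : Subalgebra ℝ (MvPolynomial {g : Gen n s // g.IsEven} ℝ)).map
          Algebra.TensorProduct.includeLeft := ⟨p, trivial, rfl⟩
    rw [← MvPolynomial.adjoin_range_X, AlgHom.map_adjoin] at this
    refine Algebra.adjoin_mono ?_ this
    rintro _ ⟨_, ⟨g, rfl⟩, rfl⟩
    exact ⟨g.1, gen_of_even g.2⟩
  have h2 : ∀ e : ExteriorAlgebra ℝ ({g : Gen n s // ¬ g.IsEven} →₀ ℝ), 1 ⊗ₜ[ℝ] e ∈ A := by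
    intro e
    induction e using ExteriorAlgebra.induction with
    | algebraMap r =>
      have : (1 : MvPolynomial {g : Gen n s // g.IsEven} ℝ) ⊗ₜ[ℝ]
          (algebraMap ℝ (ExteriorAlgebra ℝ ({g : Gen n s // ¬ g.IsEven} →₀ ℝ)) r) =
          algebraMap ℝ (VAlg n s) r := by
        rw [Algebra.algebraMap_eq_smul_one, Algebra.algebraMap_eq_smul_one, TensorProduct.tmul_smul]
        rfl
      rw [this]; exact A.algebraMap_mem r
    | ι m =>
      induction m using Finsupp.induction_linear with
      | zero => simp
      | add a b ha hb => rw [map_add, TensorProduct.tmul_add]; exact A.add_mem ha hb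
      | single g r =>
        have : (Finsupp.single g r : {g : Gen n s // ¬ g.IsEven} →₀ ℝ) =
          r • Finsupp.single g 1 := by simp
        rw [this, map_smul, TensorProduct.tmul_smul, ← gen_of_odd g.2]
        exact A.smul_mem (Algebra.subset_adjoin ⟨_, rfl⟩) r
    | mul a b ha hb =>
      have : (1 : MvPolynomial {g : Gen n s // g.IsEven} ℝ) ⊗ₜ[ℝ] (a * b) =
        (1 ⊗ₜ a) * (1 ⊗ₜ b) := by simp
      rw [this]; exact A.mul_mem ha hb
    | add a b ha hb => rw [TensorProduct.tmul_add]; exact A.add_mem ha hb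
  have h3 : (⊤ : Submodule ℝ (VAlg n s)) ≤ Subalgebra.toSubmodule A := by
    rintro x -
    induction x using TensorProduct.induction_on with
    | zero => exact A.zero_mem
    | add x y hx hy => exact A.add_mem hx hy
    | tmul p e =>
      have : p ⊗ₜ[ℝ] e = (p ⊗ₜ[ℝ] 1) * (1 ⊗ₜ[ℝ] e) := by simp
      rw [this]; exact A.mul_mem (h1 p) (h2 e)
  rw [eq_top_iff]
  refine h3.trans ?_
  rw [hA, Algebra.adjoin_eq_span]
  refine Submodule.span_mono ?_
  intro x hx
  induction hx using Submonoid.closure_induction with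
  | mem x hx => obtain ⟨g, rfl⟩ := hx; exact ⟨[g], by simp⟩
  | one => exact ⟨[], by simp⟩
  | mul x y _ _ hx hy =>
    obtain ⟨l, rfl⟩ := hx; obtain ⟨l', rfl⟩ := hy
    exact ⟨l ++ l', by simp⟩

/-- Induction over products of generators. -/
theorem VAlg_induction {P : VAlg n s → Prop} (zero : P 0) (add : ∀ x y, P x → P y → P (x + y))
    (smul : ∀ (r : ℝ) x, P x → P (r • x)) (one : P 1) (gen_mul : ∀ g x, P x → P (gen g * x))
    (x : VAlg n s) : P x := by
  have hx : x ∈ Submodule.span ℝ (Set.range fun l : List (Gen n s) => (l.map gen).prod) := by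
    rw [span_prod_gen]; trivial
  induction hx using Submodule.span_induction with
  | mem x hx =>
    obtain ⟨l, rfl⟩ := hx
    induction l with
    | nil => simpa using one
    | cons g l ih => simpa using gen_mul g _ ih
  | zero => exact zero
  | add x y _ _ hx hy => exact add x y hx hy
  | smul r x _ hx => exact smul r x hx

/-- A `finsum` with infinite support is zero by convention; this finiteness is what makes the sums
over all generators below the intended ones. -/
theorem pd_support_finite (x : VAlg n s) : {g | pd g x ≠ 0}.Finite := by
  classical
  induction x using VAlg_induction with
  | zero => simp
  | add x y hx hy =>
    refine (hx.union hy).subset fun g hg => ?_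
    by_contra h
    simp only [Set.mem_union, Set.mem_ofPred_eq, not_or, not_not] at h
    exact hg (by rw [map_add, h.1, h.2, add_zero])
  | smul r x hx =>
    refine hx.subset fun g hg h => hg ?_
    rw [map_smul, h, smul_zero]
  | one => simp [pd_one]
  | gen_mul h x hx =>
    refine (hx.union (Set.finite_singleton h)).subset fun g hg => ?_
    by_contra h'
    simp only [Set.mem_union, Set.mem_ofPred_eq, not_or, not_not, Set.mem_singleton_iff] at h'
    exact hg (by simp [pd_gen_mul, h'.1, h'.2])

theorem mul_pd_support_finite (Z : Gen n s → VAlg n s) (x : VAlg n s) :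
    (Function.support fun g => Z g * pd g x).Finite :=
  (pd_support_finite x).subset fun g hg h => hg (by simp [h])

/-- The operator `∑ Z^g ∂/∂g`. -/
def der (Z : Gen n s → VAlg n s) : VAlg n s →ₗ[ℝ] VAlg n s where
  toFun x := ∑ᶠ g, Z g * pd g x
  map_add' x y := by
    rw [← finsum_add_distrib (mul_pd_support_finite Z x) (mul_pd_support_finite Z y)]
    simp [mul_add]
  map_smul' r x := by
    rw [RingHom.id_apply, smul_finsum' r (mul_pd_support_finite Z x)]
    exact finsum_congr fun g => by rw [map_smul, mul_smul_comm]

theorem der_apply (Z : Gen n s → VAlg n s) (x : VAlg n s) : der Z x = ∑ᶠ g, Z g * pd g x := rfl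

theorem der_one (Z : Gen n s → VAlg n s) : der Z 1 = 0 := by simp [der_apply, pd_one]

theorem der_gen (Z : Gen n s → VAlg n s) (g : Gen n s) : der Z (gen g) = Z g := by
  classical
  rw [der_apply, finsum_eq_single _ g]
  · simp [pd_gen]
  · intro h hh; simp [pd_gen, hh]

/-- `x` commutes with the generators in the same way as the generator `g`. -/
def SameParity (g : Gen n s) (x : VAlg n s) : Prop :=
  ∀ h, x * gen h = koszulSign g h • (gen h * x)

theorem SameParity.zero (g : Gen n s) : SameParity g 0 := fun h => by simp

theorem SameParity.add {g : Gen n s} {x y : VAlg n s} (hx : SameParity g x) (hy : SameParity g y) :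
    SameParity g (x + y) := fun h => by rw [add_mul, hx h, hy h, mul_add, smul_add]

theorem SameParity.smul {g : Gen n s} {x : VAlg n s} (r : ℝ) (hx : SameParity g x) :
    SameParity g (r • x) := fun h => by rw [smul_mul_assoc, hx h, mul_smul_comm, smul_comm]

theorem SameParity.sum {ι : Type*} {g : Gen n s} {x : ι → VAlg n s} (t : Finset ι)
    (hx : ∀ i ∈ t, SameParity g (x i)) : SameParity g (∑ i ∈ t, x i) := by
  classical
  induction t using Finset.induction_on with
  | empty => simpa using SameParity.zero g
  | insert i t hi ih =>
    rw [Finset.sum_insert hi]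
    exact (hx i (by simp)).add (ih fun j hj => hx j (by simp [hj]))

theorem SameParity.gen {g g' : Gen n s} (h : g.IsEven ↔ g'.IsEven) : SameParity g (gen g') :=
  fun h' => by rw [gen_mul_gen, koszulSign_congr h Iff.rfl]

/-- The sign from moving `pd g` past `gen h` and the sign from moving `Z g` past `gen h` are equal
and cancel, so an operator whose coefficients have the parity of the generators obeys the Leibniz
rule without signs. -/
theorem der_gen_mul {Z : Gen n s → VAlg n s} (hZ : ∀ g, SameParity g (Z g)) (h : Gen n s)
    (x : VAlg n s) : der Z (gen h * x) = Z h * x + gen h * der Z x := by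
  classical
  have e : ∀ g, Z g * pd g (gen h * x) = (if g = h then Z h * x else 0) + gen h * (Z g * pd g x) := by
    intro g
    rw [pd_gen_mul, mul_add, mul_smul_comm, ← mul_assoc, hZ g h, smul_mul_assoc, smul_smul,
      koszulSign_mul_self, one_smul, mul_assoc]
    congr 1
    split_ifs with h' <;> simp [h']
  rw [der_apply, finsum_congr e, finsum_add_distrib, finsum_eq_single _ h, if_pos rfl, der_apply,
    mul_finsum' _ _ (mul_pd_support_finite Z x)]
  · intro g hg; rw [if_neg hg]
  · exact (Set.finite_singleton h).subset fun g hg => by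
      by_contra h'; exact hg (if_neg h')
  · exact (mul_pd_support_finite Z x).subset fun g hg h' => hg (by simp [h'])

/-- Derivations of the (noncommutative) algebra of vertical forms. -/
def IsDer (L : VAlg n s →ₗ[ℝ] VAlg n s) : Prop := ∀ x y, L (x * y) = L x * y + x * L y

theorem isDer_der {Z : Gen n s → VAlg n s} (hZ : ∀ g, SameParity g (Z g)) : IsDer (der Z) := by
  intro x y
  induction x using VAlg_induction with
  | zero => simp
  | add a b ha hb => rw [add_mul, map_add, ha, hb, map_add, add_mul, add_mul]; abel
  | smul r a ha => simp only [smul_mul_assoc, map_smul, ha, smul_add]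
  | one => simp [der_one]
  | gen_mul g a ha => rw [mul_assoc, der_gen_mul hZ, ha, der_gen_mul hZ]; noncomm_ring

/-! ### Shifts of multi-indices -/

theorem isEven_shift (μ : Fin n) (g : Gen n s) : (g.shift μ).IsEven ↔ g.IsEven := by
  rcases g with g | g <;> rfl

theorem vdeg_shift (μ : Fin n) (g : Gen n s) : (g.shift μ).vdeg = g.vdeg := by
  rcases g with g | g <;> rfl

theorem gdeg_shift (μ : Fin n) (g : Gen n s) : (g.shift μ).gdeg = g.gdeg := by
  rcases g with g | g <;> rfl

/-- The derivation `u_I ↦ u_{I + μ}`, `δu_I ↦ δu_{I + μ}`. -/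
def shiftDer (μ : Fin n) : VAlg n s →ₗ[ℝ] VAlg n s := der fun g => gen (g.shift μ)

theorem sameParity_shift (μ : Fin n) (g : Gen n s) : SameParity g (gen (g.shift μ)) :=
  SameParity.gen (isEven_shift μ g).symm

theorem isDer_shiftDer (μ : Fin n) : IsDer (shiftDer (s := s) μ) := isDer_der (sameParity_shift μ)

theorem shiftDer_gen (μ : Fin n) (g : Gen n s) : shiftDer μ (gen g) = gen (g.shift μ) := der_gen _ _

theorem shiftDer_one (μ : Fin n) : shiftDer μ (1 : VAlg n s) = 0 := der_one _

/-- The left side is the algebraic part of the total derivative; the right side is a finite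
combination of derivations with constant coefficients. -/
theorem finsum_shift (v : Base n) (x : VAlg n s) :
    ∑ᶠ g : Gen n s, (∑ ν, v ν • gen (g.shift ν)) * pd g x = ∑ ν, v ν • shiftDer ν x := by
  have h1 : ∀ g : Gen n s, (∑ ν, v ν • gen (g.shift ν)) * pd g x =
      ∑ ν, v ν • (gen (g.shift ν) * pd g x) := fun g => by
    rw [Finset.sum_mul]; exact Finset.sum_congr rfl fun ν _ => smul_mul_assoc _ _ _
  rw [finsum_congr h1, finsum_sum_comm]
  · refine Finset.sum_congr rfl fun ν _ => ?_
    rw [shiftDer, der_apply, smul_finsum' _ (mul_pd_support_finite _ x)]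
  · intro ν _
    exact (mul_pd_support_finite (fun g => gen (g.shift ν)) x).subset fun g hg h => hg (by simp [h])

/-- The multi-index of a generator. -/
def idx : Gen n s → MIdx n
  | Sum.inl p => p.2
  | Sum.inr p => p.2

/-- `u_I ↦ u_{I - μ}`, `δu_I ↦ δu_{I - μ}` (meaningful for `I μ ≠ 0`). -/
def lower (μ : Fin n) : Gen n s → Gen n s
  | Sum.inl p => Sum.inl (p.1, p.2 - Finsupp.single μ 1)
  | Sum.inr p => Sum.inr (p.1, p.2 - Finsupp.single μ 1)

theorem single_le {μ : Fin n} {I : MIdx n} (h : I μ ≠ 0) : Finsupp.single μ 1 ≤ I := by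
  rw [Finsupp.single_le_iff]; omega

/-- Subtraction of multi-indices is truncated, so lowering inverts the shift only where the `μ`-th
entry is nonzero. -/
theorem eq_shift_iff (μ : Fin n) (g h : Gen n s) :
    g = h.shift μ ↔ idx g μ ≠ 0 ∧ lower μ g = h := by
  have key : ∀ I J : MIdx n, I = J + Finsupp.single μ 1 ↔ I μ ≠ 0 ∧ I - Finsupp.single μ 1 = J := by
    intro I J
    constructor
    · rintro rfl; simp
    · rintro ⟨h, rfl⟩; rw [tsub_add_cancel_of_le (single_le h)]
  rcases g with ⟨a, I⟩ | ⟨a, I⟩ <;> rcases h with ⟨b, J⟩ | ⟨b, J⟩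
  · simp only [Gen.shift, idx, lower, Sum.inl.injEq, Prod.mk.injEq, key]; tauto
  · simp [Gen.shift, lower]
  · simp [Gen.shift, lower]
  · simp only [Gen.shift, idx, lower, Sum.inr.injEq, Prod.mk.injEq, key]; tauto

theorem isEven_lower (μ : Fin n) (g : Gen n s) : (lower μ g).IsEven ↔ g.IsEven := by
  rcases g with g | g <;> rfl

/-- The partial derivative with respect to `u_{I - μ}` (zero if `I μ = 0`). -/
def pdLower (μ : Fin n) (g : Gen n s) : VAlg n s →ₗ[ℝ] VAlg n s :=
  if idx g μ = 0 then 0 else pd (lower μ g)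

/-- The algebraic core of the commutator `[∂/∂u_I, D_μ] = ∂/∂u_{I-μ}`: both sides obey the same
graded Leibniz rule and agree on generators. -/
theorem pd_shiftDer (g : Gen n s) (μ : Fin n) (x : VAlg n s) :
    pd g (shiftDer μ x) = shiftDer μ (pd g x) + pdLower μ g x := by
  classical
  induction x using VAlg_induction with
  | zero => simp
  | add x y hx hy => simp only [map_add, hx, hy]; abel
  | smul r x hx => simp only [map_smul, hx, smul_add]
  | one => by_cases h : idx g μ = 0 <;> simp [pdLower, pd_one, shiftDer_one, h]
  | gen_mul h x hx =>
    have h1 : koszulSign g (h.shift μ) = koszulSign g h :=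
      koszulSign_congr Iff.rfl (isEven_shift μ h)
    have h2 : koszulSign (lower μ g) h = koszulSign g h :=
      koszulSign_congr (isEven_lower μ g) Iff.rfl
    have h3 : pdLower μ g (gen h * x) =
        (if g = h.shift μ then x else 0) + koszulSign g h • (gen h * pdLower μ g x) := by
      by_cases h0 : idx g μ = 0
      · simp [pdLower, h0, eq_shift_iff]
      · simp only [pdLower, h0, if_false, pd_gen_mul, h2, eq_shift_iff, ne_eq, not_false_eq_true,
          true_and]
    rw [isDer_shiftDer, shiftDer_gen, map_add, pd_gen_mul, pd_gen_mul, hx, pd_gen_mul, h1, h3,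
      map_add, map_smul, isDer_shiftDer, shiftDer_gen]
    have h4 : shiftDer μ (if g = h then x else 0) = if g = h then shiftDer μ x else 0 := by
      split_ifs <;> simp
    rw [h4]
    simp only [mul_add, smul_add]
    abel

/-! ### Degrees -/

/-- Elements of vertical degree `q`. -/
def vdegPart (n : ℕ) (s : FibreType) (q : ℕ) : Submodule ℝ (VAlg n s) :=
  Submodule.span ℝ {b | ∃ l : List (Gen n s), (l.map Gen.vdeg).sum = q ∧ b = (l.map gen).prod}

theorem bideg_le_vdegPart (q : ℕ) (r : ℤ) : bideg n s q r ≤ vdegPart n s q :=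
  Submodule.span_mono fun _ ⟨l, h, _, h'⟩ => ⟨l, h, h'⟩

theorem gen_mem_bideg (g : Gen n s) : gen g ∈ bideg n s g.vdeg g.gdeg :=
  Submodule.subset_span ⟨[g], by simp⟩

theorem mul_mem_bideg {q q' : ℕ} {r r' : ℤ} {x y : VAlg n s} (hx : x ∈ bideg n s q r)
    (hy : y ∈ bideg n s q' r') : x * y ∈ bideg n s (q + q') (r + r') := by
  have : x * y ∈ bideg n s q r * bideg n s q' r' := Submodule.mul_mem_mul hx hy
  rw [bideg, bideg, Submodule.span_mul_span] at this
  refine Submodule.span_mono ?_ this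
  rintro _ ⟨_, ⟨l, h1, h2, rfl⟩, _, ⟨l', h1', h2', rfl⟩, rfl⟩
  exact ⟨l ++ l', by simp [h1, h1'], by simp [h2, h2'], by simp⟩

theorem mul_mem_vdegPart {q q' : ℕ} {x y : VAlg n s} (hx : x ∈ vdegPart n s q)
    (hy : y ∈ vdegPart n s q') : x * y ∈ vdegPart n s (q + q') := by
  have : x * y ∈ vdegPart n s q * vdegPart n s q' := Submodule.mul_mem_mul hx hy
  rw [vdegPart, vdegPart, Submodule.span_mul_span] at this
  refine Submodule.span_mono ?_ this
  rintro _ ⟨_, ⟨l, h1, rfl⟩, _, ⟨l', h1', rfl⟩, rfl⟩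
  exact ⟨l ++ l', by simp [h1, h1'], by simp⟩

/-- A derivation that respects the degrees of the generators respects all degrees. -/
theorem der_mem_bideg {L : VAlg n s →ₗ[ℝ] VAlg n s} (hL : IsDer L) (h1 : L 1 = 0)
    (hg : ∀ g, L (gen g) ∈ bideg n s g.vdeg g.gdeg) {q : ℕ} {r : ℤ} {x : VAlg n s}
    (hx : x ∈ bideg n s q r) : L x ∈ bideg n s q r := by
  induction hx using Submodule.span_induction with
  | zero => simp
  | add x y _ _ hx hy => rw [map_add]; exact add_mem hx hy
  | smul c x _ hx => rw [map_smul]; exact Submodule.smul_mem _ _ hx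
  | mem x hx =>
    obtain ⟨l, rfl, rfl, rfl⟩ := hx
    induction l with
    | nil => simp [h1]
    | cons g l ih =>
      simp only [List.map_cons, List.prod_cons, List.sum_cons, hL (gen g)]
      exact add_mem (mul_mem_bideg (hg g) (Submodule.subset_span ⟨l, rfl, rfl, rfl⟩))
        (mul_mem_bideg (gen_mem_bideg g) ih)

theorem shiftDer_mem_bideg (μ : Fin n) {q : ℕ} {r : ℤ} {x : VAlg n s} (hx : x ∈ bideg n s q r) :
    shiftDer μ x ∈ bideg n s q r :=
  der_mem_bideg (isDer_shiftDer μ) (shiftDer_one μ) (fun g => by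
    rw [shiftDer_gen]; simpa [vdeg_shift, gdeg_shift] using gen_mem_bideg (g.shift μ)) hx

theorem pd_inr_eq_zero {p : s.Field × MIdx n} {x : VAlg n s} (hx : x ∈ vdegPart n s 0) :
    pd (Sum.inr p) x = 0 := by
  induction hx using Submodule.span_induction with
  | zero => simp
  | add x y _ _ hx hy => rw [map_add, hx, hy, add_zero]
  | smul c x _ hx => rw [map_smul, hx, smul_zero]
  | mem x hx =>
    obtain ⟨l, h, rfl⟩ := hx
    induction l with
    | nil => simp [pd_one]
    | cons g l ih =>
      simp only [List.map_cons, List.sum_cons, Nat.add_eq_zero_iff] at h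
      rw [List.map_cons, List.prod_cons, pd_gen_mul, ih h.2, if_neg]
      · simp
      · rintro rfl; simp [Gen.vdeg] at h

theorem pd_inr_mem_bideg {p : s.Field × MIdx n} {q : ℕ} {r : ℤ} {x : VAlg n s}
    (hx : x ∈ bideg n s (q + 1) r) : pd (Sum.inr p) x ∈ bideg n s q (r - s.deg p.1) := by
  classical
  induction hx using Submodule.span_induction with
  | zero => simp
  | add x y _ _ hx hy => rw [map_add]; exact add_mem hx hy
  | smul c x _ hx => rw [map_smul]; exact Submodule.smul_mem _ _ hx
  | mem x hx =>
    obtain ⟨l, hq, rfl, rfl⟩ := hx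
    induction l generalizing q with
    | nil => simp at hq
    | cons g l ih =>
      have e : ((g :: l).map gen).prod = (gen g : VAlg n s) * (l.map gen).prod := by simp
      rw [e, pd_gen_mul]
      refine add_mem ?_ (Submodule.smul_mem _ _ ?_)
      · split_ifs with h
        · subst h
          refine Submodule.subset_span ⟨l, ?_, ?_, rfl⟩
          · simp only [List.map_cons, List.sum_cons, Gen.vdeg] at hq; omega
          · simp [Gen.gdeg]
        · exact zero_mem _
      · rw [List.map_cons, List.sum_cons] at hq
        -- The induction hypothesis speaks of positive vertical degree only; if the remaining
        -- factors have vertical degree zero, their derivative vanishes.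
        by_cases h0 : (l.map Gen.vdeg).sum = 0
        · rw [pd_inr_eq_zero (Submodule.subset_span ⟨l, h0, rfl⟩)]; simp
        · obtain ⟨q', hq'⟩ := Nat.exists_eq_succ_of_ne_zero h0
          have := mul_mem_bideg (gen_mem_bideg g) (ih hq')
          rw [List.map_cons, List.sum_cons]
          convert this using 2
          · omega
          · ring

theorem pd_inr_mem_vdegPart {p : s.Field × MIdx n} {x : VAlg n s}
    (hx : x ∈ vdegPart n s 1) : pd (Sum.inr p) x ∈ vdegPart n s 0 := by
  classical
  induction hx using Submodule.span_induction with
  | zero => simp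
  | add x y _ _ hx hy => rw [map_add]; exact add_mem hx hy
  | smul c x _ hx => rw [map_smul]; exact Submodule.smul_mem _ _ hx
  | mem x hx =>
    obtain ⟨l, hq, rfl⟩ := hx
    exact bideg_le_vdegPart _ _ (pd_inr_mem_bideg (Submodule.subset_span ⟨l, hq, rfl, rfl⟩))

/-- The derivation that counts the vertical one-forms. -/
def vertNum : VAlg n s →ₗ[ℝ] VAlg n s := der fun g => (g.vdeg : ℝ) • gen g

theorem isDer_vertNum : IsDer (vertNum (n := n) (s := s)) :=
  isDer_der fun _ => (SameParity.gen Iff.rfl).smul _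

theorem vertNum_gen (g : Gen n s) : vertNum (gen g) = (g.vdeg : ℝ) • gen g := der_gen _ _

/-- Euler's identity for homogeneous elements. For `q = 1` it recovers an element from its
derivatives along the vertical one-forms. -/
theorem vertNum_of_mem {q : ℕ} {x : VAlg n s} (hx : x ∈ vdegPart n s q) :
    vertNum x = (q : ℝ) • x := by
  induction hx using Submodule.span_induction with
  | zero => simp
  | add x y _ _ hx hy => rw [map_add, hx, hy, smul_add]
  | smul c x _ hx => rw [map_smul, hx, smul_comm]
  | mem x hx =>
    obtain ⟨l, rfl, rfl⟩ := hx
    induction l with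
    | nil => simp [vertNum, der_one]
    | cons g l ih =>
      simp only [List.map_cons, List.prod_cons, isDer_vertNum (gen g), ih, vertNum_gen,
        List.sum_cons, Nat.cast_add, add_smul, smul_mul_assoc, mul_smul_comm]

theorem finsum_inr_eq {F : Type*} [AddCommMonoid F] (f : Gen n s → F)
    (h : ∀ p, f (Sum.inl p) = 0) : ∑ᶠ g, f g = ∑ᶠ p, f (Sum.inr p) := by
  rw [← finsum_mem_range Sum.inr_injective, ← finsum_mem_univ]
  refine finsum_mem_inter_support_eq f _ _ ?_
  ext (p | p)
  · simp [h p]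
  · simp

theorem der_eq_finsum_inr {Z : Gen n s → VAlg n s} (hZ : ∀ p, Z (Sum.inl p) = 0) (x : VAlg n s) :
    der Z x = ∑ᶠ p, Z (Sum.inr p) * pd (Sum.inr p) x := by
  rw [der_apply, finsum_inr_eq _ fun p => by rw [hZ, zero_mul]]

/-- The expansion of an element of vertical degree one. -/
theorem eq_finsum_inr {x : VAlg n s} (hx : x ∈ vdegPart n s 1) :
    x = ∑ᶠ p, gen (Sum.inr p) * pd (Sum.inr p) x := by
  have := vertNum_of_mem hx
  rw [Nat.cast_one, one_smul, vertNum, der_eq_finsum_inr] at this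
  · rw [← this]
    nth_rewrite 2 [this]
    simp [Gen.vdeg]
  · intro p; simp [Gen.vdeg]

end Algebra

/-! ### Smooth functions of finitely many jet coordinates -/

section Calculus

variable {n : ℕ} {s : FibreType}

/-- The jets over an open set of the coordinate space. -/
def cyl (U : Set (ModelProd (Base n) (Base s.m))) : Set (Jet n s) := {j | j.pt ∈ U}

theorem cyl_mono {U V : Set (ModelProd (Base n) (Base s.m))} (h : U ⊆ V) : cyl U ⊆ cyl V :=
  fun _ hj => h hj

abbrev TJet (n : ℕ) (s : FibreType) (S : Finset (Fin s.m × MIdx n)) : Type := Base n × (S → ℝ)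

/-- Truncation as a linear map. -/
def truncL (S : Finset (Fin s.m × MIdx n)) : Jet n s →ₗ[ℝ] TJet n s S where
  toFun := Jet.trunc S
  map_add' _ _ := rfl
  map_smul' _ _ := rfl

open Classical in
/-- Replaces the base coordinates and the jet coordinates in `S` by given values. -/
def patch (S : Finset (Fin s.m × MIdx n)) (j : Jet n s) (y : TJet n s S) : Jet n s :=
  (y.1, fun a I => if h : (a, I) ∈ S then y.2 ⟨(a, I), h⟩ else j.2 a I)

theorem trunc_patch (S : Finset (Fin s.m × MIdx n)) (j : Jet n s) (y : TJet n s S) :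
    (patch S j y).trunc S = y := by
  refine Prod.ext rfl (funext fun i => ?_)
  simp [patch, Jet.trunc]

theorem patch_trunc (S : Finset (Fin s.m × MIdx n)) (j : Jet n s) :
    patch S j (j.trunc S) = j := by
  refine Prod.ext rfl ?_
  funext a I
  simp [patch, Jet.trunc]

theorem continuous_pt_patch (S : Finset (Fin s.m × MIdx n)) (j : Jet n s) :
    Continuous fun y => (patch S j y).pt := by
  refine Continuous.prodMk continuous_fst ?_
  refine (PiLp.continuous_toLp 2 _).comp (continuous_pi fun a => ?_)
  by_cases h : (a, (0 : MIdx n)) ∈ S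
  · simp only [patch, h, dif_pos]
    exact (continuous_apply (⟨(a, 0), h⟩ : S)).comp continuous_snd
  · simpa [patch, h] using continuous_const

/-- Patching new values into a fixed jet is a right inverse of truncation, and the underlying point
depends continuously on these values. Openness lets `ContDiffOn` on the truncated image yield honest
derivatives. -/
theorem isOpen_trunc_image {U : Set (ModelProd (Base n) (Base s.m))} (hU : IsOpen U)
    (S : Finset (Fin s.m × MIdx n)) : IsOpen (Jet.trunc S '' cyl U) := by
  rw [isOpen_iff_mem_nhds]
  rintro _ ⟨j, hj, rfl⟩
  have h1 : (fun y => (patch S j y).pt) ⁻¹' U ∈ nhds (j.trunc S) := by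
    refine (continuous_pt_patch S j).continuousAt.preimage_mem_nhds (hU.mem_nhds ?_)
    rw [patch_trunc]; exact hj
  refine Filter.mem_of_superset h1 fun y hy => ⟨patch S j y, hy, trunc_patch S j y⟩

/-- All derivatives on the jet space are taken along lines, so this one-parameter statement replaces
openness of `cyl U`. -/
theorem eventually_mem_cyl {U : Set (ModelProd (Base n) (Base s.m))} (hU : IsOpen U)
    {j : Jet n s} (hj : j ∈ cyl U) (w : Jet n s) : ∀ᶠ t : ℝ in nhds 0, j + t • w ∈ cyl U := by
  have hc : Continuous fun t : ℝ => (j + t • w).pt := by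
    refine Continuous.prodMk ?_ ((PiLp.continuous_toLp 2 _).comp (continuous_pi fun a => ?_))
    · show Continuous fun t : ℝ => j.1 + t • w.1
      fun_prop
    · show Continuous fun t : ℝ => j.2 a 0 + t * w.2 a 0
      fun_prop
  refine hc.continuousAt.preimage_mem_nhds (hU.mem_nhds ?_)
  rw [zero_smul, add_zero]; exact hj

section Smooth

variable {E E' : Type*} [NormedAddCommGroup E] [NormedSpace ℝ E] [NormedAddCommGroup E']
  [NormedSpace ℝ E']

/-- `f` is a smooth function of the base coordinates and of finitely many jet coordinates. -/
def JSmooth (U : Set (ModelProd (Base n) (Base s.m))) (f : Jet n s → E) : Prop :=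
  ∃ (S : Finset (Fin s.m × MIdx n)) (G : TJet n s S → E),
    ContDiffOn ℝ ∞ G (Jet.trunc S '' cyl U) ∧ ∀ j ∈ cyl U, f j = G (j.trunc S)

variable {U V : Set (ModelProd (Base n) (Base s.m))}

/-- Forgetting jet coordinates. -/
def truncRes {S S' : Finset (Fin s.m × MIdx n)} (h : S ⊆ S') : TJet n s S' →L[ℝ] TJet n s S :=
  (ContinuousLinearMap.fst ℝ _ _).prod
    (ContinuousLinearMap.pi fun i : S =>
      (ContinuousLinearMap.proj (R := ℝ) (φ := fun _ : S' => ℝ) ⟨i.1, h i.2⟩).comp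
        (ContinuousLinearMap.snd ℝ (Base n) (S' → ℝ)))

theorem contDiffOn_truncRes {S S' : Finset (Fin s.m × MIdx n)} (h : S ⊆ S')
    {G : TJet n s S → E} (hG : ContDiffOn ℝ ∞ G (Jet.trunc S '' cyl U)) :
    ContDiffOn ℝ ∞ (G ∘ truncRes h) (Jet.trunc S' '' cyl U) := by
  refine hG.comp (truncRes h).contDiff.contDiffOn ?_
  rintro _ ⟨j, hj, rfl⟩
  exact ⟨j, hj, rfl⟩

theorem JSmooth.congr {f g : Jet n s → E} (hf : JSmooth U f) (h : ∀ j ∈ cyl U, g j = f j) :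
    JSmooth U g := by
  obtain ⟨S, G, hG, hf⟩ := hf
  exact ⟨S, G, hG, fun j hj => (h j hj).trans (hf j hj)⟩

theorem JSmooth.mono {f : Jet n s → E} (hf : JSmooth U f) (h : V ⊆ U) : JSmooth V f := by
  obtain ⟨S, G, hG, hf⟩ := hf
  exact ⟨S, G, hG.mono (Set.image_mono (cyl_mono h)), fun j hj => hf j (h hj)⟩

theorem JSmooth.comp {f : Jet n s → E} (hf : JSmooth U f) {K : E → E'} {W : Set E}
    (hK : ContDiffOn ℝ ∞ K W) (hW : ∀ j ∈ cyl U, f j ∈ W) : JSmooth U fun j => K (f j) := by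
  obtain ⟨S, G, hG, hf⟩ := hf
  refine ⟨S, K ∘ G, hK.comp hG ?_, fun j hj => congrArg K (hf j hj)⟩
  rintro _ ⟨j, hj, rfl⟩
  rw [← hf j hj]; exact hW j hj

theorem JSmooth.compContDiff {f : Jet n s → E} (hf : JSmooth U f) {K : E → E'}
    (hK : ContDiff ℝ ∞ K) : JSmooth U fun j => K (f j) :=
  hf.comp hK.contDiffOn fun _ _ => Set.mem_univ _

theorem JSmooth.prodMk {f : Jet n s → E} {g : Jet n s → E'} (hf : JSmooth U f)
    (hg : JSmooth U g) : JSmooth U fun j => (f j, g j) := by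
  classical
  obtain ⟨S, G, hG, hf⟩ := hf
  obtain ⟨S', G', hG', hg⟩ := hg
  refine ⟨S ∪ S', fun y => (G (truncRes Finset.subset_union_left y),
    G' (truncRes Finset.subset_union_right y)),
    (contDiffOn_truncRes _ hG).prodMk (contDiffOn_truncRes _ hG'), fun j hj => ?_⟩
  exact Prod.ext (hf j hj) (hg j hj)

theorem jsmooth_const (e : E) : JSmooth U fun _ : Jet n s => e :=
  ⟨∅, fun _ => e, contDiffOn_const, fun _ _ => rfl⟩

theorem jsmooth_fst : JSmooth U fun j : Jet n s => j.1 :=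
  ⟨∅, Prod.fst, contDiff_fst.contDiffOn, fun _ _ => rfl⟩

theorem jsmooth_coord (a : Fin s.m) (I : MIdx n) : JSmooth U fun j : Jet n s => j.2 a I := by
  refine ⟨{(a, I)}, fun y => y.2 ⟨(a, I), by simp⟩, ?_, fun _ _ => rfl⟩
  exact ((contDiff_apply ℝ ℝ _).comp contDiff_snd).contDiffOn

theorem jsmooth_pi {ι : Type*} [Fintype ι] {f : ι → Jet n s → ℝ} (hf : ∀ i, JSmooth U (f i)) :
    JSmooth U fun j i => f i j := by
  classical
  choose S G hG hf using hf
  refine ⟨Finset.univ.biUnion S, fun y i =>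
    G i (truncRes (Finset.subset_biUnion_of_mem S (Finset.mem_univ i)) y), ?_, fun j hj => ?_⟩
  · exact contDiffOn_pi.2 fun i => contDiffOn_truncRes _ (hG i)
  · exact funext fun i => hf i j hj

theorem jsmooth_trunc (S : Finset (Fin s.m × MIdx n)) : JSmooth U (Jet.trunc S) :=
  jsmooth_fst.prodMk (jsmooth_pi fun i : S => jsmooth_coord i.1.1 i.1.2)

theorem JSmooth.add {f g : Jet n s → E} (hf : JSmooth U f) (hg : JSmooth U g) :
    JSmooth U fun j => f j + g j := (hf.prodMk hg).compContDiff contDiff_add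

theorem JSmooth.smul {f : Jet n s → ℝ} {g : Jet n s → E} (hf : JSmooth U f) (hg : JSmooth U g) :
    JSmooth U fun j => f j • g j := (hf.prodMk hg).compContDiff contDiff_smul

theorem JSmooth.mul {f g : Jet n s → ℝ} (hf : JSmooth U f) (hg : JSmooth U g) :
    JSmooth U fun j => f j * g j := (hf.prodMk hg).compContDiff contDiff_mul

theorem JSmooth.sum {ι : Type*} (t : Finset ι) {f : ι → Jet n s → E}
    (hf : ∀ i ∈ t, JSmooth U (f i)) : JSmooth U fun j => ∑ i ∈ t, f i j := by
  classical
  induction t using Finset.induction_on with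
  | empty => simpa using jsmooth_const 0
  | insert i t hi ih =>
    simp only [Finset.sum_insert hi]
    exact (hf i (by simp)).add (ih fun k hk => hf k (by simp [hk]))

/-- Truncation is linear, so a line of jets becomes a line in a finite-dimensional space, where the
Fréchet derivative of the representative is available. -/
theorem hasLineDerivAt_of_rep (hU : IsOpen U) {f : Jet n s → E} {S : Finset (Fin s.m × MIdx n)}
    {G : TJet n s S → E} (hG : ContDiffOn ℝ ∞ G (Jet.trunc S '' cyl U))
    (hf : ∀ j ∈ cyl U, f j = G (j.trunc S)) {j : Jet n s} (hj : j ∈ cyl U) (w : Jet n s) :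
    HasLineDerivAt ℝ f (fderiv ℝ G (j.trunc S) (w.trunc S)) j w := by
  have h1 : HasFDerivAt G (fderiv ℝ G (j.trunc S)) (j.trunc S) :=
    ((hG.contDiffAt ((isOpen_trunc_image hU S).mem_nhds ⟨j, hj, rfl⟩)).differentiableAt
      (by simp)).hasFDerivAt
  have h2 : HasDerivAt (fun t : ℝ => G (j.trunc S + t • w.trunc S))
      (fderiv ℝ G (j.trunc S) (w.trunc S)) 0 := h1.hasLineDerivAt (w.trunc S)
  refine h2.congr_of_eventuallyEq ?_
  filter_upwards [eventually_mem_cyl hU hj w] with t ht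
  rw [hf _ ht]; rfl

theorem JSmooth.hasLineDerivAt (hU : IsOpen U) {f : Jet n s → E} (hf : JSmooth U f) {j : Jet n s}
    (hj : j ∈ cyl U) (w : Jet n s) : HasLineDerivAt ℝ f (lineDeriv ℝ f j w) j w := by
  obtain ⟨S, G, hG, hf⟩ := hf
  exact (hasLineDerivAt_of_rep hU hG hf hj w).lineDifferentiableAt.hasLineDerivAt

theorem lineDeriv_of_rep (hU : IsOpen U) {f : Jet n s → E} {S : Finset (Fin s.m × MIdx n)}
    {G : TJet n s S → E} (hG : ContDiffOn ℝ ∞ G (Jet.trunc S '' cyl U))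
    (hf : ∀ j ∈ cyl U, f j = G (j.trunc S)) {j : Jet n s} (hj : j ∈ cyl U) (w : Jet n s) :
    lineDeriv ℝ f j w = fderiv ℝ G (j.trunc S) (w.trunc S) :=
  (hasLineDerivAt_of_rep hU hG hf hj w).lineDeriv

theorem lineDeriv_congr_cyl (hU : IsOpen U) {f g : Jet n s → E} (h : ∀ j ∈ cyl U, f j = g j)
    {j : Jet n s} (hj : j ∈ cyl U) (w : Jet n s) : lineDeriv ℝ f j w = lineDeriv ℝ g j w := by
  refine Filter.EventuallyEq.deriv_eq ?_
  filter_upwards [eventually_mem_cyl hU hj w] with t ht using h _ ht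

/-- The differential of a smooth function on the jet space. -/
theorem JSmooth.exists_linear (hU : IsOpen U) {f : Jet n s → E} (hf : JSmooth U f) {j : Jet n s}
    (hj : j ∈ cyl U) : ∃ L : Jet n s →ₗ[ℝ] E, ∀ w, lineDeriv ℝ f j w = L w := by
  obtain ⟨S, G, hG, hf⟩ := hf
  exact ⟨(fderiv ℝ G (j.trunc S)).toLinearMap ∘ₗ truncL S, fun w => lineDeriv_of_rep hU hG hf hj w⟩

theorem JSmooth.lineDeriv_comp (hU : IsOpen U) {f : Jet n s → E} (hf : JSmooth U f) {K : E → E'}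
    {W : Set E} (hK : ContDiffOn ℝ ∞ K W) (hWo : IsOpen W) {j : Jet n s} (hj : j ∈ cyl U)
    (hW : f j ∈ W) (w : Jet n s) :
    lineDeriv ℝ (fun j => K (f j)) j w = fderiv ℝ K (f j) (lineDeriv ℝ f j w) := by
  have h1 : HasFDerivAt K (fderiv ℝ K (f j)) (f (j + (0 : ℝ) • w)) := by
    rw [zero_smul, add_zero]
    exact ((hK.contDiffAt (hWo.mem_nhds hW)).differentiableAt (by simp)).hasFDerivAt
  exact (h1.comp_hasDerivAt (0 : ℝ) (hf.hasLineDerivAt hU hj w)).deriv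

/-- Vector fields on the jet space with smooth components. -/
def JField (U : Set (ModelProd (Base n) (Base s.m))) (A : Jet n s → Jet n s) : Prop :=
  JSmooth U (fun j => (A j).1) ∧ ∀ a I, JSmooth U fun j => (A j).2 a I

theorem JField.mono {A : Jet n s → Jet n s} (hA : JField U A) (h : V ⊆ U) : JField V A :=
  ⟨hA.1.mono h, fun a I => (hA.2 a I).mono h⟩

theorem JField.trunc {A : Jet n s → Jet n s} (hA : JField U A) (S : Finset (Fin s.m × MIdx n)) :
    JSmooth U fun j => (A j).trunc S :=
  hA.1.prodMk (jsmooth_pi fun i : S => hA.2 i.1.1 i.1.2)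

/-- The componentwise derivative of a map between jet spaces. -/
def fieldDeriv (A : Jet n s → Jet n s) (j w : Jet n s) : Jet n s :=
  (lineDeriv ℝ (fun j' => (A j').1) j w, fun a I => lineDeriv ℝ (fun j' => (A j').2 a I) j w)

theorem lineDeriv_prodMk (hU : IsOpen U) {f : Jet n s → E} {g : Jet n s → E'} (hf : JSmooth U f)
    (hg : JSmooth U g) {j : Jet n s} (hj : j ∈ cyl U) (w : Jet n s) :
    lineDeriv ℝ (fun j => (f j, g j)) j w = (lineDeriv ℝ f j w, lineDeriv ℝ g j w) :=
  (HasDerivAt.prodMk (hf.hasLineDerivAt hU hj w) (hg.hasLineDerivAt hU hj w)).deriv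

theorem JField.lineDeriv_trunc (hU : IsOpen U) {A : Jet n s → Jet n s} (hA : JField U A)
    (S : Finset (Fin s.m × MIdx n)) {j : Jet n s} (hj : j ∈ cyl U) (w : Jet n s) :
    lineDeriv ℝ (fun j => (A j).trunc S) j w = (fieldDeriv A j w).trunc S := by
  have h2 := jsmooth_pi fun i : S => hA.2 i.1.1 i.1.2
  have := lineDeriv_prodMk hU hA.1 h2 hj w
  refine this.trans (Prod.ext rfl ?_)
  refine (hasDerivAt_pi.2 fun i : S => ?_).deriv
  exact (hA.2 i.1.1 i.1.2).hasLineDerivAt hU hj w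

theorem JSmooth.lineDeriv_field (hU : IsOpen U) {f : Jet n s → E} (hf : JSmooth U f)
    {A : Jet n s → Jet n s} (hA : JField U A) : JSmooth U fun j => lineDeriv ℝ f j (A j) := by
  obtain ⟨S, G, hG, hf⟩ := hf
  have h1 : ContDiffOn ℝ ∞ (fderiv ℝ G) (Jet.trunc S '' cyl U) :=
    hG.fderiv_of_isOpen (isOpen_trunc_image hU S) (by simp)
  have h2 : JSmooth U fun j => fderiv ℝ G (j.trunc S) :=
    (jsmooth_trunc S).comp h1 fun j hj => ⟨j, hj, rfl⟩
  refine ((h2.prodMk (hA.trunc S)).compContDiff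
    (K := fun p : (TJet n s S →L[ℝ] E) × TJet n s S => p.1 p.2) ?_).congr fun j hj => ?_
  · exact contDiff_fst.clm_apply contDiff_snd
  · exact lineDeriv_of_rep hU hG hf hj _

/-- The second derivative of a smooth function along vector fields, up to a symmetric term. -/
theorem lineDeriv_lineDeriv (hU : IsOpen U) {f : Jet n s → E} (hf : JSmooth U f)
    {A B : Jet n s → Jet n s} (hA : JField U A) (hB : JField U B) {j : Jet n s} (hj : j ∈ cyl U) :
    lineDeriv ℝ (fun j' => lineDeriv ℝ f j' (B j')) j (A j) -
      lineDeriv ℝ (fun j' => lineDeriv ℝ f j' (A j')) j (B j) =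
    lineDeriv ℝ f j (fieldDeriv B j (A j) - fieldDeriv A j (B j)) := by
  obtain ⟨S, G, hG, hf⟩ := hf
  have ho := isOpen_trunc_image hU S
  have hy : j.trunc S ∈ Jet.trunc S '' cyl U := ⟨j, hj, rfl⟩
  have h1 : ContDiffOn ℝ ∞ (fderiv ℝ G) (Jet.trunc S '' cyl U) :=
    hG.fderiv_of_isOpen ho (by simp)
  have h2 : JSmooth U fun j => fderiv ℝ G (j.trunc S) :=
    (jsmooth_trunc S).comp h1 fun j hj => ⟨j, hj, rfl⟩
  have key : ∀ {A B : Jet n s → Jet n s}, JField U A → JField U B →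
      lineDeriv ℝ (fun j' => lineDeriv ℝ f j' (B j')) j (A j) =
      fderiv ℝ (fderiv ℝ G) (j.trunc S) ((A j).trunc S) ((B j).trunc S) +
        fderiv ℝ G (j.trunc S) ((fieldDeriv B j (A j)).trunc S) := by
    intro A B hA hB
    rw [lineDeriv_congr_cyl hU (fun j' hj' => lineDeriv_of_rep hU hG hf hj' (B j')) hj]
    have e1 : HasDerivAt (fun t : ℝ => fderiv ℝ G ((j + t • A j).trunc S))
        (fderiv ℝ (fderiv ℝ G) (j.trunc S) ((A j).trunc S)) 0 :=
      hasLineDerivAt_of_rep (f := fun j => fderiv ℝ G (j.trunc S)) hU h1 (fun _ _ => rfl) hj (A j)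
    have e2 : HasDerivAt (fun t : ℝ => (B (j + t • A j)).trunc S)
        ((fieldDeriv B j (A j)).trunc S) 0 := by
      rw [← hB.lineDeriv_trunc hU S hj]
      exact (hB.trunc S).hasLineDerivAt hU hj (A j)
    have e3 := e1.clm_apply e2
    simp only [zero_smul, add_zero] at e3
    exact e3.deriv
  -- Symmetry of the Hessian cancels the second order terms and leaves the derivative along the
  -- bracket of the two fields.
  have hsymm : fderiv ℝ (fderiv ℝ G) (j.trunc S) ((A j).trunc S) ((B j).trunc S) =
      fderiv ℝ (fderiv ℝ G) (j.trunc S) ((B j).trunc S) ((A j).trunc S) := by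
    have hc : ContDiffAt ℝ ∞ G (j.trunc S) := hG.contDiffAt (ho.mem_nhds hy)
    exact (hc.isSymmSndFDerivAt (by simp; exact WithTop.coe_le_coe.2 le_top)).eq _ _
  rw [key hA hB, key hB hA, lineDeriv_of_rep hU hG hf hj, hsymm]
  have : (fieldDeriv B j (A j) - fieldDeriv A j (B j)).trunc S =
    (fieldDeriv B j (A j)).trunc S - (fieldDeriv A j (B j)).trunc S := rfl
  rw [this, map_sub]
  abel

/-- Pullback of smooth functions along smooth maps of jet spaces. -/
theorem JSmooth.pullback {f : Jet n s → E} (hf : JSmooth V f) {Θ : Jet n s → Jet n s}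
    (hΘ : JField U Θ) (hm : ∀ j ∈ cyl U, Θ j ∈ cyl V) : JSmooth U fun j => f (Θ j) := by
  obtain ⟨S, G, hG, hf⟩ := hf
  exact ((hΘ.trunc S).comp hG fun j hj => ⟨_, hm j hj, rfl⟩).congr fun j hj => hf _ (hm j hj)

theorem JSmooth.lineDeriv_pullback (hU : IsOpen U) (hV : IsOpen V) {f : Jet n s → E}
    (hf : JSmooth V f) {Θ : Jet n s → Jet n s} (hΘ : JField U Θ) (hm : ∀ j ∈ cyl U, Θ j ∈ cyl V)
    {j : Jet n s} (hj : j ∈ cyl U) (w : Jet n s) :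
    lineDeriv ℝ (fun j => f (Θ j)) j w = lineDeriv ℝ f (Θ j) (fieldDeriv Θ j w) := by
  obtain ⟨S, G, hG, hf⟩ := hf
  rw [lineDeriv_congr_cyl hU (fun j' hj' => hf _ (hm j' hj')) hj,
    (hΘ.trunc S).lineDeriv_comp hU hG (isOpen_trunc_image hV S) hj ⟨_, hm j hj, rfl⟩,
    hΘ.lineDeriv_trunc hU S hj, lineDeriv_of_rep hV hG hf (hm j hj)]

end Smooth

end Calculus

/-! ### Local functions with values in vector spaces without topology -/

section VectorCalculus

variable {n : ℕ} {s : FibreType} {U V : Set (ModelProd (Base n) (Base s.m))}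
variable {F F' F'' : Type*} [AddCommGroup F] [Module ℝ F] [AddCommGroup F'] [Module ℝ F']
  [AddCommGroup F''] [Module ℝ F'']

theorem isLocalOn_of_sum {ι : Type*} [Fintype ι] {f : Jet n s → F} {g : ι → Jet n s → ℝ}
    {b : ι → F} (hg : ∀ i, JSmooth U (g i)) (hf : ∀ j ∈ cyl U, f j = ∑ i, g i j • b i) :
    IsLocalOn (cyl U) f := by
  classical
  choose S G hG hgG using hg
  let e := Fintype.equivFin ι
  refine ⟨Finset.univ.biUnion S, Fintype.card ι, fun i =>
    G (e.symm i) ∘ truncRes (Finset.subset_biUnion_of_mem S (Finset.mem_univ (e.symm i))),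
    fun i => b (e.symm i), fun i => contDiffOn_truncRes _ (hG _), fun j hj => ?_⟩
  rw [hf j hj, ← e.symm.sum_comp]
  exact Finset.sum_congr rfl fun i _ => by rw [hgG _ j hj]; rfl

theorem _root_.IsLocalOn.exists_sum {f : Jet n s → F} (hf : IsLocalOn (cyl U) f) :
    ∃ (N : ℕ) (g : Fin N → Jet n s → ℝ) (b : Fin N → F), (∀ i, JSmooth U (g i)) ∧
      ∀ j ∈ cyl U, f j = ∑ i, g i j • b i := by
  obtain ⟨S, N, G, b, hG, hf⟩ := hf
  exact ⟨N, fun i j => G i (j.trunc S), b, fun i => ⟨S, G i, hG i, fun _ _ => rfl⟩, hf⟩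

theorem _root_.IsLocalOn.congr {f g : Jet n s → F} (hf : IsLocalOn (cyl U) f)
    (h : ∀ j ∈ cyl U, g j = f j) : IsLocalOn (cyl U) g := by
  obtain ⟨S, N, G, b, hG, hf⟩ := hf
  exact ⟨S, N, G, b, hG, fun j hj => (h j hj).trans (hf j hj)⟩

theorem _root_.IsLocalOn.mono {f : Jet n s → F} (hf : IsLocalOn (cyl U) f) (h : V ⊆ U) :
    IsLocalOn (cyl V) f := by
  obtain ⟨N, g, b, hg, hf⟩ := hf.exists_sum
  exact isLocalOn_of_sum (fun i => (hg i).mono h) fun j hj => hf j (h hj)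

theorem JSmooth.smul_isLocalOn_const {g : Jet n s → ℝ} (hg : JSmooth U g) (b : F) :
    IsLocalOn (cyl U) fun j => g j • b :=
  isLocalOn_of_sum (ι := Unit) (g := fun _ => g) (b := fun _ => b) (fun _ => hg) (by simp)

theorem isLocalOn_const (b : F) : IsLocalOn (cyl U) fun _ : Jet n s => b :=
  (JSmooth.smul_isLocalOn_const (jsmooth_const (1 : ℝ)) b).congr fun _ _ => by simp

theorem _root_.IsLocalOn.add {f g : Jet n s → F} (hf : IsLocalOn (cyl U) f) (hg : IsLocalOn (cyl U) g) :
    IsLocalOn (cyl U) fun j => f j + g j := by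
  obtain ⟨N, u, b, hu, hf⟩ := hf.exists_sum
  obtain ⟨N', u', b', hu', hg⟩ := hg.exists_sum
  refine isLocalOn_of_sum (ι := Fin N ⊕ Fin N') (g := Sum.elim u u') (b := Sum.elim b b') ?_ ?_
  · rintro (i | i)
    · exact hu i
    · exact hu' i
  · intro j hj; rw [hf j hj, hg j hj]; simp

theorem _root_.IsLocalOn.sum {ι : Type*} (t : Finset ι) {f : ι → Jet n s → F}
    (hf : ∀ i ∈ t, IsLocalOn (cyl U) (f i)) : IsLocalOn (cyl U) fun j => ∑ i ∈ t, f i j := by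
  classical
  induction t using Finset.induction_on with
  | empty => simpa using isLocalOn_const 0
  | insert i t hi ih =>
    simp only [Finset.sum_insert hi]
    exact (hf i (by simp)).add (ih fun k hk => hf k (by simp [hk]))

theorem _root_.IsLocalOn.bilin (B : F →ₗ[ℝ] F' →ₗ[ℝ] F'') {f : Jet n s → F} {g : Jet n s → F'}
    (hf : IsLocalOn (cyl U) f) (hg : IsLocalOn (cyl U) g) :
    IsLocalOn (cyl U) fun j => B (f j) (g j) := by
  obtain ⟨N, u, b, hu, hf⟩ := hf.exists_sum
  obtain ⟨N', u', b', hu', hg⟩ := hg.exists_sum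
  refine isLocalOn_of_sum (ι := Fin N × Fin N') (g := fun p j => u p.1 j * u' p.2 j)
    (b := fun p => B (b p.1) (b' p.2)) (fun p => (hu p.1).mul (hu' p.2)) fun j hj => ?_
  rw [hf j hj, hg j hj, map_sum B, LinearMap.sum_apply, Fintype.sum_prod_type]
  refine Finset.sum_congr rfl fun i _ => ?_
  rw [map_sum]
  refine Finset.sum_congr rfl fun k _ => ?_
  rw [map_smul, map_smul, LinearMap.smul_apply, smul_smul, mul_comm]

theorem _root_.IsLocalOn.map (φ : F →ₗ[ℝ] F') {f : Jet n s → F} (hf : IsLocalOn (cyl U) f) :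
    IsLocalOn (cyl U) fun j => φ (f j) := by
  obtain ⟨N, u, b, hu, hf⟩ := hf.exists_sum
  exact isLocalOn_of_sum (b := fun i => φ (b i)) hu fun j hj => by
    rw [hf j hj, map_sum]; exact Finset.sum_congr rfl fun i _ => map_smul _ _ _

theorem JSmooth.isLocalOn {g : Jet n s → ℝ} (hg : JSmooth U g) : IsLocalOn (cyl U) g :=
  (hg.smul_isLocalOn_const (1 : ℝ)).congr fun _ _ => by simp

theorem JSmooth.smul_isLocalOn {g : Jet n s → ℝ} (hg : JSmooth U g) {f : Jet n s → F}
    (hf : IsLocalOn (cyl U) f) : IsLocalOn (cyl U) fun j => g j • f j :=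
  hg.isLocalOn.bilin (LinearMap.lsmul ℝ F) hf

theorem _root_.IsLocalOn.const_smul (c : ℝ) {f : Jet n s → F} (hf : IsLocalOn (cyl U) f) :
    IsLocalOn (cyl U) fun j => c • f j := (jsmooth_const c).smul_isLocalOn hf

theorem _root_.IsLocalOn.sub {f g : Jet n s → F} (hf : IsLocalOn (cyl U) f) (hg : IsLocalOn (cyl U) g) :
    IsLocalOn (cyl U) fun j => f j - g j :=
  (hf.add (hg.const_smul (-1))).congr fun j _ => by module

theorem _root_.IsLocalOn.jsmooth {f : Jet n s → ℝ} (hf : IsLocalOn (cyl U) f) : JSmooth U f := by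
  obtain ⟨N, u, b, hu, hf⟩ := hf.exists_sum
  exact (JSmooth.sum Finset.univ fun i _ => (hu i).smul (jsmooth_const (b i))).congr hf

theorem _root_.IsLocalOn.mul {f g : Jet n s → VAlg n s} (hf : IsLocalOn (cyl U) f)
    (hg : IsLocalOn (cyl U) g) : IsLocalOn (cyl U) fun j => f j * g j :=
  hf.bilin (LinearMap.mul ℝ (VAlg n s)) hg

open Classical in
/-- Directional derivative of functions with values in a vector space without topology. -/
def gDeriv (f : Jet n s → F) (j w : Jet n s) : F :=
  if h : ∃ b : F, ∀ l : F →ₗ[ℝ] ℝ, HasLineDerivAt ℝ (fun j' => l (f j')) (l b) j w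
  then h.choose else 0

theorem dirDeriv_eq_gDeriv (f : Jet n s → VAlg n s) (j w : Jet n s) :
    dirDeriv f j w = gDeriv f j w := rfl

/-- Linear functionals separate the points of a real vector space, so the chosen value is
determined. -/
theorem gDeriv_unique {f : Jet n s → F} {j w : Jet n s} {b : F}
    (h : ∀ l : F →ₗ[ℝ] ℝ, HasLineDerivAt ℝ (fun j' => l (f j')) (l b) j w) :
    gDeriv f j w = b := by
  have hex : ∃ b : F, ∀ l : F →ₗ[ℝ] ℝ, HasLineDerivAt ℝ (fun j' => l (f j')) (l b) j w := ⟨b, h⟩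
  rw [gDeriv, dif_pos hex, ← sub_eq_zero, ← Module.forall_dual_apply_eq_zero_iff ℝ]
  intro l
  rw [map_sub, sub_eq_zero]
  exact HasDerivAt.unique (hex.choose_spec l) (h l)

/-- This makes the abstract derivative computable, by differentiating the scalar coefficients; in
particular the result does not depend on how the function is written as a sum. -/
theorem gDeriv_of_sum (hU : IsOpen U) {ι : Type*} [Fintype ι] {f : Jet n s → F}
    {g : ι → Jet n s → ℝ} {b : ι → F} (hg : ∀ i, JSmooth U (g i))
    (hf : ∀ j ∈ cyl U, f j = ∑ i, g i j • b i) {j : Jet n s} (hj : j ∈ cyl U) (w : Jet n s) :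
    gDeriv f j w = ∑ i, lineDeriv ℝ (g i) j w • b i := by
  refine gDeriv_unique fun l => ?_
  have h1 : HasDerivAt (fun t : ℝ => ∑ i, g i (j + t • w) * l (b i))
      (∑ i, lineDeriv ℝ (g i) j w * l (b i)) 0 :=
    HasDerivAt.fun_sum fun i _ => HasDerivAt.mul_const ((hg i).hasLineDerivAt hU hj w) _
  have h2 : l (∑ i, lineDeriv ℝ (g i) j w • b i) = ∑ i, lineDeriv ℝ (g i) j w * l (b i) := by
    simp
  rw [h2]
  refine h1.congr_of_eventuallyEq ?_
  filter_upwards [eventually_mem_cyl hU hj w] with t ht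
  rw [hf _ ht]; simp

theorem gDeriv_spec (hU : IsOpen U) {f : Jet n s → F} (hf : IsLocalOn (cyl U) f) {j : Jet n s}
    (hj : j ∈ cyl U) (w : Jet n s) (l : F →ₗ[ℝ] ℝ) :
    HasLineDerivAt ℝ (fun j' => l (f j')) (l (gDeriv f j w)) j w := by
  have : l (gDeriv f j w) = lineDeriv ℝ (fun j' => l (f j')) j w := by
    obtain ⟨N, g, b, hg, hf⟩ := hf.exists_sum
    rw [gDeriv_of_sum hU hg hf hj]
    have h1 := gDeriv_of_sum hU (b := fun i => l (b i)) hg (f := fun j => l (f j)) (fun j hj => by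
      rw [hf j hj, map_sum]; exact Finset.sum_congr rfl fun i _ => map_smul _ _ _) hj w
    have h2 : gDeriv (fun j => l (f j)) j w = lineDeriv ℝ (fun j => l (f j)) j w := by
      refine gDeriv_unique fun l' => ?_
      have h3 : JSmooth U fun j => l (f j) := by
        refine IsLocalOn.jsmooth (IsLocalOn.map l (isLocalOn_of_sum hg hf))
      have h4 : HasDerivAt (fun t : ℝ => l (f (j + t • w)) * l' 1)
        (lineDeriv ℝ (fun j => l (f j)) j w * l' 1) 0 := (h3.hasLineDerivAt hU hj w).mul_const _
      have h5 : ∀ x : ℝ, l' x = x * l' 1 := fun x => by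
        rw [← smul_eq_mul, ← map_smul, smul_eq_mul, mul_one]
      rw [h5]
      refine h4.congr_of_eventuallyEq (Filter.Eventually.of_forall fun t => h5 _)
    rw [← h2, h1, map_sum]; exact Finset.sum_congr rfl fun i _ => map_smul _ _ _
  rw [this]
  exact (IsLocalOn.jsmooth (hf.map l)).hasLineDerivAt hU hj w

theorem gDeriv_congr (hU : IsOpen U) {f g : Jet n s → F} (hg : IsLocalOn (cyl U) g)
    (h : ∀ j ∈ cyl U, f j = g j) {j : Jet n s} (hj : j ∈ cyl U) (w : Jet n s) :
    gDeriv f j w = gDeriv g j w := by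
  obtain ⟨N, u, b, hu, hg⟩ := hg.exists_sum
  rw [gDeriv_of_sum hU hu hg hj, gDeriv_of_sum hU hu (fun j hj => (h j hj).trans (hg j hj)) hj]

theorem gDeriv_const (b : F) (j w : Jet n s) : gDeriv (fun _ : Jet n s => b) j w = 0 :=
  gDeriv_unique fun l => by rw [map_zero]; exact hasDerivAt_const _ _

theorem gDeriv_map (hU : IsOpen U) (φ : F →ₗ[ℝ] F') {f : Jet n s → F} (hf : IsLocalOn (cyl U) f)
    {j : Jet n s} (hj : j ∈ cyl U) (w : Jet n s) :
    gDeriv (fun j => φ (f j)) j w = φ (gDeriv f j w) :=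
  gDeriv_unique fun l => gDeriv_spec hU hf hj w (l ∘ₗ φ)

theorem gDeriv_real (hU : IsOpen U) {f : Jet n s → ℝ} (hf : JSmooth U f) {j : Jet n s}
    (hj : j ∈ cyl U) (w : Jet n s) : gDeriv f j w = lineDeriv ℝ f j w :=
  (HasLineDerivAt.lineDeriv (gDeriv_spec hU hf.isLocalOn hj w LinearMap.id)).symm

theorem gDeriv_add (hU : IsOpen U) {f g : Jet n s → F} (hf : IsLocalOn (cyl U) f)
    (hg : IsLocalOn (cyl U) g) {j : Jet n s} (hj : j ∈ cyl U) (w : Jet n s) :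
    gDeriv (fun j => f j + g j) j w = gDeriv f j w + gDeriv g j w :=
  gDeriv_unique fun l => by
    rw [map_add]; simp only [map_add]
    exact HasDerivAt.add (gDeriv_spec hU hf hj w l) (gDeriv_spec hU hg hj w l)

theorem gDeriv_sum (hU : IsOpen U) {ι : Type*} (t : Finset ι) {f : ι → Jet n s → F}
    (hf : ∀ i ∈ t, IsLocalOn (cyl U) (f i)) {j : Jet n s} (hj : j ∈ cyl U) (w : Jet n s) :
    gDeriv (fun j => ∑ i ∈ t, f i j) j w = ∑ i ∈ t, gDeriv (f i) j w :=
  gDeriv_unique fun l => by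
    rw [map_sum]; simp only [map_sum]
    exact HasDerivAt.fun_sum fun i hi => gDeriv_spec hU (hf i hi) hj w l

/-- Only the first factor has to be expanded: against the constant vectors `b i`, the second enters
through the scalar functions `l (B (b i) (g j))`, and the ordinary product rule applies. -/
theorem gDeriv_bilin (hU : IsOpen U) (B : F →ₗ[ℝ] F' →ₗ[ℝ] F'') {f : Jet n s → F}
    {g : Jet n s → F'} (hf : IsLocalOn (cyl U) f) (hg : IsLocalOn (cyl U) g) {j : Jet n s}
    (hj : j ∈ cyl U) (w : Jet n s) :
    gDeriv (fun j => B (f j) (g j)) j w = B (gDeriv f j w) (g j) + B (f j) (gDeriv g j w) := by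
  obtain ⟨N, u, b, hu, hf⟩ := hf.exists_sum
  rw [gDeriv_of_sum hU hu hf hj w, hf j hj]
  refine gDeriv_unique fun l => ?_
  have h1 : HasDerivAt (fun t : ℝ => ∑ i, u i (j + t • w) * l (B (b i) (g (j + t • w))))
      (∑ i, (lineDeriv ℝ (u i) j w * l (B (b i) (g (j + (0 : ℝ) • w))) +
        u i (j + (0 : ℝ) • w) * l (B (b i) (gDeriv g j w)))) 0 :=
    HasDerivAt.fun_sum fun i _ => HasDerivAt.mul ((hu i).hasLineDerivAt hU hj w)
      (gDeriv_spec hU hg hj w (l ∘ₗ B (b i)))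
  have h2 : l (B (∑ i, lineDeriv ℝ (u i) j w • b i) (g j) +
      B (∑ i, u i j • b i) (gDeriv g j w)) =
      ∑ i, (lineDeriv ℝ (u i) j w * l (B (b i) (g (j + (0 : ℝ) • w))) +
        u i (j + (0 : ℝ) • w) * l (B (b i) (gDeriv g j w))) := by
    simp [Finset.sum_add_distrib]
  rw [h2]
  refine h1.congr_of_eventuallyEq ?_
  filter_upwards [eventually_mem_cyl hU hj w] with t ht
  rw [hf _ ht]; simp

theorem gDeriv_smul (hU : IsOpen U) {g : Jet n s → ℝ} (hg : JSmooth U g) {f : Jet n s → F}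
    (hf : IsLocalOn (cyl U) f) {j : Jet n s} (hj : j ∈ cyl U) (w : Jet n s) :
    gDeriv (fun j => g j • f j) j w = lineDeriv ℝ g j w • f j + g j • gDeriv f j w := by
  rw [← gDeriv_real hU hg hj]
  exact gDeriv_bilin hU (LinearMap.lsmul ℝ F) hg.isLocalOn hf hj w

theorem gDeriv_const_smul (hU : IsOpen U) (c : ℝ) {f : Jet n s → F}
    (hf : IsLocalOn (cyl U) f) {j : Jet n s} (hj : j ∈ cyl U) (w : Jet n s) :
    gDeriv (fun j => c • f j) j w = c • gDeriv f j w :=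
  gDeriv_map hU (c • LinearMap.id) hf hj w

theorem gDeriv_mul (hU : IsOpen U) {f g : Jet n s → VAlg n s} (hf : IsLocalOn (cyl U) f)
    (hg : IsLocalOn (cyl U) g) {j : Jet n s} (hj : j ∈ cyl U) (w : Jet n s) :
    gDeriv (fun j => f j * g j) j w = gDeriv f j w * g j + f j * gDeriv g j w :=
  gDeriv_bilin hU (LinearMap.mul ℝ (VAlg n s)) hf hg hj w

theorem _root_.IsLocalOn.exists_linear (hU : IsOpen U) {f : Jet n s → F} (hf : IsLocalOn (cyl U) f)
    {j : Jet n s} (hj : j ∈ cyl U) : ∃ L : Jet n s →ₗ[ℝ] F, ∀ w, gDeriv f j w = L w := by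
  obtain ⟨N, u, b, hu, hf⟩ := hf.exists_sum
  choose L hL using fun i => (hu i).exists_linear hU hj
  refine ⟨∑ i, (L i).smulRight (b i), fun w => ?_⟩
  rw [gDeriv_of_sum hU hu hf hj]
  simp [hL]

theorem _root_.IsLocalOn.gDeriv_field (hU : IsOpen U) {f : Jet n s → F} (hf : IsLocalOn (cyl U) f)
    {A : Jet n s → Jet n s} (hA : JField U A) : IsLocalOn (cyl U) fun j => gDeriv f j (A j) := by
  obtain ⟨N, u, b, hu, hf⟩ := hf.exists_sum
  exact isLocalOn_of_sum (fun i => (hu i).lineDeriv_field hU hA) fun j hj =>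
    gDeriv_of_sum hU hu hf hj _

theorem gDeriv_gDeriv (hU : IsOpen U) {f : Jet n s → F} (hf : IsLocalOn (cyl U) f)
    {A B : Jet n s → Jet n s} (hA : JField U A) (hB : JField U B) {j : Jet n s} (hj : j ∈ cyl U) :
    gDeriv (fun j' => gDeriv f j' (B j')) j (A j) - gDeriv (fun j' => gDeriv f j' (A j')) j (B j) =
      gDeriv f j (fieldDeriv B j (A j) - fieldDeriv A j (B j)) := by
  obtain ⟨N, u, b, hu, hf⟩ := hf.exists_sum
  have key : ∀ {A B : Jet n s → Jet n s}, JField U A → JField U B →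
      gDeriv (fun j' => gDeriv f j' (B j')) j (A j) =
        ∑ i, lineDeriv ℝ (fun j' => lineDeriv ℝ (u i) j' (B j')) j (A j) • b i := fun hA hB =>
    gDeriv_of_sum hU (fun i => (hu i).lineDeriv_field hU hB)
      (fun j' hj' => gDeriv_of_sum hU hu hf hj' _) hj _
  rw [key hA hB, key hB hA, gDeriv_of_sum hU hu hf hj, ← Finset.sum_sub_distrib]
  refine Finset.sum_congr rfl fun i _ => ?_
  rw [← sub_smul, lineDeriv_lineDeriv hU (hu i) hA hB hj]

/-- A derivative outside `W` would be detected by a functional that vanishes on `W`, hence on all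
values of `f`. No closedness of `W` is involved; this is how differentiation respects the degrees.
-/
theorem gDeriv_mem (hU : IsOpen U) {f : Jet n s → F} (hf : IsLocalOn (cyl U) f)
    (W : Submodule ℝ F) (hW : ∀ j ∈ cyl U, f j ∈ W) {j : Jet n s} (hj : j ∈ cyl U)
    (w : Jet n s) : gDeriv f j w ∈ W := by
  by_contra h
  obtain ⟨l, hl, hl'⟩ := W.exists_le_ker_of_notMem h
  refine hl ?_
  have h1 := gDeriv_spec hU hf hj w l
  have h2 : HasDerivAt (fun t : ℝ => l (f (j + t • w))) 0 0 := by
    refine (hasDerivAt_const (0 : ℝ) (0 : ℝ)).congr_of_eventuallyEq ?_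
    filter_upwards [eventually_mem_cyl hU hj w] with t ht
    exact hl' (hW _ ht)
  exact HasDerivAt.unique h1 h2

end VectorCalculus

/-! ### Total derivatives -/

section TotalDerivative

variable {n : ℕ} {s : FibreType} {U : Set (ModelProd (Base n) (Base s.m))}

theorem totalDeriv_apply (v : Base n) (f : Jet n s → VAlg n s) (j : Jet n s) :
    totalDeriv v f j = gDeriv f j (cartanLift v j) + ∑ ν, v ν • shiftDer ν (f j) := by
  rw [totalDeriv, finsum_shift, dirDeriv_eq_gDeriv]

theorem jfield_cartanLift {X : Jet n s → Base n} (hX : JSmooth U X) :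
    JField U fun j => cartanLift (X j) j := by
  refine ⟨hX, fun a I => ?_⟩
  refine JSmooth.sum (f := fun ν j => X j ν * j.2 a (I + Finsupp.single ν 1)) Finset.univ
    fun ν _ => ?_
  exact (hX.compContDiff (K := fun x : Base n => x ν) (by fun_prop)).mul (jsmooth_coord _ _)

theorem cartanLift_add (v w : Base n) (j : Jet n s) :
    cartanLift (v + w) j = cartanLift v j + cartanLift w j := by
  refine Prod.ext rfl ?_
  funext a I
  simp [cartanLift, add_mul, Finset.sum_add_distrib]

theorem cartanLift_smul (c : ℝ) (v : Base n) (j : Jet n s) :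
    cartanLift (c • v) j = c • cartanLift v j := by
  refine Prod.ext rfl ?_
  funext a I
  simp [cartanLift, Finset.mul_sum, mul_assoc]

theorem totalDeriv_add_left (hU : IsOpen U) {f : Jet n s → VAlg n s} (hf : IsLocalOn (cyl U) f)
    {j : Jet n s} (hj : j ∈ cyl U) (v w : Base n) :
    totalDeriv (v + w) f j = totalDeriv v f j + totalDeriv w f j := by
  obtain ⟨L, hL⟩ := hf.exists_linear hU hj
  simp only [totalDeriv_apply, hL, cartanLift_add, map_add, PiLp.add_apply, add_smul,
    Finset.sum_add_distrib]
  abel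

theorem totalDeriv_smul_left (hU : IsOpen U) {f : Jet n s → VAlg n s} (hf : IsLocalOn (cyl U) f)
    {j : Jet n s} (hj : j ∈ cyl U) (c : ℝ) (v : Base n) :
    totalDeriv (c • v) f j = c • totalDeriv v f j := by
  obtain ⟨L, hL⟩ := hf.exists_linear hU hj
  simp only [totalDeriv_apply, hL, cartanLift_smul, map_smul, PiLp.smul_apply, smul_eq_mul,
    mul_smul, ← Finset.smul_sum, smul_add]

/-- The total derivative at a jet as a linear map. -/
theorem exists_totalDeriv_linear (hU : IsOpen U) {f : Jet n s → VAlg n s}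
    (hf : IsLocalOn (cyl U) f) {j : Jet n s} (hj : j ∈ cyl U) :
    ∃ L : Base n →ₗ[ℝ] VAlg n s, ∀ v, totalDeriv v f j = L v :=
  ⟨{ toFun := fun v => totalDeriv v f j
     map_add' := totalDeriv_add_left hU hf hj
     map_smul' := totalDeriv_smul_left hU hf hj }, fun _ => rfl⟩

theorem base_eq_sum (v : Base n) : v = ∑ ν, v ν • EuclideanSpace.single ν (1 : ℝ) := by
  ext μ
  simp [Finset.sum_apply, Pi.single_apply]

theorem totalDeriv_eq_sum (hU : IsOpen U) {f : Jet n s → VAlg n s} (hf : IsLocalOn (cyl U) f)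
    {j : Jet n s} (hj : j ∈ cyl U) (v : Base n) :
    totalDeriv v f j = ∑ ν, v ν • totalDeriv (EuclideanSpace.single ν 1) f j := by
  obtain ⟨L, hL⟩ := exists_totalDeriv_linear hU hf hj
  simp only [hL]
  conv_lhs => rw [base_eq_sum v, map_sum]
  simp only [map_smul]

theorem isLocalOn_totalDeriv (hU : IsOpen U) {X : Jet n s → Base n} (hX : JSmooth U X)
    {f : Jet n s → VAlg n s} (hf : IsLocalOn (cyl U) f) :
    IsLocalOn (cyl U) fun j => totalDeriv (X j) f j := by
  simp only [totalDeriv_apply]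
  refine (hf.gDeriv_field hU (jfield_cartanLift hX)).add (IsLocalOn.sum _ fun ν _ => ?_)
  exact (hX.compContDiff (K := fun x : Base n => x ν) (by fun_prop)).smul_isLocalOn
    (hf.map (shiftDer ν))

theorem isLocalOn_totalDeriv_const (hU : IsOpen U) (v : Base n)
    {f : Jet n s → VAlg n s} (hf : IsLocalOn (cyl U) f) : IsLocalOn (cyl U) (totalDeriv v f) :=
  isLocalOn_totalDeriv hU (jsmooth_const v) hf

theorem totalDeriv_congr (hU : IsOpen U) (v : Base n) {f g : Jet n s → VAlg n s}
    (hg : IsLocalOn (cyl U) g) (h : ∀ j ∈ cyl U, f j = g j) {j : Jet n s} (hj : j ∈ cyl U) :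
    totalDeriv v f j = totalDeriv v g j := by
  rw [totalDeriv_apply, totalDeriv_apply, gDeriv_congr hU hg h hj, h j hj]

theorem totalDeriv_const (v : Base n) (b : VAlg n s) (j : Jet n s) :
    totalDeriv v (fun _ => b) j = ∑ ν, v ν • shiftDer ν b := by
  rw [totalDeriv_apply, gDeriv_const, zero_add]

theorem totalDeriv_add (hU : IsOpen U) (v : Base n) {f g : Jet n s → VAlg n s}
    (hf : IsLocalOn (cyl U) f) (hg : IsLocalOn (cyl U) g) {j : Jet n s} (hj : j ∈ cyl U) :
    totalDeriv v (fun j => f j + g j) j = totalDeriv v f j + totalDeriv v g j := by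
  simp only [totalDeriv_apply, gDeriv_add hU hf hg hj, map_add, smul_add, Finset.sum_add_distrib]
  abel

theorem totalDeriv_sum (hU : IsOpen U) (v : Base n) {ι : Type*} (t : Finset ι)
    {f : ι → Jet n s → VAlg n s} (hf : ∀ i ∈ t, IsLocalOn (cyl U) (f i)) {j : Jet n s}
    (hj : j ∈ cyl U) :
    totalDeriv v (fun j => ∑ i ∈ t, f i j) j = ∑ i ∈ t, totalDeriv v (f i) j := by
  simp only [totalDeriv_apply, gDeriv_sum hU t hf hj, map_sum, Finset.smul_sum,
    Finset.sum_add_distrib]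
  rw [Finset.sum_comm]

theorem totalDeriv_smul (hU : IsOpen U) (v : Base n) {g : Jet n s → ℝ} (hg : JSmooth U g)
    {f : Jet n s → VAlg n s} (hf : IsLocalOn (cyl U) f) {j : Jet n s} (hj : j ∈ cyl U) :
    totalDeriv v (fun j => g j • f j) j =
      lineDeriv ℝ g j (cartanLift v j) • f j + g j • totalDeriv v f j := by
  simp only [totalDeriv_apply, gDeriv_smul hU hg hf hj, map_smul, smul_add, Finset.smul_sum,
    smul_comm (g j)]
  abel

theorem totalDeriv_const_smul (hU : IsOpen U) (v : Base n) (c : ℝ)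
    {f : Jet n s → VAlg n s} (hf : IsLocalOn (cyl U) f) {j : Jet n s} (hj : j ∈ cyl U) :
    totalDeriv v (fun j => c • f j) j = c • totalDeriv v f j := by
  simp only [totalDeriv_apply, gDeriv_const_smul hU c hf hj, map_smul, smul_add, Finset.smul_sum,
    smul_comm c]

theorem totalDeriv_mul (hU : IsOpen U) (v : Base n) {f g : Jet n s → VAlg n s}
    (hf : IsLocalOn (cyl U) f) (hg : IsLocalOn (cyl U) g) {j : Jet n s} (hj : j ∈ cyl U) :
    totalDeriv v (fun j => f j * g j) j = totalDeriv v f j * g j + f j * totalDeriv v g j := by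
  simp only [totalDeriv_apply, gDeriv_mul hU hf hg hj, isDer_shiftDer _ (f j), smul_add,
    Finset.sum_add_distrib, add_mul, mul_add, Finset.sum_mul, Finset.mul_sum, smul_mul_assoc,
    mul_smul_comm]
  abel

/-- Total derivatives of the image under a constant linear map that almost commutes with shifts. -/
theorem totalDeriv_map (hU : IsOpen U) (v : Base n) (φ : VAlg n s →ₗ[ℝ] VAlg n s)
    {f : Jet n s → VAlg n s} (hf : IsLocalOn (cyl U) f) {j : Jet n s} (hj : j ∈ cyl U) :
    totalDeriv v (fun j => φ (f j)) j = φ (totalDeriv v f j) +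
      ∑ ν, v ν • (shiftDer ν (φ (f j)) - φ (shiftDer ν (f j))) := by
  simp only [totalDeriv_apply, gDeriv_map hU φ hf hj, map_add, map_sum, map_smul, smul_sub,
    Finset.sum_sub_distrib]
  abel

/-- A constant linear operator commutes with directional derivatives, so the commutator comes
entirely from the shift derivations. -/
theorem pd_totalDeriv (hU : IsOpen U) (v : Base n) (g : Gen n s)
    {f : Jet n s → VAlg n s} (hf : IsLocalOn (cyl U) f) {j : Jet n s} (hj : j ∈ cyl U) :
    pd g (totalDeriv v f j) = totalDeriv v (fun j => pd g (f j)) j +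
      ∑ ν, v ν • pdLower ν g (f j) := by
  rw [totalDeriv_map hU v (pd g) hf hj, add_assoc, ← Finset.sum_add_distrib, eq_comm]
  refine add_eq_left.2 (Finset.sum_eq_zero fun ν _ => ?_)
  rw [pd_shiftDer, ← smul_add]
  simp

theorem totalDeriv_mem_bideg (hU : IsOpen U) (v : Base n) {f : Jet n s → VAlg n s}
    (hf : IsLocalOn (cyl U) f) {q : ℕ} {r : ℤ} (h : ∀ j ∈ cyl U, f j ∈ bideg n s q r)
    {j : Jet n s} (hj : j ∈ cyl U) : totalDeriv v f j ∈ bideg n s q r := by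
  rw [totalDeriv_apply]
  exact add_mem (gDeriv_mem hU hf _ h hj _) (sum_mem fun ν _ =>
    Submodule.smul_mem _ _ (shiftDer_mem_bideg ν (h j hj)))

theorem shiftDer_comm (μ ν : Fin n) (x : VAlg n s) :
    shiftDer μ (shiftDer ν x) = shiftDer ν (shiftDer μ x) := by
  induction x using VAlg_induction with
  | zero => simp
  | add x y hx hy => simp only [map_add, hx, hy]
  | smul r x hx => simp only [map_smul, hx]
  | one => simp [shiftDer_one]
  | gen_mul g x hx =>
    have : (g.shift ν).shift μ = (g.shift μ).shift ν := by
      rcases g with ⟨a, I⟩ | ⟨a, I⟩ <;> simp [Gen.shift, add_right_comm]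
    simp only [isDer_shiftDer _ (gen g), isDer_shiftDer _ (gen (Gen.shift _ g)), map_add,
      shiftDer_gen, hx, this]
    abel

theorem lineDeriv_base {E : Type*} [NormedAddCommGroup E] [NormedSpace ℝ E] (hU : IsOpen U)
    {h : Base n → E} {W : Set (Base n)} (hW : IsOpen W) (hh : ContDiffOn ℝ ∞ h W)
    {j : Jet n s} (hj : j ∈ cyl U) (hjW : j.1 ∈ W) (w : Jet n s) :
    lineDeriv ℝ (fun j : Jet n s => h j.1) j w = fderiv ℝ h j.1 w.1 := by
  rw [jsmooth_fst.lineDeriv_comp hU hh hW hj hjW]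
  congr 1
  have : HasDerivAt (fun t : ℝ => j.1 + t • w.1) w.1 0 := by
    simpa using ((hasDerivAt_id (0 : ℝ)).smul_const w.1).const_add j.1
  exact this.deriv

theorem lineDeriv_coord (a : Fin s.m) (I : MIdx n) (j w : Jet n s) :
    lineDeriv ℝ (fun j : Jet n s => j.2 a I) j w = w.2 a I := by
  have : HasDerivAt (fun t : ℝ => j.2 a I + t * w.2 a I) (w.2 a I) 0 := by
    simpa using ((hasDerivAt_id (0 : ℝ)).mul_const (w.2 a I)).const_add (j.2 a I)
  exact this.deriv

/-- The bracket of Cartan lifts of vector fields on the base. -/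
theorem fieldDeriv_cartanLift (hU : IsOpen U) {X : Jet n s → Base n} (hX : JSmooth U X)
    {j : Jet n s} (hj : j ∈ cyl U) (w : Jet n s) :
    fieldDeriv (fun j => cartanLift (X j) j) j w = cartanLift (lineDeriv ℝ X j w) j +
      (0, fun a I => ∑ ν, X j ν * w.2 a (I + Finsupp.single ν 1)) := by
  refine Prod.ext (by simp [fieldDeriv, cartanLift]) ?_
  funext a I
  have hν : ∀ ν, JSmooth U fun j => X j ν := fun ν =>
    hX.compContDiff (K := fun x : Base n => x ν) (by fun_prop)
  have h1 : ∀ ν, lineDeriv ℝ (fun j => X j ν) j w = (lineDeriv ℝ X j w) ν := fun ν => by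
    have := hX.lineDeriv_comp hU (K := fun x : Base n => x ν) (W := Set.univ)
      (by fun_prop) isOpen_univ hj trivial w
    rw [this]
    exact congrArg (fun L : Base n →L[ℝ] ℝ => L (lineDeriv ℝ X j w))
      ((EuclideanSpace.proj ν : Base n →L[ℝ] ℝ).fderiv (x := X j))
  have h2 : HasDerivAt (fun t : ℝ => ∑ ν, X (j + t • w) ν * (j + t • w).2 a (I + Finsupp.single ν 1))
      (∑ ν, ((lineDeriv ℝ X j w) ν * (j + (0 : ℝ) • w).2 a (I + Finsupp.single ν 1) +
        X (j + (0 : ℝ) • w) ν * w.2 a (I + Finsupp.single ν 1))) 0 := by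
    refine HasDerivAt.fun_sum fun ν _ => ?_
    rw [← h1, ← lineDeriv_coord a (I + Finsupp.single ν 1) j w]
    exact HasDerivAt.mul ((hν ν).hasLineDerivAt hU hj w)
      ((jsmooth_coord (U := U) a _).hasLineDerivAt hU hj w)
  refine h2.deriv.trans ?_
  simp [cartanLift, Finset.sum_add_distrib]

/-- Flatness of the Cartan connection: the hypothesis `hXY` makes the bracket of the lifted fields
vanish. Non-constant fields are allowed because the coordinate fields of one chart have variable
components in another. -/
theorem totalDeriv_comm_fields (hU : IsOpen U) {X Y : Jet n s → Base n} (hX : JSmooth U X)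
    (hY : JSmooth U Y) {f : Jet n s → VAlg n s} (hf : IsLocalOn (cyl U) f) {j : Jet n s}
    (hj : j ∈ cyl U)
    (hXY : lineDeriv ℝ Y j (cartanLift (X j) j) = lineDeriv ℝ X j (cartanLift (Y j) j)) :
    totalDeriv (X j) (fun j => totalDeriv (Y j) f j) j =
      totalDeriv (Y j) (fun j => totalDeriv (X j) f j) j := by
  have hν : ∀ {X : Jet n s → Base n}, JSmooth U X → ∀ ν, JSmooth U fun j => X j ν := fun hX ν =>
    hX.compContDiff (K := fun x : Base n => x ν) (by fun_prop)
  have h1 : ∀ {X : Jet n s → Base n}, JSmooth U X → ∀ w ν,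
      lineDeriv ℝ (fun j => X j ν) j w = (lineDeriv ℝ X j w) ν := fun {X} hX w ν => by
    have := hX.lineDeriv_comp hU (K := fun x : Base n => x ν) (W := Set.univ)
      (by fun_prop) isOpen_univ hj trivial w
    rw [this]
    exact congrArg (fun L : Base n →L[ℝ] ℝ => L (lineDeriv ℝ X j w))
      ((EuclideanSpace.proj ν : Base n →L[ℝ] ℝ).fderiv (x := X j))
  have key : ∀ {X Y : Jet n s → Base n}, JSmooth U X → JSmooth U Y →
      totalDeriv (X j) (fun j => totalDeriv (Y j) f j) j =
      gDeriv (fun j' => gDeriv f j' (cartanLift (Y j') j')) j (cartanLift (X j) j) +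
      (∑ ν, ((lineDeriv ℝ Y j (cartanLift (X j) j)) ν • shiftDer ν (f j))) +
      ((∑ ν, Y j ν • shiftDer ν (gDeriv f j (cartanLift (X j) j))) +
        ∑ ν, X j ν • shiftDer ν (gDeriv f j (cartanLift (Y j) j))) +
      ∑ ν, ∑ μ, (X j ν * Y j μ) • shiftDer ν (shiftDer μ (f j)) := by
    intro X Y hX hY
    have e1 : IsLocalOn (cyl U) fun j => gDeriv f j (cartanLift (Y j) j) :=
      hf.gDeriv_field hU (jfield_cartanLift hY)
    have e2 : ∀ ν ∈ Finset.univ, IsLocalOn (cyl U) fun j => Y j ν • shiftDer ν (f j) := fun ν _ =>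
      (hν hY ν).smul_isLocalOn (hf.map _)
    rw [totalDeriv_apply]
    simp only [totalDeriv_apply (Y _)]
    rw [gDeriv_add hU e1 (IsLocalOn.sum _ e2) hj, gDeriv_sum hU _ e2 hj]
    have e3 : ∀ ν, gDeriv (fun j => Y j ν • shiftDer ν (f j)) j (cartanLift (X j) j) =
        (lineDeriv ℝ Y j (cartanLift (X j) j)) ν • shiftDer ν (f j) +
          Y j ν • shiftDer ν (gDeriv f j (cartanLift (X j) j)) := fun ν => by
      rw [gDeriv_smul hU (hν hY ν) (hf.map _) hj, gDeriv_map hU _ hf hj, h1 hY]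
    simp only [e3, map_add, map_sum, map_smul, smul_add, Finset.sum_add_distrib, Finset.smul_sum,
      mul_smul]
    abel
  have hb := gDeriv_gDeriv hU hf (jfield_cartanLift hX) (jfield_cartanLift hY) hj
  -- The terms that differentiate the components agree by `hXY`; those that raise the multi-index
  -- are symmetric in the two fields.
  have h0 : fieldDeriv (fun j => cartanLift (Y j) j) j (cartanLift (X j) j) -
      fieldDeriv (fun j => cartanLift (X j) j) j (cartanLift (Y j) j) = 0 := by
    rw [fieldDeriv_cartanLift hU hX hj, fieldDeriv_cartanLift hU hY hj, hXY, add_sub_add_left_eq_sub,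
      sub_eq_zero]
    refine Prod.ext rfl ?_
    funext a I
    simp only [cartanLift, Finset.mul_sum]
    rw [Finset.sum_comm]
    refine Finset.sum_congr rfl fun ν _ => Finset.sum_congr rfl fun μ _ => ?_
    rw [add_right_comm]; ring
  obtain ⟨L, hL⟩ := hf.exists_linear hU hj
  rw [h0, hL, map_zero, sub_eq_zero] at hb
  rw [key hX hY, key hY hX, hb, hXY, add_comm (∑ ν, Y j ν • _)]
  congr 1
  rw [Finset.sum_comm]
  refine Finset.sum_congr rfl fun ν _ => Finset.sum_congr rfl fun μ _ => ?_
  rw [shiftDer_comm, mul_comm]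

theorem totalDeriv_comm (hU : IsOpen U) (v w : Base n) {f : Jet n s → VAlg n s}
    (hf : IsLocalOn (cyl U) f) {j : Jet n s} (hj : j ∈ cyl U) :
    totalDeriv v (totalDeriv w f) j = totalDeriv w (totalDeriv v f) j := by
  refine totalDeriv_comm_fields hU (jsmooth_const v) (jsmooth_const w) hf hj ?_
  have : ∀ (u : Base n) (x : Jet n s), lineDeriv ℝ (fun _ : Jet n s => u) j x = 0 := fun u x =>
    (hasDerivAt_const (0 : ℝ) u).deriv
  rw [this, this]

end TotalDerivative

/-! ### Iterated operators -/

section Iter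

variable {n : ℕ} {F F' F'' : Type*}

/-- A relation preserved by each single operator passes to the iterates. With suitable relations
this transfers locality, degrees, linearity and naturality from one total derivative to `D_I`. -/
theorem iterMulti_rel₃ {D : Fin n → F → F} {D' : Fin n → F' → F'} {D'' : Fin n → F'' → F''}
    {Q : F → F' → F'' → Prop}
    (h : ∀ μ f f' f'', Q f f' f'' → Q (D μ f) (D' μ f') (D'' μ f'')) (I : MIdx n) {f : F} {f' : F'}
    {f'' : F''} (hf : Q f f' f'') :
    Q (iterMulti D I f) (iterMulti D' I f') (iterMulti D'' I f'') := by
  have hit : ∀ μ k f f' f'', Q f f' f'' → Q ((D μ)^[k] f) ((D' μ)^[k] f') ((D'' μ)^[k] f'') := by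
    intro μ k
    induction k with
    | zero => exact fun f f' f'' hf => hf
    | succ k ih => exact fun f f' f'' hf => ih _ _ _ (h μ f f' f'' hf)
  unfold iterMulti
  induction List.finRange n with
  | nil => exact hf
  | cons μ l ih => exact hit _ _ _ _ _ ih

theorem iterMulti_rel {D : Fin n → F → F} {D' : Fin n → F' → F'} {Q : F → F' → Prop}
    (h : ∀ μ f f', Q f f' → Q (D μ f) (D' μ f')) (I : MIdx n) {f : F} {f' : F'} (hf : Q f f') :
    Q (iterMulti D I f) (iterMulti D' I f') :=
  iterMulti_rel₃ (D'' := D) (Q := fun f f' _ => Q f f') (f'' := f) (fun μ f f' _ => h μ f f') I hf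

theorem iterMulti_mem {D : Fin n → F → F} {Q : F → Prop} (h : ∀ μ f, Q f → Q (D μ f))
    (I : MIdx n) {f : F} (hf : Q f) : Q (iterMulti D I f) :=
  iterMulti_rel (D' := D) (Q := fun f _ => Q f) (f' := f) (fun μ f _ => h μ f) I hf

theorem iterMulti_zero (D : Fin n → F → F) (f : F) : iterMulti D 0 f = f := by
  unfold iterMulti
  induction List.finRange n with
  | nil => rfl
  | cons μ l ih => simp only [List.foldr_cons, ih]; rfl

/-- The extra `D ν` appears in the slot of `ν` and has to be moved outwards past the operators of
smaller index. The operators commute only on functions with `P` and up to `R`, in practice on local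
functions and over the domain in question. -/
theorem iterMulti_add_single {D : Fin n → F → F} {P : F → Prop} {R : F → F → Prop}
    (hP : ∀ μ f, P f → P (D μ f)) (hrefl : ∀ f, R f f)
    (htrans : ∀ f g h, R f g → R g h → R f h)
    (hR : ∀ μ f g, P f → P g → R f g → R (D μ f) (D μ g))
    (hC : ∀ μ ν f, P f → R (D μ (D ν f)) (D ν (D μ f))) (I : MIdx n) (ν : Fin n) {f : F}
    (hf : P f) : R (iterMulti D (I + Finsupp.single ν 1) f) (D ν (iterMulti D I f)) := by
  have hPit : ∀ μ k f, P f → P ((D μ)^[k] f) := by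
    intro μ k
    induction k with
    | zero => exact fun f hf => hf
    | succ k ih => exact fun f hf => ih _ (hP μ f hf)
  have hRit : ∀ μ k f g, P f → P g → R f g → R ((D μ)^[k] f) ((D μ)^[k] g) := by
    intro μ k
    induction k with
    | zero => exact fun f g _ _ h => h
    | succ k ih => exact fun f g hf hg h => ih _ _ (hP μ f hf) (hP μ g hg) (hR μ f g hf hg h)
  have hCit : ∀ μ k f, P f → R ((D μ)^[k] (D ν f)) (D ν ((D μ)^[k] f)) := by
    intro μ k
    induction k with
    | zero => exact fun f _ => hrefl _
    | succ k ih =>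
      intro f hf
      simp only [Function.iterate_succ_apply]
      refine htrans _ _ _ (hRit μ k _ _ (hP _ _ (hP _ _ hf)) (hP _ _ (hP _ _ hf)) (hC μ ν f hf)) ?_
      exact ih _ (hP _ _ hf)
  have hPl : ∀ (l : List (Fin n)) (I : MIdx n),
      P (l.foldr (fun μ h => (D μ)^[I μ] h) f) := by
    intro l I
    induction l with
    | nil => exact hf
    | cons μ l ih => exact hPit _ _ _ ih
  have hnot : ∀ (l : List (Fin n)), ν ∉ l →
      l.foldr (fun μ h => (D μ)^[(I + Finsupp.single ν 1 : MIdx n) μ] h) f =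
        l.foldr (fun μ h => (D μ)^[I μ] h) f := by
    intro l hl
    induction l with
    | nil => rfl
    | cons μ l ih =>
      simp only [List.mem_cons, not_or] at hl
      simp only [List.foldr_cons, ih hl.2]
      simp [Finsupp.single_eq_of_ne' hl.1]
  have hmem : ∀ (l : List (Fin n)), l.Nodup → ν ∈ l →
      R (l.foldr (fun μ h => (D μ)^[(I + Finsupp.single ν 1 : MIdx n) μ] h) f)
        (D ν (l.foldr (fun μ h => (D μ)^[I μ] h) f)) := by
    intro l hl hν
    induction l with
    | nil => simp at hν
    | cons μ l ih =>
      rw [List.nodup_cons] at hl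
      simp only [List.foldr_cons]
      by_cases h : ν = μ
      · subst h
        rw [hnot l hl.1, Finsupp.add_apply, Finsupp.single_eq_same, Function.iterate_succ_apply']
        exact hrefl _
      · have hν' : ν ∈ l := by simpa [h] using hν
        have e : (I + Finsupp.single ν 1 : MIdx n) μ = I μ := by
          simp [Finsupp.single_eq_of_ne' h]
        rw [e]
        refine htrans _ _ _ (hRit μ _ _ _ (hPl _ _) (hP _ _ (hPl _ _)) (ih hl.2 hν')) ?_
        exact hCit _ _ _ (hPl _ _)
  exact hmem _ (List.nodup_finRange n) (List.mem_finRange ν)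

end Iter

/-! ### Iterated total derivatives and the interior Euler operator. -/

section Euler

variable {n : ℕ} {s : FibreType} {U : Set (ModelProd (Base n) (Base s.m))}

theorem isLocalOn_totalDerivMulti (hU : IsOpen U) (I : MIdx n) {f : Jet n s → VAlg n s}
    (hf : IsLocalOn (cyl U) f) : IsLocalOn (cyl U) (totalDerivMulti I f) :=
  iterMulti_mem (Q := IsLocalOn (cyl U)) (fun _ _ h => isLocalOn_totalDeriv_const hU _ h) I hf

theorem totalDerivMulti_zero (f : Jet n s → VAlg n s) : totalDerivMulti 0 f = f :=
  iterMulti_zero _ f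

theorem totalDerivMulti_add_single (hU : IsOpen U) (I : MIdx n) (ν : Fin n)
    {f : Jet n s → VAlg n s} (hf : IsLocalOn (cyl U) f) : ∀ j ∈ cyl U,
    totalDerivMulti (I + Finsupp.single ν 1) f j =
      totalDeriv (EuclideanSpace.single ν 1) (totalDerivMulti I f) j :=
  iterMulti_add_single (D := fun μ => totalDeriv (EuclideanSpace.single μ (1 : ℝ)))
    (P := fun f : Jet n s → VAlg n s => IsLocalOn (cyl U) f)
    (R := fun f g => ∀ j ∈ cyl U, f j = g j)
    (fun _ _ h => isLocalOn_totalDeriv_const hU _ h) (fun _ _ _ => rfl)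
    (fun _ _ _ h h' j hj => (h j hj).trans (h' j hj))
    (fun _ _ _ _ hg h _ hj => totalDeriv_congr hU _ hg h hj)
    (fun _ _ _ h _ hj => totalDeriv_comm hU _ _ h hj) I ν hf

theorem totalDerivMulti_mem_bideg (hU : IsOpen U) (I : MIdx n) {f : Jet n s → VAlg n s}
    (hf : IsLocalOn (cyl U) f) {q : ℕ} {r : ℤ} (h : ∀ j ∈ cyl U, f j ∈ bideg n s q r) :
    ∀ j ∈ cyl U, totalDerivMulti I f j ∈ bideg n s q r :=
  (iterMulti_mem (Q := fun f => IsLocalOn (cyl U) f ∧ ∀ j ∈ cyl U, f j ∈ bideg n s q r)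
    (fun _ _ h => ⟨isLocalOn_totalDeriv_const hU _ h.1,
      fun _ hj => totalDeriv_mem_bideg hU _ h.1 h.2 hj⟩) I ⟨hf, h⟩).2

theorem totalDerivMulti_congr (hU : IsOpen U) (I : MIdx n) {f g : Jet n s → VAlg n s}
    (hg : IsLocalOn (cyl U) g) (h : ∀ j ∈ cyl U, f j = g j) :
    ∀ j ∈ cyl U, totalDerivMulti I f j = totalDerivMulti I g j :=
  (iterMulti_rel (Q := fun f g => IsLocalOn (cyl U) g ∧ ∀ j ∈ cyl U, f j = g j)
    (D := fun μ => totalDeriv (EuclideanSpace.single μ (1 : ℝ)))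
    (D' := fun μ => totalDeriv (EuclideanSpace.single μ (1 : ℝ)))
    (fun _ _ _ h => ⟨isLocalOn_totalDeriv_const hU _ h.1, fun _ hj =>
      totalDeriv_congr hU _ h.1 h.2 hj⟩) I ⟨hg, h⟩).2

theorem totalDerivMulti_of_zero (hU : IsOpen U) (I : MIdx n) {f : Jet n s → VAlg n s}
    (h : ∀ j ∈ cyl U, f j = 0) : ∀ j ∈ cyl U, totalDerivMulti I f j = 0 :=
  iterMulti_mem (D := fun μ => totalDeriv (EuclideanSpace.single μ (1 : ℝ)))
    (Q := fun f : Jet n s → VAlg n s => ∀ j ∈ cyl U, f j = 0) (fun _ _ h j hj => by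
      rw [totalDeriv_congr hU _ (isLocalOn_const 0) h hj, totalDeriv_const]; simp) I h

theorem totalDerivMulti_add (hU : IsOpen U) (I : MIdx n) {f g : Jet n s → VAlg n s}
    (hf : IsLocalOn (cyl U) f) (hg : IsLocalOn (cyl U) g) : ∀ j ∈ cyl U,
    totalDerivMulti I (fun j => f j + g j) j = totalDerivMulti I f j + totalDerivMulti I g j :=
  (iterMulti_rel₃ (D := fun μ => totalDeriv (EuclideanSpace.single μ (1 : ℝ)))
    (D' := fun μ => totalDeriv (EuclideanSpace.single μ (1 : ℝ)))
    (D'' := fun μ => totalDeriv (EuclideanSpace.single μ (1 : ℝ)))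
    (Q := fun h f g => IsLocalOn (cyl U) f ∧ IsLocalOn (cyl U) g ∧ ∀ j ∈ cyl U, h j = f j + g j)
    (fun _ _ _ _ h => ⟨isLocalOn_totalDeriv_const hU _ h.1, isLocalOn_totalDeriv_const hU _ h.2.1,
      fun _ hj => by
        rw [totalDeriv_congr hU _ (h.1.add h.2.1) h.2.2 hj, totalDeriv_add hU _ h.1 h.2.1 hj]⟩)
    I ⟨hf, hg, fun _ _ => rfl⟩).2.2

theorem totalDerivMulti_const_smul (hU : IsOpen U) (I : MIdx n) (c : ℝ) {f : Jet n s → VAlg n s}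
    (hf : IsLocalOn (cyl U) f) : ∀ j ∈ cyl U,
    totalDerivMulti I (fun j => c • f j) j = c • totalDerivMulti I f j :=
  (iterMulti_rel (D := fun μ => totalDeriv (EuclideanSpace.single μ (1 : ℝ)))
    (D' := fun μ => totalDeriv (EuclideanSpace.single μ (1 : ℝ)))
    (Q := fun h f => IsLocalOn (cyl U) f ∧ ∀ j ∈ cyl U, h j = c • f j)
    (fun _ _ _ h => ⟨isLocalOn_totalDeriv_const hU _ h.1, fun _ hj => by
        rw [totalDeriv_congr hU _ (h.1.const_smul c) h.2 hj, totalDeriv_const_smul hU _ c h.1 hj]⟩)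
    I ⟨hf, fun _ _ => rfl⟩).2

theorem totalDerivMulti_totalDeriv (hU : IsOpen U) (I : MIdx n) (ν : Fin n)
    {f : Jet n s → VAlg n s} (hf : IsLocalOn (cyl U) f) : ∀ j ∈ cyl U,
    totalDerivMulti I (totalDeriv (EuclideanSpace.single ν 1) f) j =
      totalDeriv (EuclideanSpace.single ν 1) (totalDerivMulti I f) j :=
  (iterMulti_rel (D := fun μ => totalDeriv (EuclideanSpace.single μ (1 : ℝ)))
    (D' := fun μ => totalDeriv (EuclideanSpace.single μ (1 : ℝ)))
    (Q := fun h f => IsLocalOn (cyl U) f ∧ ∀ j ∈ cyl U,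
      h j = totalDeriv (EuclideanSpace.single ν 1) f j)
    (fun _ _ _ h => ⟨isLocalOn_totalDeriv_const hU _ h.1, fun _ hj => by
        rw [totalDeriv_congr hU _ (isLocalOn_totalDeriv_const hU _ h.1) h.2 hj,
          totalDeriv_comm hU _ _ h.1 hj]⟩)
    I ⟨hf, fun _ _ => rfl⟩).2

/-- A local function involves only finitely many generators. -/
theorem _root_.IsLocalOn.exists_finset {f : Jet n s → VAlg n s} (hf : IsLocalOn (cyl U) f) :
    ∃ t : Finset (Gen n s), ∀ g ∉ t, ∀ j ∈ cyl U, pd g (f j) = 0 := by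
  classical
  obtain ⟨N, u, b, hu, hf⟩ := hf.exists_sum
  refine ⟨Finset.univ.biUnion fun i => (pd_support_finite (b i)).toFinset, fun g hg j hj => ?_⟩
  simp only [Finset.mem_biUnion, Finset.mem_univ, true_and, Set.Finite.mem_toFinset,
    Set.mem_ofPred_eq, not_exists, not_not] at hg
  rw [hf j hj, map_sum]
  exact Finset.sum_eq_zero fun i _ => by rw [map_smul, hg, smul_zero]

/-- The variational derivative `∑_I (-D)_I (ι_{∂/∂u^a_I} f)`. -/
def varDeriv (a : s.Field) (f : Jet n s → VAlg n s) (j : Jet n s) : VAlg n s :=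
  ∑ᶠ I : MIdx n, (-1 : ℝ) ^ I.degree • totalDerivMulti I (fun j' => pd (Sum.inr (a, I)) (f j')) j

theorem varDeriv_support (hU : IsOpen U) (a : s.Field) {f : Jet n s → VAlg n s}
    (hf : IsLocalOn (cyl U) f) {j : Jet n s} (hj : j ∈ cyl U) :
    (Function.support fun I : MIdx n => (-1 : ℝ) ^ I.degree •
      totalDerivMulti I (fun j' => pd (Sum.inr (a, I)) (f j')) j).Finite := by
  obtain ⟨t, ht⟩ := hf.exists_finset
  refine ((t.finite_toSet).image idx).subset fun I hI => ?_
  by_contra h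
  refine hI ?_
  have : Sum.inr (a, I) ∉ t := fun h' => h ⟨_, h', rfl⟩
  beta_reduce
  rw [totalDerivMulti_of_zero hU I (ht _ this) j hj, smul_zero]

theorem varDeriv_add (hU : IsOpen U) (a : s.Field) {f g : Jet n s → VAlg n s}
    (hf : IsLocalOn (cyl U) f) (hg : IsLocalOn (cyl U) g) {j : Jet n s} (hj : j ∈ cyl U) :
    varDeriv a (fun j => f j + g j) j = varDeriv a f j + varDeriv a g j := by
  rw [varDeriv, varDeriv, varDeriv, ← finsum_add_distrib (varDeriv_support hU a hf hj)
    (varDeriv_support hU a hg hj)]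
  refine finsum_congr fun I => ?_
  simp only [map_add]
  rw [totalDerivMulti_add hU I (hf.map _) (hg.map _) j hj, smul_add]

theorem varDeriv_const_smul (hU : IsOpen U) (a : s.Field) (c : ℝ) {f : Jet n s → VAlg n s}
    (hf : IsLocalOn (cyl U) f) {j : Jet n s} (hj : j ∈ cyl U) :
    varDeriv a (fun j => c • f j) j = c • varDeriv a f j := by
  rw [varDeriv, varDeriv, smul_finsum' _ (varDeriv_support hU a hf hj)]
  refine finsum_congr fun I => ?_
  simp only [map_smul]
  rw [totalDerivMulti_const_smul hU I c (hf.map _) j hj, smul_comm]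

theorem varDeriv_congr (hU : IsOpen U) (a : s.Field) {f g : Jet n s → VAlg n s}
    (hg : IsLocalOn (cyl U) g) (h : ∀ j ∈ cyl U, f j = g j) {j : Jet n s} (hj : j ∈ cyl U) :
    varDeriv a f j = varDeriv a g j :=
  finsum_congr fun I => by
    rw [totalDerivMulti_congr hU I (hg.map (pd (Sum.inr (a, I)))) (fun j hj => by rw [h j hj]) j hj]

theorem varDeriv_sum (hU : IsOpen U) (a : s.Field) {ι : Type*} (t : Finset ι)
    {f : ι → Jet n s → VAlg n s} (hf : ∀ i ∈ t, IsLocalOn (cyl U) (f i)) {j : Jet n s}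
    (hj : j ∈ cyl U) :
    varDeriv a (fun j => ∑ i ∈ t, f i j) j = ∑ i ∈ t, varDeriv a (f i) j := by
  classical
  induction t using Finset.induction_on with
  | empty =>
    simp only [Finset.sum_empty]
    have := varDeriv_const_smul hU a 0 (isLocalOn_const (U := U) (0 : VAlg n s)) hj
    simpa using this
  | insert i t hi ih =>
    simp only [Finset.sum_insert hi]
    rw [varDeriv_add hU a (hf i (by simp)) (IsLocalOn.sum _ fun k hk => hf k (by simp [hk])) hj,
      ih fun k hk => hf k (by simp [hk])]

/-- The variational derivatives of a total derivative vanish. -/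
theorem varDeriv_totalDeriv_single (hU : IsOpen U) (a : s.Field) (ν : Fin n)
    {f : Jet n s → VAlg n s} (hf : IsLocalOn (cyl U) f) {j : Jet n s} (hj : j ∈ cyl U) :
    varDeriv a (totalDeriv (EuclideanSpace.single ν 1) f) j = 0 := by
  have hpd : ∀ I, IsLocalOn (cyl U) fun j => pd (Sum.inr (a, I)) (f j) := fun I => hf.map _
  have hlo : ∀ I, IsLocalOn (cyl U) fun j => pdLower ν (Sum.inr (a, I)) (f j) := fun I => hf.map _
  have e1 : ∀ I : MIdx n, ∀ j ∈ cyl U,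
      pd (Sum.inr (a, I)) (totalDeriv (EuclideanSpace.single ν 1) f j) =
      totalDeriv (EuclideanSpace.single ν 1) (fun j => pd (Sum.inr (a, I)) (f j)) j +
        pdLower ν (Sum.inr (a, I)) (f j) := fun I j hj => by
    rw [pd_totalDeriv hU _ _ hf hj]
    congr 1
    rw [Finset.sum_eq_single ν]
    · simp
    · intro μ _ hμ; simp [hμ]
    · simp
  obtain ⟨t, ht⟩ := hf.exists_finset
  set A : MIdx n → VAlg n s := fun I => (-1 : ℝ) ^ I.degree •
    totalDerivMulti (I + Finsupp.single ν 1) (fun j => pd (Sum.inr (a, I)) (f j)) j with hA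
  set B : MIdx n → VAlg n s := fun I => (-1 : ℝ) ^ I.degree •
    totalDerivMulti I (fun j => pdLower ν (Sum.inr (a, I)) (f j)) j with hB
  have hAfin : (Function.support A).Finite := by
    refine ((t.finite_toSet).image idx).subset fun I hI => ?_
    by_contra h
    refine hI ?_
    have : Sum.inr (a, I) ∉ t := fun h' => h ⟨_, h', rfl⟩
    simp only [hA]
    rw [totalDerivMulti_of_zero hU _ (ht _ this) j hj, smul_zero]
  have hinj : Function.Injective fun I : MIdx n => I + Finsupp.single ν 1 :=
    add_left_injective _
  -- Raising the index by one changes the sign `(-1)^{|I|}`, so the lowered derivatives at `I + ν`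
  -- cancel the differentiated ones at `I`: summation by parts.
  have hBA : ∀ I, B (I + Finsupp.single ν 1) = - A I := fun I => by
    have : pdLower ν (Sum.inr (a, I + Finsupp.single ν 1) : Gen n s) = pd (Sum.inr (a, I)) := by
      simp [pdLower, idx, lower]
    simp only [hA, hB, this, map_add, Finsupp.degree_single, pow_succ, mul_neg, mul_one, neg_smul]
  have hBsupp : ∀ I, I ∉ Set.range (fun I : MIdx n => I + Finsupp.single ν 1) → B I = 0 := by
    intro I hI
    have h0 : I ν = 0 := by
      by_contra h
      exact hI ⟨I - Finsupp.single ν 1, tsub_add_cancel_of_le (single_le h)⟩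
    have : pdLower ν (Sum.inr (a, I) : Gen n s) = 0 := by simp [pdLower, idx, h0]
    simp only [hB, this, LinearMap.zero_apply]
    rw [totalDerivMulti_of_zero hU _ (fun _ _ => rfl) j hj, smul_zero]
  have hBfin : (Function.support B).Finite := by
    refine (hAfin.image fun I : MIdx n => I + Finsupp.single ν 1).subset fun I hI => ?_
    by_cases h : I ∈ Set.range (fun I : MIdx n => I + Finsupp.single ν 1)
    · obtain ⟨J, rfl⟩ := h
      exact ⟨J, fun h => hI (by rw [hBA, h, neg_zero]), rfl⟩
    · exact absurd (hBsupp I h) hI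
  have hsum : varDeriv a (totalDeriv (EuclideanSpace.single ν 1) f) j = ∑ᶠ I, (A I + B I) := by
    refine finsum_congr fun I => ?_
    rw [totalDerivMulti_congr hU I ((isLocalOn_totalDeriv_const hU _ (hpd I)).add (hlo I)) (e1 I)
      j hj, totalDerivMulti_add hU I (isLocalOn_totalDeriv_const hU _ (hpd I)) (hlo I) j hj,
      totalDerivMulti_totalDeriv hU I ν (hpd I) j hj, smul_add,
      ← totalDerivMulti_add_single hU I ν (hpd I) j hj]
  have hB2 : ∑ᶠ I, B I = - ∑ᶠ I, A I := by
    rw [← finsum_neg_distrib, ← finsum_congr hBA, ← finsum_mem_range hinj, ← finsum_mem_univ]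
    refine finsum_mem_inter_support_eq _ _ _ ?_
    ext I
    simp only [Set.univ_inter, Set.mem_inter_iff, Function.mem_support]
    exact ⟨fun h => ⟨by_contra fun h' => h (hBsupp I h'), h⟩, fun h => h.2⟩
  rw [hsum, finsum_add_distrib hAfin hBfin, hB2, add_neg_cancel]

theorem varDeriv_totalDeriv (hU : IsOpen U) (a : s.Field) (v : Base n)
    {f : Jet n s → VAlg n s} (hf : IsLocalOn (cyl U) f) {j : Jet n s} (hj : j ∈ cyl U) :
    varDeriv a (totalDeriv v f) j = 0 := by
  have hl : ∀ ν ∈ Finset.univ, IsLocalOn (cyl U)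
      fun j => v ν • totalDeriv (EuclideanSpace.single ν 1) f j := fun ν _ =>
    (isLocalOn_totalDeriv_const hU _ hf).const_smul _
  rw [varDeriv_congr hU a (IsLocalOn.sum _ hl) (fun j hj => totalDeriv_eq_sum hU hf hj v) hj,
    varDeriv_sum hU a _ hl hj]
  refine Finset.sum_eq_zero fun ν _ => ?_
  rw [varDeriv_const_smul hU a _ (isLocalOn_totalDeriv_const hU _ hf) hj,
    varDeriv_totalDeriv_single hU a ν hf hj, smul_zero]

/-- Variational derivatives of a function without derivatives of the `δu^a`. -/
theorem varDeriv_of_source (hU : IsOpen U) (a : s.Field) {f : Jet n s → VAlg n s}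
    (h : ∀ j ∈ cyl U, ∀ I ≠ 0, pd (Sum.inr (a, I)) (f j) = 0) {j : Jet n s} (hj : j ∈ cyl U) :
    varDeriv a f j = pd (Sum.inr (a, 0)) (f j) := by
  rw [varDeriv, finsum_eq_single _ 0]
  · rw [totalDerivMulti_zero]; simp
  · intro I hI
    rw [totalDerivMulti_of_zero hU I (fun j hj => h j hj I hI) j hj, smul_zero]

theorem euler_eq (q : ℕ) (f : Jet n s → VAlg n s) (j : Jet n s) :
    euler q f j = (q : ℝ)⁻¹ • ∑ a : s.Field, gen (Sum.inr (a, 0)) * varDeriv a f j := rfl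

/-- A total divergence that does not involve derivatives of the `δu^a` is what the interior Euler
operator makes of any local form differing from it by a total divergence. -/
theorem euler_one_eq_of_source (hU : IsOpen U) {f y : Jet n s → VAlg n s}
    (hv : ∀ a, ∀ j ∈ cyl U, varDeriv a f j = varDeriv a y j)
    (hy1 : ∀ j ∈ cyl U, y j ∈ vdegPart n s 1)
    (hy : ∀ j ∈ cyl U, ∀ a, ∀ I ≠ 0, pd (Sum.inr (a, I)) (y j) = 0) {j : Jet n s}
    (hj : j ∈ cyl U) : euler 1 f j = y j := by
  rw [euler_eq, Nat.cast_one, inv_one, one_smul]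
  conv_rhs => rw [eq_finsum_inr (hy1 j hj)]
  have hinj : Function.Injective fun a : s.Field => (a, (0 : MIdx n)) := fun a b h => by
    simpa using h
  rw [← finsum_eq_sum_of_fintype]
  conv_rhs => rw [← finsum_mem_univ]
  have e : ∀ a : s.Field, (gen (Sum.inr (a, 0)) : VAlg n s) * varDeriv a f j =
      gen (Sum.inr (a, 0)) * pd (Sum.inr (a, 0)) (y j) := fun a => by
    rw [hv a j hj, varDeriv_of_source hU a (fun j hj => hy j hj a) hj]
  rw [finsum_congr e, ← finsum_mem_range (f := fun p : s.Field × MIdx n =>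
    (gen (Sum.inr p) : VAlg n s) * pd (Sum.inr p) (y j)) hinj]
  refine finsum_mem_inter_support_eq _ _ _ ?_
  ext ⟨a, I⟩
  simp only [Set.mem_inter_iff, Set.mem_range, Function.mem_support, Set.mem_univ, true_and]
  refine ⟨fun h => h.2, fun h => ⟨⟨a, ?_⟩, h⟩⟩
  by_contra h'
  have hI : I ≠ 0 := fun h0 => h' (by rw [h0])
  exact h (by rw [hy j hj a I hI, mul_zero])

end Euler

/-! ### Forms without derivatives of the vertical generators -/

section Source

variable {n : ℕ} {s : FibreType}

/-- The span of the products of generators other than the `δu^a_I` with `I ≠ 0`. -/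
def undiff (n : ℕ) (s : FibreType) : Submodule ℝ (VAlg n s) :=
  Submodule.span ℝ {b | ∃ l : List (Gen n s), (∀ a I, Sum.inr (a, I) ∈ l → I = 0) ∧
    b = (l.map gen).prod}

theorem mul_mem_undiff {x y : VAlg n s} (hx : x ∈ undiff n s) (hy : y ∈ undiff n s) :
    x * y ∈ undiff n s := by
  have : x * y ∈ undiff n s * undiff n s := Submodule.mul_mem_mul hx hy
  rw [undiff, Submodule.span_mul_span] at this
  refine Submodule.span_mono ?_ this
  rintro _ ⟨_, ⟨l, h, rfl⟩, _, ⟨l', h', rfl⟩, rfl⟩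
  refine ⟨l ++ l', fun a I hI => ?_, by simp⟩
  rcases List.mem_append.1 hI with hI | hI
  · exact h a I hI
  · exact h' a I hI

theorem gen_mem_undiff (a : s.Field) : gen (Sum.inr (a, 0)) ∈ undiff n s :=
  Submodule.subset_span ⟨[Sum.inr (a, 0)], fun b I h => by simp at h; exact h.2, by simp⟩

theorem vdegPart_zero_le_undiff : vdegPart n s 0 ≤ undiff n s := by
  refine Submodule.span_mono ?_
  rintro _ ⟨l, h, rfl⟩
  refine ⟨l, fun a I hI => ?_, rfl⟩
  have := List.sum_eq_zero_iff.1 h 1 (List.mem_map.2 ⟨_, hI, rfl⟩)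
  simp at this

theorem pd_undiff_eq_zero {a : s.Field} {I : MIdx n} (hI : I ≠ 0) {x : VAlg n s}
    (hx : x ∈ undiff n s) : pd (Sum.inr (a, I)) x = 0 := by
  induction hx using Submodule.span_induction with
  | zero => simp
  | add x y _ _ hx hy => rw [map_add, hx, hy, add_zero]
  | smul c x _ hx => rw [map_smul, hx, smul_zero]
  | mem x hx =>
    obtain ⟨l, h, rfl⟩ := hx
    induction l with
    | nil => simp [pd_one]
    | cons g l ih =>
      rw [List.map_cons, List.prod_cons, pd_gen_mul,
        ih fun b J hJ => h b J (List.mem_cons_of_mem _ hJ), if_neg]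
      · simp
      · rintro rfl; exact hI (h a I (by simp))

theorem pd_mem_undiff (g : Gen n s) {x : VAlg n s} (hx : x ∈ undiff n s) :
    pd g x ∈ undiff n s := by
  classical
  induction hx using Submodule.span_induction with
  | zero => simp
  | add x y _ _ hx hy => rw [map_add]; exact add_mem hx hy
  | smul c x _ hx => rw [map_smul]; exact Submodule.smul_mem _ _ hx
  | mem x hx =>
    obtain ⟨l, h, rfl⟩ := hx
    induction l with
    | nil => simp [pd_one]
    | cons h' l ih =>
      have hl : ∀ a I, Sum.inr (a, I) ∈ l → I = 0 := fun b J hJ => h b J (List.mem_cons_of_mem _ hJ)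
      rw [List.map_cons, List.prod_cons, pd_gen_mul]
      refine add_mem ?_ (Submodule.smul_mem _ _ (mul_mem_undiff ?_ (ih hl)))
      · split_ifs
        · exact Submodule.subset_span ⟨l, hl, rfl⟩
        · exact zero_mem _
      · refine Submodule.subset_span ⟨[h'], fun b J hJ => h b J ?_, by simp⟩
        rw [List.mem_singleton] at hJ; simp [hJ]

variable {U : Set (ModelProd (Base n) (Base s.m))}

/-- The finite index set is the same for all jets of the domain, which a pointwise `finsum` would
not give; locality of the contraction can then be checked term by term. -/
theorem exists_contr_eq_sum {X : s.Field → Jet n s → VAlg n s} {f : Jet n s → VAlg n s}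
    (hf : IsLocalOn (cyl U) f) :
    ∃ t : Finset (s.Field × MIdx n), ∀ j ∈ cyl U, contr X f j =
      ∑ p ∈ t, totalDerivMulti p.2 (X p.1) j * pd (Sum.inr p) (f j) := by
  obtain ⟨t, ht⟩ := hf.exists_finset
  refine ⟨t.preimage Sum.inr (Sum.inr_injective.injOn), fun j hj => ?_⟩
  refine finsum_eq_sum_of_support_subset _ fun p hp => ?_
  by_contra h
  refine hp ?_
  beta_reduce
  rw [ht _ (by simpa using h) j hj, mul_zero]

end Source

/-! ### Local forms in a chart and the vanishing of variational derivatives of exact forms. -/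

section Forms

variable {n : ℕ} {s : FibreType} {M : Type*} [TopologicalSpace M] [ChartedSpace (Base n) M]
  {Y : GradedBundle n s M}

/-- Evaluation of alternating maps as a linear map. -/
def evalAlt {p : ℕ} (v : Fin p → Base n) : (Base n) [⋀^Fin p]→ₗ[ℝ] VAlg n s →ₗ[ℝ] VAlg n s where
  toFun α := α v
  map_add' _ _ := rfl
  map_smul' _ _ := rfl

theorem isLocalOn_apply {p : ℕ} (α : LocalForm Y p) (c : AdaptedChart Y) (v : Fin p → Base n) :
    IsLocalOn (cyl c.ψ.target) fun j => α.raw c j v :=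
  IsLocalOn.map (evalAlt v) (α.isLocal c)

theorem isLocalOn_dh {p : ℕ} (α : LocalForm Y p) (c : AdaptedChart Y) (v : Fin (p + 1) → Base n) :
    IsLocalOn (cyl c.ψ.target) fun j => RawForm.dh α.raw c j v :=
  IsLocalOn.sum _ fun _ _ => (isLocalOn_totalDeriv_const c.ψ.open_target _
    (isLocalOn_apply α c _)).const_smul _

theorem varDeriv_dh {p : ℕ} (α : LocalForm Y p) (c : AdaptedChart Y) (v : Fin (p + 1) → Base n)
    (a : s.Field) {j : Jet n s} (hj : j ∈ c.dom) :
    varDeriv a (fun j => RawForm.dh α.raw c j v) j = 0 := by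
  have hU := c.ψ.open_target
  have hl := fun (i : Fin (p + 1)) =>
    isLocalOn_totalDeriv_const hU (v i) (isLocalOn_apply α c fun l => v (i.succAbove l))
  unfold RawForm.dh
  rw [varDeriv_sum hU a _ (fun i _ => (hl i).const_smul _) hj]
  refine Finset.sum_eq_zero fun i _ => ?_
  rw [varDeriv_const_smul hU a _ (hl i) hj, varDeriv_totalDeriv hU a _ (isLocalOn_apply α c _) hj,
    smul_zero]

end Forms

/-! ### Closedness of `γ + γ^{(1)}`. -/

section BoundaryForm

variable {k : ℕ} {s : FibreType} {M : Type*} [TopologicalSpace M] [ChartedSpace (Base (k + 1)) M]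
  {Y : GradedBundle (k + 1) s M}

/-- The boundary form and the form `γ^{(1)}` have opposite horizontal differentials. -/
theorem dh_boundaryForm_add {m : ℕ} (T : ExtendedBVBFV Y m) (ν : VolumeForm (k + 1) M)
    (hω : HasCanonicalForm (T.Ω (k + 1)) ν) (γ : LocalForm Y k)
    (hγ : IsBoundaryForm (T.L (k + 1)) γ) (c : AdaptedChart Y) {j : Jet (k + 1) s}
    (hj : j ∈ c.dom) (v : Fin (k + 1) → Base (k + 1)) :
    RawForm.dh γ.raw c j v + RawForm.dh (T.γ k).raw c j v = 0 := by
  have hU := c.ψ.open_target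
  obtain ⟨w, -, hw, hΩ⟩ := hω c
  set y : Jet (k + 1) s → VAlg (k + 1) s := fun j => RawForm.ins T.Q (T.Ω (k + 1)).raw c j v
    with hy
  obtain ⟨t, ht⟩ := exists_contr_eq_sum (X := T.Q.comp c) (isLocalOn_apply (T.Ω (k + 1)) c v)
  have hyt : ∀ j ∈ cyl c.ψ.target, y j = ∑ p ∈ t, totalDerivMulti p.2 (T.Q.comp c p.1) j *
      pd (Sum.inr p) ((T.Ω (k + 1)).raw c j v) := ht
  have hyloc : IsLocalOn (cyl c.ψ.target) y := by
    refine IsLocalOn.congr (IsLocalOn.sum t fun p _ => IsLocalOn.mul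
      (isLocalOn_totalDerivMulti hU p.2 (T.Q.isLocal c p.1))
      ((isLocalOn_apply (T.Ω (k + 1)) c v).map (pd (Sum.inr p)))) hyt
  have hQ : ∀ p : s.Field × MIdx (k + 1), ∀ j ∈ cyl c.ψ.target,
      totalDerivMulti p.2 (T.Q.comp c p.1) j ∈ bideg (k + 1) s 0 (s.deg p.1 + 1) := fun p =>
    totalDerivMulti_mem_bideg hU p.2 (T.Q.isLocal c p.1) (T.Q.degree c p.1)
  have hy1 : ∀ j ∈ cyl c.ψ.target, y j ∈ vdegPart (k + 1) s 1 := by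
    intro j hj
    rw [hyt j hj]
    refine sum_mem fun p _ => ?_
    have h1 := bideg_le_vdegPart _ _ (hQ p j hj)
    have h2 := bideg_le_vdegPart _ _
      (pd_inr_mem_bideg (p := p) (q := 1) (T.symplectic.degree c j hj v))
    exact mul_mem_vdegPart (q := 0) (q' := 1) h1 h2
  -- `ι_Q ω^{(0)}` is a source form: the canonical form of `ω^{(0)}` has only undifferentiated
  -- `δu^a`, and the components of `Q` contribute no vertical one-forms. This is where the
  -- hypothesis on `ω^{(0)}` enters.
  have hy0 : ∀ j ∈ cyl c.ψ.target, ∀ a, ∀ I ≠ 0, pd (Sum.inr (a, I)) (y j) = 0 := by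
    intro j hj a I hI
    refine pd_undiff_eq_zero hI ?_
    rw [hyt j hj]
    refine sum_mem fun p _ => mul_mem_undiff
      (vdegPart_zero_le_undiff (bideg_le_vdegPart _ _ (hQ p j hj))) (pd_mem_undiff _ ?_)
    rw [hΩ j hj v]
    refine Submodule.smul_mem _ _ (sum_mem fun a _ => sum_mem fun b _ => ?_)
    exact mul_mem_undiff (mul_mem_undiff (vdegPart_zero_le_undiff
      (bideg_le_vdegPart _ _ (hw a b j hj))) (gen_mem_undiff a)) (gen_mem_undiff b)
  set f : Jet (k + 1) s → VAlg (k + 1) s := fun j => RawForm.dv (T.L (k + 1)).raw c j v with hf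
  set g : Jet (k + 1) s → VAlg (k + 1) s := fun j => RawForm.dh (T.γ k).raw c j v with hg
  have hgloc : IsLocalOn (cyl c.ψ.target) g := isLocalOn_dh _ c v
  have hyfg : ∀ j ∈ cyl c.ψ.target, y j = f j + g j := fun j hj =>
    T.structural k (Nat.lt_succ_self k) c j hj v
  -- Locality of `d_v L` is read off from the structural equation, as a difference of two local
  -- functions.
  have hfloc : IsLocalOn (cyl c.ψ.target) f :=
    (hyloc.sub hgloc).congr fun j hj => by rw [hyfg j hj, add_sub_cancel_right]
  have hv : ∀ a, ∀ j ∈ cyl c.ψ.target, varDeriv a f j = varDeriv a y j := by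
    intro a j hj
    rw [varDeriv_congr hU a (hfloc.add hgloc) hyfg hj, varDeriv_add hU a hfloc hgloc hj,
      varDeriv_dh _ c v a hj, add_zero]
  -- The Euler-Lagrange form is `ι_Q ω^{(0)}`, because `d_v L` has the variational derivatives of
  -- this source form.
  have hEL : eulerLagrange (T.L (k + 1)) c j v = y j :=
    euler_one_eq_of_source hU hv hy1 hy0 hj
  have h1 : f j = eulerLagrange (T.L (k + 1)) c j v + RawForm.dh γ.raw c j v := hγ.eq c j hj v
  rw [hEL] at h1
  have h2 := hyfg j hj
  rw [h1] at h2
  have h3 : RawForm.dh γ.raw c j v + g j = (y j + RawForm.dh γ.raw c j v + g j) - y j := by abel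
  rw [h3, ← h2, sub_self]

end BoundaryForm

/-! ### Alternating forms with local coefficients -/

section Alternating

variable {n : ℕ} {s : FibreType} {U : Set (ModelProd (Base n) (Base s.m))} {p : ℕ}

/-- The product of the coordinates `f i` of the `i`-th arguments, as a multilinear form. -/
def coordProd (f : Fin p → Fin n) : MultilinearMap ℝ (fun _ : Fin p => Base n) ℝ :=
  (MultilinearMap.mkPiAlgebra ℝ (Fin p) ℝ).compLinearMap
    fun i => (EuclideanSpace.proj (f i) : Base n →L[ℝ] ℝ).toLinearMap

theorem coordProd_apply (f : Fin p → Fin n) (v : Fin p → Base n) :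
    coordProd f v = ∏ i, v i (f i) := by
  simp [coordProd]

/-- `x ↦ A ⊗ x`. -/
def altSmulRight (A : (Base n) [⋀^Fin p]→ₗ[ℝ] ℝ) :
    VAlg n s →ₗ[ℝ] (Base n) [⋀^Fin p]→ₗ[ℝ] VAlg n s where
  toFun x := (LinearMap.toSpanSingleton ℝ (VAlg n s) x).compAlternatingMap A
  map_add' x y := by ext v; simp
  map_smul' c x := by ext v; simp [smul_comm c]

/-- Expand `α` in the standard basis as a multilinear map and alternate; on an already alternating
form this multiplies by `p!`. The form is thus controlled by its finitely many values on basis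
vectors. -/
theorem factorial_smul_alt (α : (Base n) [⋀^Fin p]→ₗ[ℝ] VAlg n s) :
    (p.factorial : ℝ) • α = ∑ f : Fin p → Fin n,
      altSmulRight (MultilinearMap.alternatization (coordProd f))
        (α fun i => EuclideanSpace.single (f i) 1) := by
  have h1 : (α : MultilinearMap ℝ (fun _ : Fin p => Base n) (VAlg n s)) = ∑ f : Fin p → Fin n,
      (LinearMap.toSpanSingleton ℝ (VAlg n s)
        (α fun i => EuclideanSpace.single (f i) 1)).compMultilinearMap (coordProd f) := by
    ext v
    rw [_root_.sum_apply]
    have h2 : v = fun i => ∑ ν, v i ν • EuclideanSpace.single ν (1 : ℝ) :=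
      funext fun i => base_eq_sum (v i)
    conv_lhs => rw [h2]
    rw [MultilinearMap.map_sum]
    refine Finset.sum_congr rfl fun f _ => ?_
    rw [MultilinearMap.map_smul_univ]
    simp [coordProd_apply]
  have h3 := congrArg MultilinearMap.alternatization h1
  rw [AlternatingMap.coe_alternatization, map_sum, Fintype.card_fin] at h3
  rw [Nat.cast_smul_eq_nsmul ℝ, h3]
  refine Finset.sum_congr rfl fun f _ => ?_
  rw [LinearMap.compMultilinearMap_alternatization]
  rfl

/-- An alternating form is local if all its values are. -/
theorem isLocalOn_alt {a : Jet n s → (Base n) [⋀^Fin p]→ₗ[ℝ] VAlg n s}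
    (h : ∀ v, IsLocalOn (cyl U) fun j => a j v) : IsLocalOn (cyl U) a := by
  have h1 : IsLocalOn (cyl U) fun j => (p.factorial : ℝ)⁻¹ • ∑ f : Fin p → Fin n,
      altSmulRight (MultilinearMap.alternatization (coordProd f))
        (a j fun i => EuclideanSpace.single (f i) 1) :=
    (IsLocalOn.sum _ fun f _ => (h _).map _).const_smul _
  refine h1.congr fun j _ => ?_
  rw [← factorial_smul_alt, smul_smul, inv_mul_cancel₀ (by positivity), one_smul]

theorem _root_.IsLocalOn.eval {a : Jet n s → (Base n) [⋀^Fin p]→ₗ[ℝ] VAlg n s}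
    (h : IsLocalOn (cyl U) a) (v : Fin p → Base n) : IsLocalOn (cyl U) fun j => a j v :=
  h.map (evalAlt v)

/-- The total derivative of a family of alternating forms. -/
def altD (w : Base n) (a : Jet n s → (Base n) [⋀^Fin p]→ₗ[ℝ] VAlg n s) (j : Jet n s) :
    (Base n) [⋀^Fin p]→ₗ[ℝ] VAlg n s :=
  gDeriv a j (cartanLift w j) + ∑ ν, w ν • (shiftDer ν).compAlternatingMap (a j)

theorem altD_apply (hU : IsOpen U) (w : Base n)
    {a : Jet n s → (Base n) [⋀^Fin p]→ₗ[ℝ] VAlg n s} (h : IsLocalOn (cyl U) a) {j : Jet n s}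
    (hj : j ∈ cyl U) (v : Fin p → Base n) :
    altD w a j v = totalDeriv w (fun j => a j v) j := by
  rw [totalDeriv_apply]
  have := gDeriv_map hU (evalAlt v) h hj (cartanLift w j)
  change gDeriv (fun j => a j v) j _ = (gDeriv a j (cartanLift w j)) v at this
  rw [this, altD, AlternatingMap.add_apply]
  congr 1
  exact map_sum (evalAlt v) (fun ν => w ν • (shiftDer ν).compAlternatingMap (a j)) _

theorem isLocalOn_altD (hU : IsOpen U) (w : Base n)
    {a : Jet n s → (Base n) [⋀^Fin p]→ₗ[ℝ] VAlg n s} (h : IsLocalOn (cyl U) a) :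
    IsLocalOn (cyl U) (altD w a) :=
  isLocalOn_alt fun v => (isLocalOn_totalDeriv_const hU w (h.eval v)).congr fun _ hj =>
    altD_apply hU w h hj v

theorem isLinearMap_altD (hU : IsOpen U)
    {a : Jet n s → (Base n) [⋀^Fin p]→ₗ[ℝ] VAlg n s} (h : IsLocalOn (cyl U) a) {j : Jet n s}
    (hj : j ∈ cyl U) : IsLinearMap ℝ fun w => altD w a j where
  map_add v w := by
    ext u
    rw [AlternatingMap.add_apply, altD_apply hU _ h hj, altD_apply hU _ h hj, altD_apply hU _ h hj,
      totalDeriv_add_left hU (h.eval u) hj]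
  map_smul c v := by
    ext u
    rw [AlternatingMap.smul_apply, altD_apply hU _ h hj, altD_apply hU _ h hj,
      totalDeriv_smul_left hU (h.eval u) hj]

open Classical in
/-- The total derivative of a family of alternating forms, as a linear map in the direction (zero
where it is not linear). -/
def altDL (a : Jet n s → (Base n) [⋀^Fin p]→ₗ[ℝ] VAlg n s) (j : Jet n s) :
    Base n →ₗ[ℝ] (Base n) [⋀^Fin p]→ₗ[ℝ] VAlg n s :=
  if h : IsLinearMap ℝ fun w => altD w a j then h.mk' _ else 0

theorem altDL_apply (hU : IsOpen U)
    {a : Jet n s → (Base n) [⋀^Fin p]→ₗ[ℝ] VAlg n s} (h : IsLocalOn (cyl U) a) {j : Jet n s}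
    (hj : j ∈ cyl U) (w : Base n) : altDL a j w = altD w a j := by
  rw [altDL, dif_pos (isLinearMap_altD hU h hj)]; rfl

/-- The horizontal differential of a family of alternating forms. -/
def altDh (a : Jet n s → (Base n) [⋀^Fin p]→ₗ[ℝ] VAlg n s) (j : Jet n s) :
    (Base n) [⋀^Fin (p + 1)]→ₗ[ℝ] VAlg n s :=
  AlternatingMap.alternatizeUncurryFin (altDL a j)

theorem altDh_apply (hU : IsOpen U)
    {a : Jet n s → (Base n) [⋀^Fin p]→ₗ[ℝ] VAlg n s} (h : IsLocalOn (cyl U) a) {j : Jet n s}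
    (hj : j ∈ cyl U) (v : Fin (p + 1) → Base n) :
    altDh a j v = ∑ i : Fin (p + 1), (-1 : ℝ) ^ (i : ℕ) •
      totalDeriv (v i) (fun j' => a j' fun l => v (i.succAbove l)) j := by
  rw [altDh, AlternatingMap.alternatizeUncurryFin_apply]
  refine Finset.sum_congr rfl fun i _ => ?_
  rw [altDL_apply hU h hj, altD_apply hU _ h hj]
  rcases Nat.even_or_odd (i : ℕ) with hi | hi
  · rw [hi.neg_one_pow, hi.neg_one_pow, one_smul, one_smul]; rfl
  · rw [hi.neg_one_pow, hi.neg_one_pow, neg_one_smul, neg_one_smul]; rfl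

theorem isLocalOn_altDh (hU : IsOpen U)
    {a : Jet n s → (Base n) [⋀^Fin p]→ₗ[ℝ] VAlg n s} (h : IsLocalOn (cyl U) a) :
    IsLocalOn (cyl U) (altDh a) := by
  refine isLocalOn_alt fun v => ?_
  refine IsLocalOn.congr (IsLocalOn.sum Finset.univ fun (i : Fin (p + 1)) _ => IsLocalOn.const_smul
    ((-1 : ℝ) ^ (i : ℕ)) (isLocalOn_totalDeriv_const hU (v i)
    (h.eval fun l => v (i.succAbove l)))) fun j hj => ?_
  rw [altDh_apply hU h hj]

/-- Total derivatives in constant directions commute, so the second derivative is symmetric in its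
two directions, and the alternation of a symmetric expression vanishes. -/
theorem altDh_altDh (hU : IsOpen U)
    {a : Jet n s → (Base n) [⋀^Fin p]→ₗ[ℝ] VAlg n s} (h : IsLocalOn (cyl U) a) {j : Jet n s}
    (hj : j ∈ cyl U) : altDh (altDh a) j = 0 := by
  have hl : ∀ w, IsLinearMap ℝ fun y => altD w (altD y a) j := fun w => by
    constructor
    · intro x y
      ext u
      rw [AlternatingMap.add_apply]
      simp only [altD_apply hU _ (isLocalOn_altD hU _ h) hj]
      have e : ∀ y, ∀ j ∈ cyl U, altD y a j u = totalDeriv y (fun j => a j u) j :=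
        fun y j hj => altD_apply hU y h hj u
      have l := fun y => isLocalOn_totalDeriv_const hU y (h.eval u)
      rw [totalDeriv_congr hU w (l _) (e x) hj, totalDeriv_congr hU w (l _) (e y) hj,
        ← totalDeriv_add hU w (l _) (l _) hj]
      exact totalDeriv_congr hU w ((l _).add (l _)) (fun j hj => by
        rw [e _ j hj, totalDeriv_add_left hU (h.eval u) hj]) hj
    · intro c x
      ext u
      rw [AlternatingMap.smul_apply]
      simp only [altD_apply hU _ (isLocalOn_altD hU _ h) hj]
      have e : ∀ y, ∀ j ∈ cyl U, altD y a j u = totalDeriv y (fun j => a j u) j :=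
        fun y j hj => altD_apply hU y h hj u
      have l := fun y => isLocalOn_totalDeriv_const hU y (h.eval u)
      rw [totalDeriv_congr hU w (l _) (e x) hj, ← totalDeriv_const_smul hU w c (l _) hj]
      exact totalDeriv_congr hU w ((l _).const_smul c) (fun j hj => by
        rw [e _ j hj, totalDeriv_smul_left hU (h.eval u) hj]) hj
  have hl2 : IsLinearMap ℝ fun w => (hl w).mk' _ := by
    constructor
    · intro x y
      ext1 z
      exact (isLinearMap_altD hU (isLocalOn_altD hU z h) hj).map_add x y
    · intro c x
      ext1 z
      exact (isLinearMap_altD hU (isLocalOn_altD hU z h) hj).map_smul c x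
  have hsymm : ∀ x y, hl2.mk' _ x y = hl2.mk' _ y x := by
    intro x y
    change altD x (altD y a) j = altD y (altD x a) j
    ext u
    simp only [altD_apply hU _ (isLocalOn_altD hU _ h) hj]
    have e : ∀ y, ∀ j ∈ cyl U, altD y a j u = totalDeriv y (fun j => a j u) j :=
      fun y j hj => altD_apply hU y h hj u
    have l := fun y => isLocalOn_totalDeriv_const hU y (h.eval u)
    rw [totalDeriv_congr hU x (l _) (e y) hj, totalDeriv_congr hU y (l _) (e x) hj,
      totalDeriv_comm hU x y (h.eval u) hj]
  have h0 := AlternatingMap.alternatizeUncurryFin_alternatizeUncurryFinLM_comp_of_symmetric hsymm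
  rw [← h0, altDh]
  congr 1
  ext1 w
  rw [altDL_apply hU (isLocalOn_altDh hU h) hj]
  ext v
  rw [altD_apply hU w (isLocalOn_altDh hU h) hj, LinearMap.comp_apply,
    AlternatingMap.alternatizeUncurryFinLM_apply, AlternatingMap.alternatizeUncurryFin_apply]
  have hsgn : ∀ (i : ℕ) (x : VAlg n s), (-1 : ℤ) ^ i • x = (-1 : ℝ) ^ i • x := by
    intro i x
    rcases Nat.even_or_odd i with hi | hi
    · rw [hi.neg_one_pow, hi.neg_one_pow, one_smul, one_smul]
    · rw [hi.neg_one_pow, hi.neg_one_pow, neg_one_smul, neg_one_smul]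
  have l := fun i : Fin (p + 1) => isLocalOn_totalDeriv_const hU (v i)
    (h.eval fun l => v (i.succAbove l))
  rw [totalDeriv_congr hU w (IsLocalOn.sum _ fun i _ => (l i).const_smul ((-1) ^ (i : ℕ)))
    (fun j hj => altDh_apply hU h hj v) hj,
    totalDeriv_sum hU w _ (fun i _ => (l i).const_smul ((-1) ^ (i : ℕ))) hj]
  refine Finset.sum_congr rfl fun i _ => ?_
  rw [totalDeriv_const_smul hU w _ (l i) hj, hsgn]
  congr 1
  change _ = altD w (altD (v i) a) j (i.removeNth v)
  rw [altD_apply hU w (isLocalOn_altD hU _ h) hj]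
  exact totalDeriv_congr hU w ((isLocalOn_altD hU (v i) h).eval _)
    (fun j hj => (altD_apply hU (v i) h hj _).symm) hj

end Alternating

/-! ### Lowering operators and the homotopy for the horizontal differential -/

section Symbol

variable {n : ℕ} {s : FibreType} {p : ℕ}

/-- In invariant terms, `∑_ν dx^ν ∧ ι_{∂_ν}` is multiplication by the form degree. -/
theorem sum_neg_one_pow_smul_cons (A : (Base n) [⋀^Fin (p + 1)]→ₗ[ℝ] VAlg n s)
    (v : Fin (p + 1) → Base n) :
    ∑ i : Fin (p + 1), (-1 : ℝ) ^ (i : ℕ) • A (Fin.cons (v i) fun l => v (i.succAbove l)) =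
      ((p : ℝ) + 1) • A v := by
  have h := DFunLike.congr_fun (AlternatingMap.alternatizeUncurryFin_curryLeft A) v
  rw [AlternatingMap.alternatizeUncurryFin_apply, AlternatingMap.smul_apply] at h
  have e : ((p : ℝ) + 1) • A v = (p + 1) • A v := by
    rw [← Nat.cast_smul_eq_nsmul ℝ]; push_cast; rfl
  rw [e, ← h]
  refine Finset.sum_congr rfl fun i _ => ?_
  rcases Nat.even_or_odd (i : ℕ) with hi | hi
  · rw [hi.neg_one_pow, hi.neg_one_pow, one_smul, one_smul]; rfl
  · rw [hi.neg_one_pow, hi.neg_one_pow, neg_one_smul, neg_one_smul]; rfl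

theorem add_single_sub_single {I : MIdx n} {μ ν : Fin n} (hI : I ν ≠ 0) :
    I - Finsupp.single ν 1 + Finsupp.single μ 1 = I + Finsupp.single μ 1 - Finsupp.single ν 1 := by
  rw [tsub_add_eq_add_tsub (single_le hI)]

/-- The top order part of the homotopy formula: `S I` is the coefficient of `δu_I`. -/
theorem symbol_identity (S : MIdx n → (Base n) [⋀^Fin (p + 1)]→ₗ[ℝ] VAlg n s) (I : MIdx n)
    (hS : ∀ (μ : Fin n) (w : Fin (p + 2) → Base n), ∑ i : Fin (p + 2), (-1 : ℝ) ^ (i : ℕ) •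
      ∑ ν, w i ν • (if (I + Finsupp.single μ 1 : MIdx n) ν = 0 then (0 : VAlg n s) else
        S (I + Finsupp.single μ 1 - Finsupp.single ν 1) fun l => w (i.succAbove l)) = 0)
    (v : Fin (p + 1) → Base n) :
    ∑ i : Fin (p + 1), (-1 : ℝ) ^ (i : ℕ) • ∑ ν, v i ν • (if I ν = 0 then (0 : VAlg n s) else
      ∑ μ, (((I - Finsupp.single ν 1 : MIdx n) μ : ℝ) + 1) •
        S (I - Finsupp.single ν 1 + Finsupp.single μ 1)
          (Fin.cons (EuclideanSpace.single μ 1) fun l => v (i.succAbove l))) =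
      ((I.degree : ℝ) + n - (p + 1)) • S I v := by
  classical
  set C : Fin (p + 1) → Fin n → Fin n → VAlg n s := fun i ν μ =>
    S (I + Finsupp.single μ 1 - Finsupp.single ν 1)
      (Fin.cons (EuclideanSpace.single μ 1) fun l => v (i.succAbove l)) with hC
  -- `hS` is the leading part of closedness at the index `I + μ`. With `∂_μ` as first argument its
  -- zeroth term is `S I v`, for which the equation is solved.
  have h1 : ∀ μ : Fin n, S I v = ∑ i : Fin (p + 1), (-1 : ℝ) ^ (i : ℕ) •
      ∑ ν, v i ν • (if (I + Finsupp.single μ 1 : MIdx n) ν = 0 then (0 : VAlg n s) else C i ν μ) := by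
    intro μ
    have h := hS μ (Fin.cons (EuclideanSpace.single μ 1) v)
    rw [Fin.sum_univ_succ] at h
    have e0 : ∑ ν, (EuclideanSpace.single μ (1 : ℝ)) ν •
        (if (I + Finsupp.single μ 1 : MIdx n) ν = 0 then (0 : VAlg n s) else
          S (I + Finsupp.single μ 1 - Finsupp.single ν 1) v) = S I v := by
      rw [Finset.sum_eq_single μ]
      · simp
      · intro ν _ hν; simp [hν]
      · simp
    simp only [Fin.cons_zero, Fin.val_zero, pow_zero, one_smul, Fin.zero_succAbove,
      Fin.cons_succ] at h
    rw [e0, add_eq_zero_iff_eq_neg, ← Finset.sum_neg_distrib] at h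
    rw [h]
    refine Finset.sum_congr rfl fun i _ => ?_
    rw [Fin.val_succ, pow_succ, mul_neg_one, neg_smul, neg_neg]
    congr 1
    refine Finset.sum_congr rfl fun ν _ => ?_
    congr 1
    split_ifs with h0
    · rfl
    · refine congrArg (S _) ?_
      refine funext fun l => ?_
      refine Fin.cases ?_ (fun l => ?_) l
      · simp
      · simp
  -- The weights `I_μ + 1` are those of the lowering operators; their sum produces `|I| + n`, and
  -- the form degree `p + 1` is subtracted by `h3`.
  have h2 : ∑ μ, ((I μ : ℝ) + 1) • S I v = ((I.degree : ℝ) + n) • S I v := by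
    rw [← Finset.sum_smul]
    congr 1
    simp [Finset.sum_add_distrib, Finsupp.degree_eq_sum]
  have h3 : ∑ i : Fin (p + 1), (-1 : ℝ) ^ (i : ℕ) • ∑ ν, v i ν •
      S I (Fin.cons (EuclideanSpace.single ν 1) fun l => v (i.succAbove l)) =
      ((p : ℝ) + 1) • S I v := by
    rw [← sum_neg_one_pow_smul_cons]
    refine Finset.sum_congr rfl fun i _ => ?_
    congr 1
    have : ∀ x : Base n, S I (Fin.cons x fun l => v (i.succAbove l)) =
        evalAlt (fun l => v (i.succAbove l)) ((S I).curryLeft x) := fun x => rfl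
    simp only [this]
    conv_rhs => rw [base_eq_sum (v i), map_sum, map_sum]
    simp only [map_smul]
  rw [sub_smul, ← h2, ← h3]
  have h4 : ∑ μ, ((I μ : ℝ) + 1) • S I v = ∑ i : Fin (p + 1), (-1 : ℝ) ^ (i : ℕ) •
      ∑ ν, v i ν • ∑ μ, ((I μ : ℝ) + 1) •
        (if (I + Finsupp.single μ 1 : MIdx n) ν = 0 then (0 : VAlg n s) else C i ν μ) := by
    rw [Finset.sum_congr rfl fun μ _ => congrArg (fun x => ((I μ : ℝ) + 1) • x) (h1 μ)]
    simp only [Finset.smul_sum]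
    rw [Finset.sum_comm]
    refine Finset.sum_congr rfl fun i _ => ?_
    rw [Finset.sum_comm]
    refine Finset.sum_congr rfl fun ν _ => Finset.sum_congr rfl fun μ _ => ?_
    module
  rw [h4, ← Finset.sum_sub_distrib]
  refine Finset.sum_congr rfl fun i _ => ?_
  rw [← smul_sub, ← Finset.sum_sub_distrib]
  congr 1
  refine Finset.sum_congr rfl fun ν _ => ?_
  rw [← smul_sub]
  congr 1
  have h5 : S I (Fin.cons (EuclideanSpace.single ν 1) fun l => v (i.succAbove l)) = C i ν ν := by
    simp [hC]
  have hμ : ∀ μ ≠ ν, (I + Finsupp.single μ 1 : MIdx n) ν = I ν := fun μ h => by simp [h]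
  -- The diagonal term `μ = ν` is split off: there the weight in the homotopy is `I_ν` instead of
  -- `I_ν + 1`, and the surplus is exactly the term counted in `h3`. Off the diagonal the weights
  -- agree.
  have h6 : ∑ μ, ((I μ : ℝ) + 1) • (if (I + Finsupp.single μ 1 : MIdx n) ν = 0 then (0 : VAlg n s)
      else C i ν μ) = (I ν : ℝ) • C i ν ν + C i ν ν + ∑ μ ∈ Finset.univ.erase ν,
        ((I μ : ℝ) + 1) • (if I ν = 0 then (0 : VAlg n s) else C i ν μ) := by
    rw [← Finset.add_sum_erase _ _ (Finset.mem_univ ν), if_neg (by simp), add_smul, one_smul]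
    congr 1
    exact Finset.sum_congr rfl fun μ hm => by rw [hμ μ (Finset.ne_of_mem_erase hm)]
  rw [h5, h6]
  by_cases h0 : I ν = 0
  · rw [if_pos h0, Finset.sum_eq_zero]
    · simp [h0]
    · intro μ hm
      rw [if_pos h0, smul_zero]
  · rw [if_neg h0, ← Finset.add_sum_erase _ _ (Finset.mem_univ ν)]
    have e1 : S (I - Finsupp.single ν 1 + Finsupp.single ν 1)
        (Fin.cons (EuclideanSpace.single ν 1) fun l => v (i.succAbove l)) = C i ν ν := by
      rw [← h5, tsub_add_cancel_of_le (single_le h0)]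
    have e2 : (((I - Finsupp.single ν 1 : MIdx n) ν : ℝ) + 1) = I ν := by
      have : (I - Finsupp.single ν 1 : MIdx n) ν + 1 = I ν := by
        simp; omega
      exact_mod_cast this
    rw [e1, e2, add_right_comm, add_sub_cancel_right]
    congr 1
    refine Finset.sum_congr rfl fun μ hm => ?_
    have hm := Finset.ne_of_mem_erase hm
    rw [if_neg h0, add_single_sub_single h0]
    congr 2
    simp [hm]

/-- The elements whose derivatives along all `δu_I` with `|I| ≥ r` vanish. -/
def ordLT (n : ℕ) (s : FibreType) (r : ℕ) : Submodule ℝ (VAlg n s) where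
  carrier := {x | ∀ a I, r ≤ I.degree → pd (Sum.inr (a, I)) x = 0}
  add_mem' hx hy a I h := by rw [map_add, hx a I h, hy a I h, add_zero]
  zero_mem' a I h := map_zero _
  smul_mem' c x hx a I h := by rw [map_smul, hx a I h, smul_zero]

theorem eq_zero_of_ordLT_zero {x : VAlg n s} (hx : x ∈ vdegPart n s 1) (h : x ∈ ordLT n s 0) :
    x = 0 := by
  rw [eq_finsum_inr hx]
  exact (finsum_congr fun p => by rw [h p.1 p.2 (Nat.zero_le _), mul_zero]).trans finsum_zero

end Symbol

/-! ### The homotopy operator in one chart and reduction of the order. -/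

section Homotopy

variable {n : ℕ} {s : FibreType} {U : Set (ModelProd (Base n) (Base s.m))} {p : ℕ}

/-- A family of operators, one for each base coordinate, that lowers the order of vertical one-forms
by one, with the leading term `δu_I ↦ I_μ δu_{I - μ}`. -/
structure IsLowering (U : Set (ModelProd (Base n) (Base s.m)))
    (Λ : Fin n → Jet n s → VAlg n s →ₗ[ℝ] VAlg n s) : Prop where
  isLocal : ∀ μ f, IsLocalOn (cyl U) f → IsLocalOn (cyl U) fun j => Λ μ j (f j)
  mem_bideg : ∀ μ, ∀ j ∈ cyl U, ∀ r, ∀ x ∈ bideg n s 1 r, Λ μ j x ∈ bideg n s 1 r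
  mem_ordLT : ∀ μ, ∀ j ∈ cyl U, ∀ r, ∀ x ∈ vdegPart n s 1, x ∈ ordLT n s (r + 1) →
    Λ μ j x ∈ ordLT n s r
  pd_eq : ∀ μ, ∀ j ∈ cyl U, ∀ a J, ∀ x ∈ vdegPart n s 1, x ∈ ordLT n s (J.degree + 2) →
    pd (Sum.inr (a, J)) (Λ μ j x) = ((J μ : ℝ) + 1) • pd (Sum.inr (a, J + Finsupp.single μ 1)) x

/-- The contraction of a horizontal form with a family of lowering operators. -/
def lowK (Λ : Fin n → Jet n s → VAlg n s →ₗ[ℝ] VAlg n s)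
    (a : Jet n s → (Base n) [⋀^Fin (p + 1)]→ₗ[ℝ] VAlg n s) (j : Jet n s) :
    (Base n) [⋀^Fin p]→ₗ[ℝ] VAlg n s :=
  ∑ μ, (Λ μ j).compAlternatingMap ((a j).curryLeft (EuclideanSpace.single μ 1))

variable {Λ : Fin n → Jet n s → VAlg n s →ₗ[ℝ] VAlg n s}

theorem lowK_apply (a : Jet n s → (Base n) [⋀^Fin (p + 1)]→ₗ[ℝ] VAlg n s) (j : Jet n s)
    (v : Fin p → Base n) :
    lowK Λ a j v = ∑ μ, Λ μ j (a j (Fin.cons (EuclideanSpace.single μ 1) v)) :=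
  map_sum (evalAlt v) (fun μ => (Λ μ j).compAlternatingMap
    ((a j).curryLeft (EuclideanSpace.single μ 1))) _

theorem isLocalOn_lowK (hΛ : IsLowering U Λ)
    {a : Jet n s → (Base n) [⋀^Fin (p + 1)]→ₗ[ℝ] VAlg n s} (h : IsLocalOn (cyl U) a) :
    IsLocalOn (cyl U) (lowK Λ a) :=
  isLocalOn_alt fun v => (IsLocalOn.sum Finset.univ fun (μ : Fin n) _ => hΛ.isLocal μ _
    (h.eval (Fin.cons (EuclideanSpace.single μ 1) v))).congr fun j _ => lowK_apply a j v

theorem lowK_mem_bideg (hΛ : IsLowering U Λ)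
    {a : Jet n s → (Base n) [⋀^Fin (p + 1)]→ₗ[ℝ] VAlg n s} {j : Jet n s} (hj : j ∈ cyl U) {r : ℤ}
    (h : ∀ v, a j v ∈ bideg n s 1 r) (v : Fin p → Base n) : lowK Λ a j v ∈ bideg n s 1 r := by
  rw [lowK_apply]
  exact sum_mem fun μ _ => hΛ.mem_bideg μ j hj r _ (h _)

theorem lowK_mem_ordLT (hΛ : IsLowering U Λ)
    {a : Jet n s → (Base n) [⋀^Fin (p + 1)]→ₗ[ℝ] VAlg n s} {j : Jet n s} (hj : j ∈ cyl U) {r : ℕ}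
    (h1 : ∀ v, a j v ∈ vdegPart n s 1) (h : ∀ v, a j v ∈ ordLT n s (r + 1)) (v : Fin p → Base n) :
    lowK Λ a j v ∈ ordLT n s r := by
  rw [lowK_apply]
  exact sum_mem fun μ _ => hΛ.mem_ordLT μ j hj r _ (h1 _) (h _)

/-- If `a` does not involve `g`, the coefficient of `g` in `d_h a` comes only from shifts of lower
generators. This gives the leading part of `d_h`, with no derivatives of coefficients left. -/
theorem pd_altDh (hU : IsOpen U) {a : Jet n s → (Base n) [⋀^Fin p]→ₗ[ℝ] VAlg n s}
    (h : IsLocalOn (cyl U) a) {g : Gen n s} (hg : ∀ j ∈ cyl U, ∀ v, pd g (a j v) = 0) {j : Jet n s}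
    (hj : j ∈ cyl U) (v : Fin (p + 1) → Base n) :
    pd g (altDh a j v) = ∑ i : Fin (p + 1), (-1 : ℝ) ^ (i : ℕ) • ∑ ν, v i ν •
      pdLower ν g (a j fun l => v (i.succAbove l)) := by
  rw [altDh_apply hU h hj, map_sum]
  refine Finset.sum_congr rfl fun i _ => ?_
  rw [map_smul, pd_totalDeriv hU _ g (h.eval _) hj,
    totalDeriv_congr hU _ (isLocalOn_const 0) (fun j hj => hg j hj _) hj, totalDeriv_const]
  simp

/-- The homotopy formula modulo lower order. Only the leading terms of `Λ` and of the closedness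
condition contribute at order `r`, so the variable coefficients of `Λ` in lower order are harmless.
-/
theorem altDh_lowK_sub_mem (hU : IsOpen U) (hΛ : IsLowering U Λ)
    {a : Jet n s → (Base n) [⋀^Fin (p + 1)]→ₗ[ℝ] VAlg n s} (h : IsLocalOn (cyl U) a)
    (h1 : ∀ j ∈ cyl U, ∀ v, a j v ∈ vdegPart n s 1) {r : ℕ}
    (hr : ∀ j ∈ cyl U, ∀ v, a j v ∈ ordLT n s (r + 1)) (hc : ∀ j ∈ cyl U, altDh a j = 0)
    {j : Jet n s} (hj : j ∈ cyl U) (v : Fin (p + 1) → Base n) :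
    altDh (lowK Λ a) j v - ((r : ℝ) + n - (p + 1)) • a j v ∈ ordLT n s r := by
  intro b I hI
  have hK := fun j hj => lowK_mem_ordLT (a := a) hΛ hj (h1 j hj) (hr j hj)
  rw [map_sub, map_smul, pd_altDh hU (isLocalOn_lowK hΛ h) (fun j hj v => hK j hj v b I hI) hj]
  have hidx : ∀ ν, idx (Sum.inr (b, I) : Gen n s) ν = I ν := fun _ => rfl
  have hdeg : ∀ {ν}, I ν ≠ 0 → (I - Finsupp.single ν 1 : MIdx n).degree + 1 = I.degree := by
    intro ν h0
    conv_rhs => rw [← tsub_add_cancel_of_le (single_le h0)]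
    simp
  rcases hI.lt_or_eq with hlt | heq
  · rw [hr j hj v b I hlt, smul_zero, sub_zero]
    refine Finset.sum_eq_zero fun i _ => ?_
    rw [Finset.sum_eq_zero, smul_zero]
    intro ν _
    rw [pdLower, hidx]
    split_ifs with h0
    · simp
    · have := hdeg h0
      rw [show pd (lower ν (Sum.inr (b, I))) _ = 0 from
        hK j hj _ b (I - Finsupp.single ν 1) (by omega), smul_zero]
  -- At order exactly `r` the claim is the symbol identity; its hypothesis is the coefficient of
  -- `δu_{I+μ}` in `d_h a = 0`.
  · subst heq
    rw [sub_eq_zero]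
    refine Eq.trans ?_ (symbol_identity
      (fun I => (pd (Sum.inr (b, I))).compAlternatingMap (a j)) I ?_ v)
    · refine Finset.sum_congr rfl fun i _ => ?_
      congr 1
      refine Finset.sum_congr rfl fun ν _ => ?_
      congr 1
      rw [pdLower, hidx]
      split_ifs with h0
      · rfl
      · change pd (Sum.inr (b, I - Finsupp.single ν 1)) _ = _
        rw [lowK_apply, map_sum]
        refine Finset.sum_congr rfl fun μ _ => ?_
        rw [hΛ.pd_eq μ j hj b _ _ (h1 j hj _)]
        · rfl
        · have := hr j hj (Fin.cons (EuclideanSpace.single μ 1) fun l => v (i.succAbove l))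
          rwa [← hdeg h0] at this
    · intro μ w
      have h0 := congrArg (pd (Sum.inr (b, I + Finsupp.single μ 1)))
        (DFunLike.congr_fun (hc j hj) w)
      rw [pd_altDh hU h (fun j hj v => hr j hj v b _ (by simp)) hj, AlternatingMap.zero_apply,
        map_zero] at h0
      refine Eq.trans ?_ h0
      refine Finset.sum_congr rfl fun i _ => ?_
      congr 1
      refine Finset.sum_congr rfl fun ν _ => ?_
      congr 1
      rw [pdLower]
      change _ = (if (I + Finsupp.single μ 1 : MIdx n) ν = 0 then 0 else _ : VAlg n s →ₗ[ℝ] VAlg n s) _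
      split_ifs <;> rfl

theorem altDh_congr (hU : IsOpen U) {a b : Jet n s → (Base n) [⋀^Fin p]→ₗ[ℝ] VAlg n s}
    (hb : IsLocalOn (cyl U) b) (h : ∀ j ∈ cyl U, a j = b j) {j : Jet n s} (hj : j ∈ cyl U) :
    altDh a j = altDh b j := by
  ext v
  rw [altDh_apply hU (hb.congr h) hj, altDh_apply hU hb hj]
  refine Finset.sum_congr rfl fun i _ => ?_
  rw [totalDeriv_congr hU _ (hb.eval _) (fun j hj => by rw [h j hj]) hj]

theorem altDh_sub_smul (hU : IsOpen U) {a b : Jet n s → (Base n) [⋀^Fin p]→ₗ[ℝ] VAlg n s}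
    (ha : IsLocalOn (cyl U) a) (hb : IsLocalOn (cyl U) b) (c : ℝ) {j : Jet n s} (hj : j ∈ cyl U) :
    altDh (fun j => a j - c • b j) j = altDh a j - c • altDh b j := by
  ext v
  rw [AlternatingMap.sub_apply, AlternatingMap.smul_apply,
    altDh_apply hU (ha.sub (hb.const_smul c)) hj, altDh_apply hU ha hj, altDh_apply hU hb hj,
    Finset.smul_sum, ← Finset.sum_sub_distrib]
  refine Finset.sum_congr rfl fun i _ => ?_
  have e := totalDeriv_add hU (v i) (ha.eval fun l => v (i.succAbove l))
    ((hb.eval fun l => v (i.succAbove l)).const_smul (-c)) hj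
  rw [totalDeriv_const_smul hU _ _ (hb.eval _) hj] at e
  have e' : (fun j => (a j - c • b j) fun l => v (i.succAbove l)) =
      fun j => (a j fun l => v (i.succAbove l)) + -c • b j fun l => v (i.succAbove l) := by
    funext j
    rw [AlternatingMap.sub_apply, AlternatingMap.smul_apply]; module
  rw [e', e]
  module

theorem lowK_sub_smul (a b : Jet n s → (Base n) [⋀^Fin (p + 1)]→ₗ[ℝ] VAlg n s) (c : ℝ)
    (j : Jet n s) : lowK Λ (fun j => a j - c • b j) j = lowK Λ a j - c • lowK Λ b j := by
  ext v
  simp only [AlternatingMap.sub_apply, AlternatingMap.smul_apply, lowK_apply, map_sub, map_smul,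
    Finset.sum_sub_distrib, Finset.smul_sum]

/-- Closed local horizontal forms of bidegree `(1, r)`. -/
structure IsClosedForm (U : Set (ModelProd (Base n) (Base s.m))) (r : ℤ)
    (a : Jet n s → (Base n) [⋀^Fin p]→ₗ[ℝ] VAlg n s) : Prop where
  isLocal : IsLocalOn (cyl U) a
  mem : ∀ j ∈ cyl U, ∀ v, a j v ∈ bideg n s 1 r
  closed : ∀ j ∈ cyl U, altDh a j = 0

/-- Subtraction of a multiple of the exact form `d_h K a`. -/
def hstep (Λ : Fin n → Jet n s → VAlg n s →ₗ[ℝ] VAlg n s) (c : ℝ)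
    (a : Jet n s → (Base n) [⋀^Fin (p + 1)]→ₗ[ℝ] VAlg n s) (j : Jet n s) :
    (Base n) [⋀^Fin (p + 1)]→ₗ[ℝ] VAlg n s := a j - c • altDh (lowK Λ a) j

theorem IsClosedForm.hstep (hU : IsOpen U) (hΛ : IsLowering U Λ) {r : ℤ}
    {a : Jet n s → (Base n) [⋀^Fin (p + 1)]→ₗ[ℝ] VAlg n s} (h : IsClosedForm U r a) (c : ℝ) :
    IsClosedForm U r (hstep Λ c a) where
  isLocal := h.isLocal.sub ((isLocalOn_altDh hU (isLocalOn_lowK hΛ h.isLocal)).const_smul c)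
  mem j hj v := by
    refine sub_mem (h.mem j hj v) (Submodule.smul_mem _ c ?_)
    change altDh (lowK Λ a) j v ∈ _
    rw [altDh_apply hU (isLocalOn_lowK hΛ h.isLocal) hj]
    exact sum_mem fun i _ => Submodule.smul_mem _ _ (totalDeriv_mem_bideg hU _
      ((isLocalOn_lowK hΛ h.isLocal).eval _)
      (fun j hj => lowK_mem_bideg hΛ hj (h.mem j hj) _) hj)
  closed j hj := by
    have hK := isLocalOn_lowK hΛ h.isLocal
    refine (altDh_sub_smul hU h.isLocal (isLocalOn_altDh hU hK) c hj).trans ?_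
    rw [h.closed j hj, altDh_altDh hU hK hj, smul_zero, sub_zero]

theorem hstep_congr (hU : IsOpen U) (hΛ : IsLowering U Λ) (c : ℝ)
    {a b : Jet n s → (Base n) [⋀^Fin (p + 1)]→ₗ[ℝ] VAlg n s} (hb : IsLocalOn (cyl U) b)
    (h : ∀ j ∈ cyl U, a j = b j) {j : Jet n s} (hj : j ∈ cyl U) : hstep Λ c a j = hstep Λ c b j := by
  rw [hstep, hstep, h j hj, altDh_congr hU (isLocalOn_lowK hΛ hb) (fun j hj => by
    rw [lowK, lowK, h j hj]) hj]

/-- Both operators are polynomials in the single operator `d_h K`. -/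
theorem hstep_comm (hU : IsOpen U) (hΛ : IsLowering U Λ) (c d : ℝ)
    {a : Jet n s → (Base n) [⋀^Fin (p + 1)]→ₗ[ℝ] VAlg n s} (h : IsLocalOn (cyl U) a)
    {j : Jet n s} (hj : j ∈ cyl U) :
    hstep Λ c (hstep Λ d a) j = hstep Λ d (hstep Λ c a) j := by
  have hK := isLocalOn_lowK hΛ h
  have key : ∀ c d : ℝ, hstep Λ c (hstep Λ d a) j = a j - d • altDh (lowK Λ a) j -
      c • (altDh (lowK Λ a) j - d • altDh (lowK Λ (altDh (lowK Λ a))) j) := by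
    intro c d
    have hD := isLocalOn_altDh hU hK
    rw [hstep, ← altDh_sub_smul hU hK (isLocalOn_lowK hΛ hD) d hj]
    congr 2
    exact congrFun (congrArg altDh (funext fun j => lowK_sub_smul _ _ _ j)) j
  rw [key, key]
  module

/-- The iterates `∏ (1 - d_h K / i) a`, `1 ≤ i ≤ N`. -/
def hiter (Λ : Fin n → Jet n s → VAlg n s →ₗ[ℝ] VAlg n s)
    (a : Jet n s → (Base n) [⋀^Fin (p + 1)]→ₗ[ℝ] VAlg n s) :
    ℕ → Jet n s → (Base n) [⋀^Fin (p + 1)]→ₗ[ℝ] VAlg n s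
  | 0 => a
  | N + 1 => hstep Λ ((N : ℝ) + 1)⁻¹ (hiter Λ a N)

theorem IsClosedForm.hiter (hU : IsOpen U) (hΛ : IsLowering U Λ) {r : ℤ}
    {a : Jet n s → (Base n) [⋀^Fin (p + 1)]→ₗ[ℝ] VAlg n s} (h : IsClosedForm U r a) (N : ℕ) :
    IsClosedForm U r (hiter Λ a N) := by
  induction N with
  | zero => exact h
  | succ N ih => exact ih.hstep hU hΛ _

theorem hiter_hstep (hU : IsOpen U) (hΛ : IsLowering U Λ) {r : ℤ} (c : ℝ)
    {a : Jet n s → (Base n) [⋀^Fin (p + 1)]→ₗ[ℝ] VAlg n s} (h : IsClosedForm U r a) (N : ℕ)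
    {j : Jet n s} (hj : j ∈ cyl U) : hiter Λ (hstep Λ c a) N j = hstep Λ c (hiter Λ a N) j := by
  induction N generalizing j with
  | zero => rfl
  | succ N ih =>
    have hN := h.hiter hU hΛ N
    refine (hstep_congr hU hΛ _ (hN.hstep hU hΛ c).isLocal (fun j hj => ih hj) hj).trans ?_
    exact hstep_comm hU hΛ _ _ hN.isLocal hj

/-- The factor with `1 / (N + 1)` lowers the order of a form of order at most `N`, but in `hiter` it
is applied last; commutativity moves it to the front and the induction hypothesis finishes. Using
the factors in increasing order makes `hiter` one sequence independent of the order of the form, as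
needed for gluing. -/
theorem hiter_eq_zero (hU : IsOpen U) (hΛ : IsLowering U Λ) {r : ℤ} (hn : n = p + 2) (N : ℕ)
    {a : Jet n s → (Base n) [⋀^Fin (p + 1)]→ₗ[ℝ] VAlg n s} (h : IsClosedForm U r a)
    (hN : ∀ j ∈ cyl U, ∀ v, a j v ∈ ordLT n s N) {j : Jet n s} (hj : j ∈ cyl U) :
    hiter Λ a N j = 0 := by
  induction N generalizing a j with
  | zero =>
    ext v
    exact eq_zero_of_ordLT_zero (bideg_le_vdegPart _ _ (h.mem j hj v)) (hN j hj v)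
  | succ N ih =>
    refine (hiter_hstep hU hΛ _ h N hj).symm.trans (ih (h.hstep hU hΛ _) (fun j hj v => ?_) hj)
    have := altDh_lowK_sub_mem hU hΛ h.isLocal (fun j hj v => bideg_le_vdegPart _ _ (h.mem j hj v))
      hN h.closed hj v
    -- Here horizontal degree `n - 1` is used: the constant is positive in every order and matches
    -- the coefficient in `hiter`.
    have e : ((N : ℝ) + n - (p + 1)) = N + 1 := by rw [hn]; push_cast; ring
    rw [e] at this
    have h0 : ((N : ℝ) + 1) ≠ 0 := by positivity
    have e2 : hstep Λ ((N : ℝ) + 1)⁻¹ a j v = (-((N : ℝ) + 1)⁻¹) •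
        (altDh (lowK Λ a) j v - ((N : ℝ) + 1) • a j v) := by
      rw [hstep, AlternatingMap.sub_apply, AlternatingMap.smul_apply, smul_sub, smul_smul, neg_mul,
        inv_mul_cancel₀ h0]
      module
    rw [e2]
    exact Submodule.smul_mem _ _ this

/-- The finitely many values on basis vectors involve finitely many generators each, and they
determine the form; the bound is uniform over the domain. -/
theorem exists_ordLT {a : Jet n s → (Base n) [⋀^Fin p]→ₗ[ℝ] VAlg n s}
    (h : IsLocalOn (cyl U) a) : ∃ N, ∀ j ∈ cyl U, ∀ v, a j v ∈ ordLT n s N := by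
  classical
  choose t ht using fun f : Fin p → Fin n =>
    (h.eval fun i => EuclideanSpace.single (f i) 1).exists_finset
  refine ⟨((Finset.univ.biUnion t).sup fun g => (idx g).degree) + 1, fun j hj v b I hI => ?_⟩
  have e := congrArg (fun x : (Base n) [⋀^Fin p]→ₗ[ℝ] VAlg n s => pd (Sum.inr (b, I)) (x v))
    (factorial_smul_alt (a j))
  have e1 : ∀ f : Fin p → Fin n, pd (Sum.inr (b, I))
      (a j fun i => EuclideanSpace.single (f i) 1) = 0 := fun f => by
    refine ht f _ (fun hm => ?_) j hj
    have := Finset.le_sup (f := fun g => (idx g).degree)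
      (Finset.mem_biUnion.2 ⟨f, Finset.mem_univ _, hm⟩)
    exact absurd (hI.trans this) (Nat.not_succ_le_self _)
  have e2 : ((p.factorial : ℝ) • a j) v = (p.factorial : ℝ) • a j v := rfl
  have e3 : (∑ f : Fin p → Fin n, altSmulRight (MultilinearMap.alternatization (coordProd f))
      (a j fun i => EuclideanSpace.single (f i) 1)) v = ∑ f : Fin p → Fin n,
      (MultilinearMap.alternatization (coordProd f) v) •
      (a j fun i => EuclideanSpace.single (f i) 1) :=
    map_sum (evalAlt v) (fun f => altSmulRight (MultilinearMap.alternatization (coordProd f))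
      (a j fun i => EuclideanSpace.single (f i) 1)) _
  simp only [e2, e3, map_smul, map_sum, e1, smul_zero, Finset.sum_const_zero] at e
  exact (smul_eq_zero.1 e).resolve_left (by positivity)

/-- Closed functions of vertical degree one are zero (in positive dimension). -/
theorem IsClosedForm.eq_zero (hU : IsOpen U) (μ : Fin n) {r : ℤ}
    {a : Jet n s → (Base n) [⋀^Fin 0]→ₗ[ℝ] VAlg n s} (h : IsClosedForm U r a) {j : Jet n s}
    (hj : j ∈ cyl U) : a j = 0 := by
  obtain ⟨N, hN⟩ := exists_ordLT h.isLocal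
  -- Descent on the order: if `|I|` is the highest order possible, the coefficient of `δu_{I+μ}` in
  -- `D_μ a = 0` is the coefficient of `δu_I` in `a`.
  have key : ∀ i ≤ N, ∀ j ∈ cyl U, ∀ v, a j v ∈ ordLT n s (N - i) := by
    intro i
    induction i with
    | zero => exact fun _ => hN
    | succ i ih =>
      intro hi j hj v b I hI
      have ih := ih (by omega)
      have h0 := congrArg (pd (Sum.inr (b, I + Finsupp.single μ 1)))
        (DFunLike.congr_fun (h.closed j hj) fun _ => EuclideanSpace.single μ 1)
      rw [pd_altDh hU h.isLocal (fun j hj v => ih j hj v b _ (by simp; omega)) hj,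
        AlternatingMap.zero_apply, map_zero] at h0
      rw [Fin.sum_univ_one] at h0
      rw [Finset.sum_eq_single μ (fun ν _ hν => by simp [hν]) (by simp)] at h0
      have e : pdLower μ (Sum.inr (b, I + Finsupp.single μ 1) : Gen n s) = pd (Sum.inr (b, I)) := by
        rw [pdLower, if_neg (by simp [idx])]
        simp [lower]
      rw [e] at h0
      have hv : v = fun l => (fun _ : Fin 1 => (EuclideanSpace.single μ (1 : ℝ) : Base n))
          (Fin.succAbove 0 l) := Subsingleton.elim _ _
      rw [hv]
      simpa using h0
  ext v
  exact eq_zero_of_ordLT_zero (bideg_le_vdegPart _ _ (h.mem j hj v)) (by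
    simpa using key N le_rfl j hj v)

end Homotopy

/-! ### Changes of adapted coordinates -/

section Manifolds

variable {n m : ℕ} {H : Type*} [TopologicalSpace H]

theorem contDiffOn_chart_symm [ChartedSpace (Base n) H] {e e' : OpenPartialHomeomorph H (Base n)}
    (he : e ∈ IsManifold.maximalAtlas (𝓡 n) ∞ H) (he' : e' ∈ IsManifold.maximalAtlas (𝓡 n) ∞ H) :
    ContDiffOn ℝ ∞ (fun z => e' (e.symm z)) (e.target ∩ e.symm ⁻¹' e'.source) := by
  have := (mem_groupoid_of_pregroupoid.1 (IsManifold.compatible_of_mem_maximalAtlas he he')).1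
  simp only [contDiffPregroupoid, mfld_simps] at this
  exact this

variable [ChartedSpace (ModelProd (Base n) (Base m)) H]

theorem contDiffOn_prodChart_symm {e e' : OpenPartialHomeomorph H (ModelProd (Base n) (Base m))}
    (he : e ∈ IsManifold.maximalAtlas ((𝓡 n).prod (𝓡 m)) ∞ H)
    (he' : e' ∈ IsManifold.maximalAtlas ((𝓡 n).prod (𝓡 m)) ∞ H) :
    ContDiffOn (E := Base n × Base m) (F := Base n × Base m) ℝ ∞ (fun z => e' (e.symm z))
      (e.target ∩ e.symm ⁻¹' e'.source) := by
  have := (mem_groupoid_of_pregroupoid.1 (IsManifold.compatible_of_mem_maximalAtlas he he')).1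
  simp only [contDiffPregroupoid, mfld_simps, Prod.map_id, Set.preimage_id, Set.range_id,
    Function.comp_id, Function.id_comp] at this
  exact this

theorem contDiffOn_comp_prodChart_symm [IsManifold ((𝓡 n).prod (𝓡 m)) ∞ H]
    {e : OpenPartialHomeomorph H (ModelProd (Base n) (Base m))}
    (he : e ∈ IsManifold.maximalAtlas ((𝓡 n).prod (𝓡 m)) ∞ H)
    {F : Type*} [NormedAddCommGroup F] [NormedSpace ℝ F] {f : H → F} {t : Set H}
    (ht : t ⊆ e.source) (hf : ContMDiffOn ((𝓡 n).prod (𝓡 m)) 𝓘(ℝ, F) ∞ f t) :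
    ContDiffOn (E := Base n × Base m) ℝ ∞ (fun z => f (e.symm z)) (e.target ∩ e.symm ⁻¹' t) := by
  have := ((contMDiffOn_iff_of_mem_maximalAtlas (e' := OpenPartialHomeomorph.refl F) he
    (StructureGroupoid.subset_maximalAtlas _ (by simp)) ht (by simp [Set.mapsTo_univ])).1 hf).2
  simp only [mfld_simps] at this
  refine this.mono ?_
  rintro z ⟨hz, hz'⟩
  exact ⟨_, hz', by simp [hz]⟩

end Manifolds

/-! ### Transition maps of the base and coordinate vector fields. -/

section BaseTransition

variable {n : ℕ} {M : Type*} [TopologicalSpace M] (e e' : OpenPartialHomeomorph M (Base n))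

/-- The change of coordinates between two charts. -/
def chg (x : Base n) : Base n := e' (e.symm x)

/-- The domain of the change of coordinates. -/
def chgDom : Set (Base n) := e.target ∩ e.symm ⁻¹' e'.source

/-- The coordinate vector field of `e'` in the coordinates of `e`. -/
def chgPartial (μ : Fin n) (x : Base n) : Base n :=
  fderiv ℝ (chg e' e) (chg e e' x) (EuclideanSpace.single μ 1)

theorem isOpen_chgDom : IsOpen (chgDom e e') := e.isOpen_inter_preimage_symm e'.open_source

variable {e e'}

theorem chg_mem {x : Base n} (hx : x ∈ chgDom e e') : chg e e' x ∈ chgDom e' e :=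
  ⟨e'.map_source hx.2, by
    simp only [chg, Set.mem_preimage]
    rw [e'.left_inv hx.2]; exact e.map_target hx.1⟩

theorem chg_chg {x : Base n} (hx : x ∈ chgDom e e') : chg e' e (chg e e' x) = x := by
  simp only [chg]
  rw [e'.left_inv hx.2, e.right_inv hx.1]

variable [ChartedSpace (Base n) M]

theorem contDiffOn_chg (he : e ∈ IsManifold.maximalAtlas (𝓡 n) ∞ M)
    (he' : e' ∈ IsManifold.maximalAtlas (𝓡 n) ∞ M)
    : ContDiffOn ℝ ∞ (chg e e') (chgDom e e') := contDiffOn_chart_symm he he'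

theorem hasFDerivAt_chg (he : e ∈ IsManifold.maximalAtlas (𝓡 n) ∞ M)
    (he' : e' ∈ IsManifold.maximalAtlas (𝓡 n) ∞ M)
    {x : Base n} (hx : x ∈ chgDom e e') :
    HasFDerivAt (chg e e') (fderiv ℝ (chg e e') x) x :=
  (((contDiffOn_chg he he').contDiffAt ((isOpen_chgDom e e').mem_nhds hx)).differentiableAt
    (by simp)).hasFDerivAt

theorem fderiv_chg_comp (he : e ∈ IsManifold.maximalAtlas (𝓡 n) ∞ M)
    (he' : e' ∈ IsManifold.maximalAtlas (𝓡 n) ∞ M)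
    {x : Base n} (hx : x ∈ chgDom e e') (v : Base n) :
    fderiv ℝ (chg e' e) (chg e e' x) (fderiv ℝ (chg e e') x v) = v := by
  have h := (hasFDerivAt_chg he' he (chg_mem hx)).comp x (hasFDerivAt_chg he he' hx)
  have h2 : HasFDerivAt (chg e' e ∘ chg e e') (ContinuousLinearMap.id ℝ (Base n)) x :=
    (hasFDerivAt_id x).congr_of_eventuallyEq (by
      filter_upwards [(isOpen_chgDom e e').mem_nhds hx] with y hy using chg_chg hy)
  exact DFunLike.congr_fun (h.unique h2) v

theorem fderiv_chg_chgPartial (he : e ∈ IsManifold.maximalAtlas (𝓡 n) ∞ M)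
    (he' : e' ∈ IsManifold.maximalAtlas (𝓡 n) ∞ M)
    {x : Base n} (hx : x ∈ chgDom e e') (μ : Fin n) :
    fderiv ℝ (chg e e') x (chgPartial e e' μ x) = EuclideanSpace.single μ 1 := by
  have := fderiv_chg_comp he' he (chg_mem hx) (EuclideanSpace.single μ (1 : ℝ))
  rwa [chg_chg hx] at this

theorem eq_sum_chgPartial (he : e ∈ IsManifold.maximalAtlas (𝓡 n) ∞ M)
    (he' : e' ∈ IsManifold.maximalAtlas (𝓡 n) ∞ M)
    {x : Base n} (hx : x ∈ chgDom e e') (v : Base n) :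
    v = ∑ μ, (fderiv ℝ (chg e e') x v) μ • chgPartial e e' μ x := by
  conv_lhs => rw [← fderiv_chg_comp he he' hx v, base_eq_sum (fderiv ℝ (chg e e') x v)]
  simp only [map_sum, map_smul]
  rfl

theorem contDiffOn_chgPartial (he : e ∈ IsManifold.maximalAtlas (𝓡 n) ∞ M)
    (he' : e' ∈ IsManifold.maximalAtlas (𝓡 n) ∞ M)
    (μ : Fin n) : ContDiffOn ℝ ∞ (chgPartial e e' μ) (chgDom e e') := by
  have h1 : ContDiffOn ℝ ∞ (fderiv ℝ (chg e' e)) (chgDom e' e) :=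
    (contDiffOn_chg he' he).fderiv_of_isOpen (isOpen_chgDom e' e) (by simp)
  exact (h1.comp (contDiffOn_chg he he') fun x hx => chg_mem hx).clm_apply
    contDiffOn_const

theorem fderiv_chgPartial (he : e ∈ IsManifold.maximalAtlas (𝓡 n) ∞ M)
    (he' : e' ∈ IsManifold.maximalAtlas (𝓡 n) ∞ M)
    {x : Base n} (hx : x ∈ chgDom e e') (μ : Fin n) (v : Base n) :
    fderiv ℝ (chgPartial e e' μ) x v = fderiv ℝ (fderiv ℝ (chg e' e)) (chg e e' x)
      (fderiv ℝ (chg e e') x v) (EuclideanSpace.single μ 1) := by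
  have h1 : ContDiffOn ℝ ∞ (fderiv ℝ (chg e' e)) (chgDom e' e) :=
    (contDiffOn_chg he' he).fderiv_of_isOpen (isOpen_chgDom e' e) (by simp)
  have h2 := ((h1.contDiffAt ((isOpen_chgDom e' e).mem_nhds (chg_mem hx))).differentiableAt
    (by simp)).hasFDerivAt
  have h3 := (h2.comp x (hasFDerivAt_chg he he' hx)).clm_apply
    (hasFDerivAt_const (EuclideanSpace.single μ (1 : ℝ) : Base n) x)
  rw [show chgPartial e e' μ = fun x => (fderiv ℝ (chg e' e) ∘ chg e e') x
    (EuclideanSpace.single μ 1) from rfl, h3.fderiv]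
  simp

/-- The coordinate fields of `e'` commute: in the coordinates of `e` both sides are the Hessian of
the inverse transition map on two basis vectors. -/
theorem fderiv_chgPartial_comm (he : e ∈ IsManifold.maximalAtlas (𝓡 n) ∞ M)
    (he' : e' ∈ IsManifold.maximalAtlas (𝓡 n) ∞ M)
    {x : Base n} (hx : x ∈ chgDom e e') (μ ν : Fin n) :
    fderiv ℝ (chgPartial e e' μ) x (chgPartial e e' ν x) =
      fderiv ℝ (chgPartial e e' ν) x (chgPartial e e' μ x) := by
  rw [fderiv_chgPartial he he' hx, fderiv_chgPartial he he' hx, fderiv_chg_chgPartial he he' hx,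
    fderiv_chg_chgPartial he he' hx]
  exact ((contDiffOn_chg he' he).contDiffAt ((isOpen_chgDom e' e).mem_nhds
    (chg_mem hx))).isSymmSndFDerivAt
    (by rw [minSmoothness_of_isRCLikeNormedField]; exact WithTop.coe_le_coe.2 le_top) _ _

/-- The coordinate vector fields of a chart in two other charts. -/
theorem chgPartial_chg (he : e ∈ IsManifold.maximalAtlas (𝓡 n) ∞ M)
    (he' : e' ∈ IsManifold.maximalAtlas (𝓡 n) ∞ M)
    {e₀ : OpenPartialHomeomorph M (Base n)}
    (he₀ : e₀ ∈ IsManifold.maximalAtlas (𝓡 n) ∞ M) {x : Base n} (hx : x ∈ chgDom e e')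
    (hx₀ : x ∈ chgDom e e₀) (μ : Fin n) :
    chgPartial e' e₀ μ (chg e e' x) = fderiv ℝ (chg e e') x (chgPartial e e₀ μ x) := by
  have e1 : chg e' e₀ (chg e e' x) = chg e e₀ x := by
    simp only [chg]; rw [e'.left_inv hx.2]
  have hy := chg_mem hx₀
  have h1 := hasFDerivAt_chg he₀ he hy
  have h2 := hasFDerivAt_chg he he' hx
  rw [← chg_chg hx₀] at h2
  have h3 : HasFDerivAt (chg e₀ e') _ (chg e e₀ x) := (h2.comp _ h1).congr_of_eventuallyEq (by
    filter_upwards [(isOpen_chgDom e₀ e).mem_nhds hy] with y hy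
    simp only [chg, Function.comp_apply]
    rw [e.left_inv hy.2])
  rw [chgPartial, chgPartial, e1, h3.fderiv, chg_chg hx₀]
  rfl

end BaseTransition

/-! ### Overlaps of adapted charts and the transformed fibre coordinates. -/

section Transition

variable {n : ℕ} {s : FibreType} {M : Type*} [TopologicalSpace M] [ChartedSpace (Base n) M]
  {Y : GradedBundle n s M} (c c' : AdaptedChart Y)

/-- The domain of the change of base coordinates. -/
def baseOvl : Set (Base n) := chgDom c.φ c'.φ

theorem isOpen_baseOvl : IsOpen (baseOvl c c') := isOpen_chgDom _ _

theorem contDiffOn_baseChange : ContDiffOn ℝ ∞ (c.baseChange c') (baseOvl c c') :=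
  contDiffOn_chg c.φ_mem c'.φ_mem

variable {c c'}

theorem fderiv_baseChange_partial' {x : Base n} (hx : x ∈ baseOvl c c') (μ : Fin n) :
    fderiv ℝ (c.baseChange c') x (c.partial' c' μ x) = EuclideanSpace.single μ 1 :=
  fderiv_chg_chgPartial c.φ_mem c'.φ_mem hx μ

theorem eq_sum_partial' {x : Base n} (hx : x ∈ baseOvl c c') (v : Base n) :
    v = ∑ μ, (fderiv ℝ (c.baseChange c') x v) μ • c.partial' c' μ x :=
  eq_sum_chgPartial c.φ_mem c'.φ_mem hx v

theorem contDiffOn_partial' (μ : Fin n) : ContDiffOn ℝ ∞ (c.partial' c' μ) (baseOvl c c') :=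
  contDiffOn_chgPartial c.φ_mem c'.φ_mem μ

theorem fderiv_partial'_comm {x : Base n} (hx : x ∈ baseOvl c c') (μ ν : Fin n) :
    fderiv ℝ (c.partial' c' μ) x (c.partial' c' ν x) =
      fderiv ℝ (c.partial' c' ν) x (c.partial' c' μ x) :=
  fderiv_chgPartial_comm c.φ_mem c'.φ_mem hx μ ν

variable (c c')

/-- The domain of the change of coordinates of `Y₀`. -/
def ovl : Set (ModelProd (Base n) (Base s.m)) := c.ψ.target ∩ c.ψ.symm ⁻¹' c'.ψ.source

theorem isOpen_ovl : IsOpen (ovl c c') := c.ψ.isOpen_inter_preimage_symm c'.ψ.open_source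

variable {c c'}

theorem ovl_subset : ovl c c' ⊆ c.ψ.target := Set.inter_subset_left

theorem proj_toY₀ {j : Jet n s} (hj : j ∈ c.dom) :
    Y.proj (c.toY₀ j) ∈ c.φ.source ∧ c.φ (Y.proj (c.toY₀ j)) = j.1 := by
  have h := c.fibred _ (c.ψ.map_target hj)
  refine ⟨h.1, ?_⟩
  rw [AdaptedChart.toY₀, ← h.2, c.ψ.right_inv hj]; rfl

theorem fst_mem_target {j : Jet n s} (hj : j ∈ c.dom) : j.1 ∈ c.φ.target := by
  rw [← (proj_toY₀ hj).2]; exact c.φ.map_source (proj_toY₀ hj).1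

theorem symm_fst {j : Jet n s} (hj : j ∈ c.dom) : c.φ.symm j.1 = Y.proj (c.toY₀ j) := by
  rw [← (proj_toY₀ hj).2, c.φ.left_inv (proj_toY₀ hj).1]

theorem fst_mem_baseOvl {j : Jet n s} (hj : j ∈ c.overlap c') : j.1 ∈ baseOvl c c' :=
  ⟨fst_mem_target hj.1, by
    rw [Set.mem_preimage, symm_fst hj.1]; exact (c'.fibred _ hj.2).1⟩

theorem jsmooth_base {E : Type*} [NormedAddCommGroup E] [NormedSpace ℝ E]
    {U : Set (ModelProd (Base n) (Base s.m))} {W : Set (Base n)} {h : Base n → E}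
    (hh : ContDiffOn ℝ ∞ h W) (hU : ∀ j ∈ cyl U, j.1 ∈ W) :
    JSmooth U fun j : Jet n s => h j.1 := jsmooth_fst.comp hh hU

theorem jsmooth_partial' (μ : Fin n) :
    JSmooth (ovl c c') fun j : Jet n s => c.partial' c' μ j.1 :=
  jsmooth_base (contDiffOn_partial' μ) fun _ hj => fst_mem_baseOvl hj

theorem jsmooth_pt {U : Set (ModelProd (Base n) (Base s.m))} :
    JSmooth (E := Base n × Base s.m) U fun j : Jet n s => j.pt := by
  refine jsmooth_fst.prodMk ?_
  exact (jsmooth_pi fun a : Fin s.m => jsmooth_coord a 0).compContDiff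
    (PiLp.contDiff_toLp (p := 2))

theorem jsmooth_coord₀ (a : Fin s.m) : JSmooth (ovl c c') (c.coord₀ c' a) := by
  have h := (jsmooth_pt (U := ovl c c')).comp
    (contDiffOn_prodChart_symm c.ψ_mem c'.ψ_mem) fun j hj => hj
  exact h.compContDiff (K := fun z : Base n × Base s.m => z.2 a) (by fun_prop)

/-- The coefficients are matrix entries of the change of trivialization of a smooth vector bundle,
read in the chart of `Y₀`. -/
theorem isLocalOn_coord₁ (a : s.Graded) : IsLocalOn (cyl (ovl c c')) (c.coord₁ c' a) := by
  refine IsLocalOn.sum _ fun b _ => JSmooth.smul_isLocalOn_const ?_ _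
  have := c.triv_mem a.1
  have := c'.triv_mem a.1
  have h1 := (contMDiffOn_coordChangeL (n := ∞) (IB := (𝓡 n).prod (𝓡 s.m)) (𝕜 := ℝ)
    (c.triv a.1) (c'.triv a.1)).mono
    (Set.inter_subset_inter (c.source_subset a.1) (c'.source_subset a.1))
  have h2 := contDiffOn_comp_prodChart_symm c.ψ_mem (t := c.ψ.source ∩ c'.ψ.source)
    Set.inter_subset_left h1
  have h3 := (jsmooth_pt (U := ovl c c')).comp h2 fun j hj =>
    ⟨hj.1, c.ψ.map_target hj.1, hj.2⟩
  have h4 := h3.compContDiff (K := fun L : (Fin (s.rk a.1.1) → ℝ) →L[ℝ] (Fin (s.rk a.1.1) → ℝ) =>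
    L (Pi.single b 1) a.2) (by fun_prop)
  refine h4.congr fun j hj => ?_
  exact (congrFun (Bundle.Trivialization.coordChangeL_apply' (R := ℝ) (c.triv a.1) (c'.triv a.1)
    (b := c.toY₀ j) ⟨c.source_subset _ (c.ψ.map_target hj.1), c'.source_subset _ hj.2⟩ _) _).symm

end Transition

/-! ### The vertical differential and total derivatives -/

section VerticalDifferential

variable {n : ℕ} {s : FibreType} {U : Set (ModelProd (Base n) (Base s.m))}

/-- The part of the vertical differential along the generators of nonzero degree. -/
def vertAlg : VAlg n s →ₗ[ℝ] VAlg n s :=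
  der (Sum.elim (fun p => gen (Sum.inr (Sum.inr p.1, p.2))) fun _ => 0)

theorem finsum_inl_eq {F : Type*} [AddCommMonoid F] (f : Gen n s → F)
    (h : ∀ p, f (Sum.inr p) = 0) : ∑ᶠ g, f g = ∑ᶠ p, f (Sum.inl p) := by
  rw [← finsum_mem_range Sum.inl_injective, ← finsum_mem_univ]
  refine finsum_mem_inter_support_eq f _ _ ?_
  ext (p | p)
  · simp
  · simp [h p]

/-- The direction of the jet coordinate `u_p`. -/
def eP (p : Fin s.m × MIdx n) : Jet n s := (0, Pi.single p.1 (Pi.single p.2 1))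

theorem vertD_apply (f : Jet n s → VAlg n s) (j : Jet n s) :
    vertD f j = (∑ᶠ p : Fin s.m × MIdx n, gen (Sum.inr (Sum.inl p.1, p.2)) * gDeriv f j (eP p)) +
      vertAlg (f j) := by
  rw [vertAlg, der_apply, finsum_inl_eq _ fun p => by simp]
  rfl

theorem even_iff_of_shift_parity (p : s.Graded × MIdx n) :
    Gen.IsEven (Sum.inl p : Gen n s) ↔ ¬ Gen.IsEven (Sum.inr (Sum.inr p.1, p.2) : Gen n s) := by
  simp only [Gen.IsEven, Gen.vdeg, Gen.gdeg, Int.even_add]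
  simp

open Classical in
-- The form `δθ` has parity opposite to `θ`, so the signs from `pd` and from exchanging `δθ` with
-- `gen h` no longer cancel: their product is the parity of `h`. Thus `vertAlg` is an odd
-- derivation.
theorem vertAlg_gen_mul (h : Gen n s) (x : VAlg n s) : vertAlg (gen h * x) =
    vertAlg (gen h) * x + (if h.IsEven then (1 : ℝ) else -1) • (gen h * vertAlg x) := by
  set Z : Gen n s → VAlg n s :=
    Sum.elim (fun p => gen (Sum.inr (Sum.inr p.1, p.2))) fun _ => 0 with hZ
  have e : ∀ g, Z g * pd g (gen h * x) = (if g = h then Z h * x else 0) +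
      (if h.IsEven then (1 : ℝ) else -1) • (gen h * (Z g * pd g x)) := by
    intro g
    rw [pd_gen_mul, mul_add]
    congr 1
    · split_ifs with h' <;> simp [h']
    · rcases g with p | p
      · have h1 := gen_mul_gen (Sum.inr (Sum.inr p.1, p.2)) h
        have h2 := even_iff_of_shift_parity (n := n) p
        rw [mul_smul_comm, ← mul_assoc, hZ, Sum.elim_inl, h1, smul_mul_assoc, smul_smul, mul_assoc]
        congr 1
        unfold koszulSign
        by_cases h3 : h.IsEven
        · simp [h3]
        · by_cases h4 : Gen.IsEven (Sum.inr (Sum.inr p.1, p.2) : Gen n s)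
          · have : ¬ Gen.IsEven (Sum.inl p : Gen n s) := fun h => h2.1 h h4
            simp [h3, h4, this]
          · simp [h3, h4, h2.2 h4]
      · simp [hZ]
  rw [vertAlg, der_gen, der_apply, finsum_congr e, finsum_add_distrib, finsum_eq_single _ h,
    if_pos rfl, der_apply, mul_finsum' _ _ (mul_pd_support_finite Z x), smul_finsum']
  · exact (mul_pd_support_finite Z x).subset fun g hg h' => hg (by simp [h'])
  · intro g hg; rw [if_neg hg]
  · exact (Set.finite_singleton h).subset fun g hg => by
      by_contra h'; exact hg (if_neg h')
  · exact (mul_pd_support_finite Z x).subset fun g hg h' => hg (by simp [h'])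

theorem vertAlg_one : vertAlg (1 : VAlg n s) = 0 := der_one _

theorem vertAlg_inl (p : s.Graded × MIdx n) :
    vertAlg (gen (Sum.inl p) : VAlg n s) = gen (Sum.inr (Sum.inr p.1, p.2)) := der_gen _ _

theorem vertAlg_inr (p : s.Field × MIdx n) : vertAlg (gen (Sum.inr p) : VAlg n s) = 0 :=
  der_gen _ _

theorem vertAlg_shiftDer (μ : Fin n) (x : VAlg n s) :
    vertAlg (shiftDer μ x) = shiftDer μ (vertAlg x) := by
  classical
  induction x using VAlg_induction with
  | zero => simp
  | add x y hx hy => simp only [map_add, hx, hy]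
  | smul r x hx => simp only [map_smul, hx]
  | one => simp [vertAlg_one, shiftDer_one]
  | gen_mul h x hx =>
    have h1 : vertAlg (gen (h.shift μ)) = shiftDer μ (vertAlg (gen h) : VAlg n s) := by
      rcases h with p | p
      · rw [vertAlg_inl, shiftDer_gen]; exact vertAlg_inl _
      · rw [vertAlg_inr, map_zero]; exact vertAlg_inr _
    rw [isDer_shiftDer, shiftDer_gen, map_add, vertAlg_gen_mul, vertAlg_gen_mul, vertAlg_gen_mul,
      hx, map_add, map_smul, isDer_shiftDer, isDer_shiftDer, shiftDer_gen, h1]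
    simp only [isEven_shift, smul_add]
    abel

section

variable {F : Type*} [AddCommGroup F] [Module ℝ F]

theorem gDeriv_eq_zero {f : Jet n s → F} {j w : Jet n s} (h : ∀ t : ℝ, f (j + t • w) = f j) :
    gDeriv f j w = 0 :=
  gDeriv_unique fun l => by
    rw [map_zero]
    exact (hasDerivAt_const (0 : ℝ) (l (f j))).congr_of_eventuallyEq
      (Filter.Eventually.of_forall fun t => congrArg l (h t))

theorem lineDeriv_base_eP {E : Type*} [NormedAddCommGroup E] [NormedSpace ℝ E] (h : Base n → E)
    (j : Jet n s) (p : Fin s.m × MIdx n) : lineDeriv ℝ (fun j : Jet n s => h j.1) j (eP p) = 0 := by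
  have : (fun t : ℝ => h (j + t • eP p).1) = fun _ => h j.1 := by
    funext t; simp [eP]
  rw [lineDeriv]
  exact (congrArg (fun g : ℝ → E => deriv g 0) this).trans (deriv_const _ _)

theorem exists_finset_gDeriv (hU : IsOpen U) {f : Jet n s → F} (hf : IsLocalOn (cyl U) f) :
    ∃ S : Finset (Fin s.m × MIdx n), ∀ p ∉ S, ∀ j ∈ cyl U, gDeriv f j (eP p) = 0 := by
  obtain ⟨S, N, G, b, hG, hf⟩ := hf
  refine ⟨S, fun p hp j hj => ?_⟩
  have e : ∀ t : ℝ, (j + t • eP p).trunc S = j.trunc S := by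
    intro t
    refine Prod.ext (by simp [Jet.trunc, eP]) (funext fun i => ?_)
    have : (i.1.1, i.1.2) ≠ (p.1, p.2) := fun h => hp (by
      have := i.2; rwa [show i.1 = p from h] at this)
    simp only [Jet.trunc, eP, Prod.snd_add, Prod.smul_snd, Pi.add_apply, Pi.smul_apply, smul_eq_mul]
    by_cases h1 : i.1.1 = p.1
    · rw [h1, Pi.single_eq_same, Pi.single_eq_of_ne (fun h2 => this (Prod.ext h1 h2)), mul_zero,
        add_zero]
    · rw [Pi.single_eq_of_ne h1, Pi.zero_apply, mul_zero, add_zero]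
  refine (gDeriv_congr hU (f := f) (g := fun j => ∑ i, G i (j.trunc S) • b i)
    ⟨S, N, G, b, hG, fun _ _ => rfl⟩ hf hj _).trans (gDeriv_eq_zero fun t => ?_)
  simp only [e]

theorem jfield_const (w : Jet n s) : JField U fun _ => w :=
  ⟨jsmooth_const _, fun _ _ => jsmooth_const _⟩

theorem isLocalOn_gDeriv_const (hU : IsOpen U) {f : Jet n s → F} (hf : IsLocalOn (cyl U) f)
    (w : Jet n s) : IsLocalOn (cyl U) fun j => gDeriv f j w := hf.gDeriv_field hU (jfield_const w)

theorem exists_finset_vertD (hU : IsOpen U) {f : Jet n s → VAlg n s} (hf : IsLocalOn (cyl U) f) :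
    ∃ S : Finset (Fin s.m × MIdx n), ∀ j ∈ cyl U, vertD f j =
      (∑ p ∈ S, gen (Sum.inr (Sum.inl p.1, p.2)) * gDeriv f j (eP p)) + vertAlg (f j) := by
  obtain ⟨S, hS⟩ := exists_finset_gDeriv hU hf
  refine ⟨S, fun j hj => ?_⟩
  rw [vertD_apply, finsum_eq_sum_of_support_subset]
  intro p hp
  by_contra h
  exact hp (by beta_reduce; rw [hS p h j hj, mul_zero])

theorem isLocalOn_vertD (hU : IsOpen U) {f : Jet n s → VAlg n s} (hf : IsLocalOn (cyl U) f) :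
    IsLocalOn (cyl U) (vertD f) := by
  obtain ⟨S, hS⟩ := exists_finset_vertD hU hf
  exact ((IsLocalOn.sum S fun p _ => (isLocalOn_const _).mul
    (isLocalOn_gDeriv_const hU hf (eP p))).add (hf.map vertAlg)).congr hS

theorem vertD_congr (hU : IsOpen U) {f g : Jet n s → VAlg n s} (hg : IsLocalOn (cyl U) g)
    (h : ∀ j ∈ cyl U, f j = g j) {j : Jet n s} (hj : j ∈ cyl U) : vertD f j = vertD g j := by
  rw [vertD_apply, vertD_apply, h j hj]
  congr 1
  exact finsum_congr fun p => by rw [gDeriv_congr hU hg h hj]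

/-- The counterpart of `pd_totalDeriv` for the jet coordinates of degree zero. The commutator is the
derivative along the bracket of `∂/∂u_I` with the Cartan lift, `∑_ν X^ν ∂/∂u_{I-ν}`; `X` contributes
nothing because it depends on the base point only. -/
theorem gDeriv_totalDeriv (hU : IsOpen U) {X : Base n → Base n}
    (hX : JSmooth U fun j : Jet n s => X j.1) {f : Jet n s → VAlg n s} (hf : IsLocalOn (cyl U) f)
    (p : Fin s.m × MIdx n) {j : Jet n s} (hj : j ∈ cyl U) :
    gDeriv (fun j => totalDeriv (X j.1) f j) j (eP p) =
      totalDeriv (X j.1) (fun j => gDeriv f j (eP p)) j +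
      ∑ ν, X j.1 ν • (if p.2 ν = 0 then 0 else gDeriv f j (eP (p.1, p.2 - Finsupp.single ν 1))) := by
  have hν : ∀ ν, JSmooth U fun j : Jet n s => X j.1 ν := fun ν =>
    hX.compContDiff (K := fun x : Base n => x ν) (by fun_prop)
  have e1 : IsLocalOn (cyl U) fun j => gDeriv f j (cartanLift (X j.1) j) :=
    hf.gDeriv_field hU (jfield_cartanLift hX)
  have e2 : ∀ ν ∈ Finset.univ, IsLocalOn (cyl U) fun j => X j.1 ν • shiftDer ν (f j) := fun ν _ =>
    (hν ν).smul_isLocalOn (hf.map _)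
  simp only [totalDeriv_apply]
  rw [gDeriv_add hU e1 (IsLocalOn.sum _ e2) hj, gDeriv_sum hU _ e2 hj]
  have e3 : ∀ ν, gDeriv (fun j => X j.1 ν • shiftDer ν (f j)) j (eP p) =
      X j.1 ν • shiftDer ν (gDeriv f j (eP p)) := fun ν => by
    rw [gDeriv_smul hU (hν ν) (hf.map _) hj, gDeriv_map hU _ hf hj,
      lineDeriv_base_eP (fun x => X x ν), zero_smul, zero_add]
  simp only [e3]
  have hb := gDeriv_gDeriv hU hf (jfield_const (eP p)) (jfield_cartanLift hX) hj
  have e4 : fieldDeriv (fun _ : Jet n s => eP p) j (cartanLift (X j.1) j) = 0 := by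
    refine Prod.ext ?_ ?_
    · exact (hasDerivAt_const (0 : ℝ) _).deriv
    · funext a I; exact (hasDerivAt_const (0 : ℝ) _).deriv
  have e5 : fieldDeriv (fun j => cartanLift (X j.1) j) j (eP p) =
      ∑ ν, X j.1 ν • (if p.2 ν = 0 then 0 else eP (p.1, p.2 - Finsupp.single ν 1)) := by
    rw [fieldDeriv_cartanLift hU hX hj, lineDeriv_base_eP X]
    have h0 : cartanLift 0 j = 0 := by
      refine Prod.ext rfl ?_
      funext a I; simp [cartanLift]
    rw [h0, zero_add]
    refine Prod.ext ?_ ?_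
    · rw [Prod.fst_sum]
      refine (Finset.sum_eq_zero fun ν _ => ?_).symm
      split_ifs <;> simp [eP]
    · rw [Prod.snd_sum]
      funext a I
      rw [Finset.sum_apply, Finset.sum_apply]
      change ∑ ν, X j.1 ν * (eP p).2 a (I + Finsupp.single ν 1) = _
      refine Finset.sum_congr rfl fun ν _ => ?_
      change _ = X j.1 ν * (if p.2 ν = 0 then (0 : Jet n s)
        else eP (p.1, p.2 - Finsupp.single ν 1)).2 a I
      congr 1
      by_cases ha : a = p.1
      · subst ha
        by_cases hp : p.2 ν = 0
        · have : I + Finsupp.single ν 1 ≠ p.2 := fun h => by simp [← h] at hp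
          simp [hp, eP, Pi.single_eq_of_ne this]
        · by_cases hI : I = p.2 - Finsupp.single ν 1
          · have : I + Finsupp.single ν 1 = p.2 := by
              rw [hI, tsub_add_cancel_of_le (single_le hp)]
            rw [this]; simp [hp, eP, hI]
          · have : I + Finsupp.single ν 1 ≠ p.2 := fun h => hI (by rw [← h]; simp)
            simp [hp, eP, Pi.single_eq_of_ne this, Pi.single_eq_of_ne hI]
      · by_cases hp : p.2 ν = 0 <;> simp [hp, eP, Pi.single_eq_of_ne ha]
  obtain ⟨L, hL⟩ := hf.exists_linear hU hj
  rw [e4, e5, sub_zero, sub_eq_iff_eq_add, hL, map_sum] at hb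
  rw [hb]
  have e6 : ∀ ν, L (X j.1 ν • (if p.2 ν = 0 then 0 else eP (p.1, p.2 - Finsupp.single ν 1))) =
      X j.1 ν • (if p.2 ν = 0 then 0 else gDeriv f j (eP (p.1, p.2 - Finsupp.single ν 1))) := by
    intro ν
    rw [map_smul]
    split_ifs
    · rw [map_zero]
    · rw [hL]
  simp only [e6]
  abel

theorem finsum_shift_reindex (f : Jet n s → VAlg n s) (j : Jet n s) (ν : Fin n) :
    ∑ᶠ p : Fin s.m × MIdx n, (gen (Sum.inr (Sum.inl p.1, p.2)) : VAlg n s) *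
      (if p.2 ν = 0 then 0 else gDeriv f j (eP (p.1, p.2 - Finsupp.single ν 1))) =
    ∑ᶠ p : Fin s.m × MIdx n, (gen (Sum.inr (Sum.inl p.1, p.2 + Finsupp.single ν 1)) : VAlg n s) *
      gDeriv f j (eP p) := by
  have hinj : Function.Injective fun p : Fin s.m × MIdx n => (p.1, p.2 + Finsupp.single ν 1) := by
    rintro ⟨a, I⟩ ⟨b, J⟩ h
    simpa using h
  have h := finsum_mem_range (f := fun p : Fin s.m × MIdx n =>
    (gen (Sum.inr (Sum.inl p.1, p.2)) : VAlg n s) *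
      (if p.2 ν = 0 then 0 else gDeriv f j (eP (p.1, p.2 - Finsupp.single ν 1)))) hinj
  rw [← finsum_mem_univ]
  refine Eq.trans (finsum_mem_inter_support_eq _ _ _ ?_) (h.trans (finsum_congr fun p => by simp))
  ext p
  refine and_congr_left fun hp => ⟨fun _ => ?_, fun _ => trivial⟩
  by_cases h0 : p.2 ν = 0
  · exact absurd (by simp [h0]) hp
  · exact ⟨(p.1, p.2 - Finsupp.single ν 1), Prod.ext rfl (tsub_add_cancel_of_le (single_le h0))⟩

/-- Commutation of `d_v` with total derivatives: the commutator terms `δu_I ∂/∂u_{I-ν}` become,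
after reindexing, the terms in which `D_ν` acts on the factor `δu_I`. For the generators of nonzero
degree this is `vertAlg_shiftDer`. -/
theorem vertD_totalDeriv (hU : IsOpen U) {X : Base n → Base n}
    (hX : JSmooth U fun j : Jet n s => X j.1) {f : Jet n s → VAlg n s} (hf : IsLocalOn (cyl U) f)
    {j : Jet n s} (hj : j ∈ cyl U) :
    vertD (fun j => totalDeriv (X j.1) f j) j = totalDeriv (X j.1) (vertD f) j := by
  obtain ⟨S, hS⟩ := exists_finset_gDeriv hU hf
  have hsupp : ∀ Z : Fin s.m × MIdx n → VAlg n s,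
      (Function.support fun p => Z p * gDeriv f j (eP p)) ⊆ (S : Set (Fin s.m × MIdx n)) := by
    intro Z p hp
    by_contra h
    exact hp (by beta_reduce; rw [hS p h j hj, mul_zero])
  have hfin3 : ∀ (ν : Fin n) (r : ℝ), (Function.support fun p : Fin s.m × MIdx n =>
      r • ((gen (Sum.inr (Sum.inl p.1, p.2)) : VAlg n s) * if p.2 ν = 0 then 0 else
        gDeriv f j (eP (p.1, p.2 - Finsupp.single ν 1)))).Finite := by
    intro ν r
    refine (S.finite_toSet.image fun p => (p.1, p.2 + Finsupp.single ν 1)).subset fun p hp => ?_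
    by_contra h
    refine hp ?_
    beta_reduce
    split_ifs with h0
    · rw [mul_zero, smul_zero]
    · rw [hS _ (fun hm => h ⟨(p.1, p.2 - Finsupp.single ν 1), hm,
        Prod.ext rfl (tsub_add_cancel_of_le (single_le h0))⟩) j hj,
        mul_zero, smul_zero]
  have e1 : ∀ p ∉ S, totalDeriv (X j.1) (fun j => gDeriv f j (eP p)) j = 0 := fun p hp => by
    rw [totalDeriv_congr hU _ (isLocalOn_const 0) (hS p hp) hj, totalDeriv_const]; simp
  have hv : ∀ j ∈ cyl U, vertD f j =
      (∑ p ∈ S, gen (Sum.inr (Sum.inl p.1, p.2)) * gDeriv f j (eP p)) + vertAlg (f j) := by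
    intro j hj
    rw [vertD_apply, finsum_eq_sum_of_support_subset]
    intro p hp
    by_contra h
    exact hp (by beta_reduce; rw [hS p h j hj, mul_zero])
  have l1 : ∀ p, IsLocalOn (cyl U) fun j => gen (Sum.inr (Sum.inl p.1, p.2)) * gDeriv f j (eP p) :=
    fun p => (isLocalOn_const _).mul (isLocalOn_gDeriv_const hU hf (eP p))
  rw [totalDeriv_congr hU _ ((IsLocalOn.sum S fun p _ => l1 p).add (hf.map vertAlg)) hv hj,
    totalDeriv_add hU _ (IsLocalOn.sum S fun p _ => l1 p) (hf.map vertAlg) hj,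
    totalDeriv_sum hU _ _ (fun p _ => l1 p) hj, totalDeriv_map hU _ _ hf hj, vertD_apply]
  have e2 : ∑ ν, X j.1 ν • (shiftDer ν (vertAlg (f j)) - vertAlg (shiftDer ν (f j))) = 0 :=
    Finset.sum_eq_zero fun ν _ => by rw [vertAlg_shiftDer, sub_self, smul_zero]
  rw [e2, add_zero]
  congr 1
  have e3 : ∀ p, totalDeriv (X j.1) (fun j => gen (Sum.inr (Sum.inl p.1, p.2)) *
      gDeriv f j (eP p)) j =
      (∑ ν, X j.1 ν • (gen (Sum.inr (Sum.inl p.1, p.2 + Finsupp.single ν 1)) * gDeriv f j (eP p))) +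
      gen (Sum.inr (Sum.inl p.1, p.2)) * totalDeriv (X j.1) (fun j => gDeriv f j (eP p)) j := by
    intro p
    rw [totalDeriv_mul hU _ (isLocalOn_const _) (isLocalOn_gDeriv_const hU hf _) hj,
      totalDeriv_const, Finset.sum_mul]
    simp only [shiftDer_gen, smul_mul_assoc]
    rfl
  simp only [e3, gDeriv_totalDeriv hU hX hf _ hj, mul_add, Finset.mul_sum, mul_smul_comm]
  rw [Finset.sum_add_distrib, Finset.sum_comm, finsum_add_distrib, finsum_sum_comm, add_comm]
  · congr 1
    · refine Finset.sum_congr rfl fun ν _ => ?_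
      rw [← Finset.smul_sum, ← smul_finsum, finsum_shift_reindex]
      congr 1
      exact finsum_eq_sum_of_support_subset _ (hsupp _)
    · refine finsum_eq_sum_of_support_subset _ fun p hp => ?_
      by_contra h
      exact hp (by beta_reduce; rw [e1 p h, mul_zero])
  · exact fun ν _ => hfin3 ν _
  · refine S.finite_toSet.subset fun p hp => ?_
    by_contra h
    exact hp (by beta_reduce; rw [e1 p h, mul_zero])
  · refine (Set.finite_iUnion fun ν => hfin3 ν (X j.1 ν)).subset fun p hp => ?_
    by_contra h
    rw [Set.mem_iUnion, not_exists] at h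
    exact hp (Finset.sum_eq_zero fun ν _ => Function.notMem_support.1 (h ν))

end

end VerticalDifferential

/-! ### Families of linear maps and changes of jet coordinates -/

section Families

variable {n : ℕ} {s : FibreType} {U V : Set (ModelProd (Base n) (Base s.m))}
  {Θ : Jet n s → Jet n s} {φ : Jet n s → VAlg n s →ₗ[ℝ] VAlg n s}

theorem isLocalOn_family (hΘ : JField U Θ) (hm : ∀ j ∈ cyl U, Θ j ∈ cyl V)
    (hloc : ∀ b, IsLocalOn (cyl U) fun j => φ j b) {f : Jet n s → VAlg n s}
    (hf : IsLocalOn (cyl V) f) : IsLocalOn (cyl U) fun j => φ j (f (Θ j)) := by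
  obtain ⟨N, u, b, hu, hf⟩ := hf.exists_sum
  refine (IsLocalOn.sum Finset.univ fun (i : Fin N) _ =>
    ((hu i).pullback hΘ hm).smul_isLocalOn (hloc (b i))).congr fun j hj => ?_
  rw [hf _ (hm j hj), map_sum]
  simp only [map_smul]

/-- A criterion for families of linear maps to intertwine total derivatives: the base map must
preserve Cartan lifts, and the claim must hold on constants. It serves both for changes of
coordinates and for multiplication operators. -/
theorem totalDeriv_family (hU : IsOpen U) (hV : IsOpen V) (hΘ : JField U Θ)
    (hm : ∀ j ∈ cyl U, Θ j ∈ cyl V) (hloc : ∀ b, IsLocalOn (cyl U) fun j => φ j b)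
    {f : Jet n s → VAlg n s} (hf : IsLocalOn (cyl V) f) {j : Jet n s} (hj : j ∈ cyl U)
    {v w : Base n} (hfd : fieldDeriv Θ j (cartanLift v j) = cartanLift w (Θ j))
    (hb : ∀ b, totalDeriv v (fun j => φ j b) j = φ j (∑ ν, w ν • shiftDer ν b)) :
    totalDeriv v (fun j => φ j (f (Θ j))) j = φ j (totalDeriv w f (Θ j)) := by
  obtain ⟨N, u, b, hu, hf'⟩ := hf.exists_sum
  have l : ∀ i ∈ (Finset.univ : Finset (Fin N)), IsLocalOn (cyl U) fun j => u i (Θ j) • φ j (b i) :=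
    fun i _ => ((hu i).pullback hΘ hm).smul_isLocalOn (hloc (b i))
  rw [totalDeriv_congr hU v (IsLocalOn.sum _ l) (fun j hj => by
    rw [hf' _ (hm j hj), map_sum]; simp only [map_smul]) hj, totalDeriv_sum hU v _ l hj,
    totalDeriv_apply, gDeriv_of_sum hV hu hf' (hm j hj), hf' _ (hm j hj)]
  have e : ∀ i, totalDeriv v (fun j => u i (Θ j) • φ j (b i)) j =
      lineDeriv ℝ (u i) (Θ j) (cartanLift w (Θ j)) • φ j (b i) +
        u i (Θ j) • φ j (∑ ν, w ν • shiftDer ν (b i)) := fun i => by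
    rw [totalDeriv_smul hU v ((hu i).pullback hΘ hm) (hloc _) hj, hb,
      (hu i).lineDeriv_pullback hU hV hΘ hm hj, hfd]
  simp only [e, map_add, map_sum, map_smul, Finset.sum_add_distrib, Finset.smul_sum]
  congr 1
  rw [Finset.sum_comm]
  exact Finset.sum_congr rfl fun ν _ => Finset.sum_congr rfl fun i _ => smul_comm _ _ _

theorem jfield_id : JField U fun j : Jet n s => j :=
  ⟨jsmooth_fst, fun a I => jsmooth_coord a I⟩

theorem fieldDeriv_id (hU : IsOpen U) {j : Jet n s} (hj : j ∈ cyl U) (w : Jet n s) :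
    fieldDeriv (fun j => j) j w = w := by
  refine Prod.ext ?_ (funext fun a => funext fun I => lineDeriv_coord a I j w)
  have := lineDeriv_base hU (h := id) isOpen_univ contDiffOn_id hj trivial w
  rw [fderiv_id] at this
  exact this

/-- Sending all generators to zero is an algebra map onto `ℝ`. Injectivity of the scalars follows
and allows real jet coordinates to be compared inside the algebra. -/
instance instNontrivialVAlg : Nontrivial (VAlg n s) := by
  let A := MvPolynomial {g : Gen n s // g.IsEven} ℝ
  let B := ExteriorAlgebra ℝ ({g : Gen n s // ¬ g.IsEven} →₀ ℝ)
  let ε : VAlg n s →ₐ[ℝ] ℝ := Algebra.TensorProduct.lift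
    (MvPolynomial.aeval fun _ => (0 : ℝ)) ExteriorAlgebra.algebraMapInv fun _ _ => mul_comm _ _
  exact ε.toRingHom.domain_nontrivial

theorem algebraMap_VAlg_injective : Function.Injective (algebraMap ℝ (VAlg n s)) :=
  FaithfulSMul.algebraMap_injective ℝ (VAlg n s)

theorem JSmooth.isLocalOn_algebraMap {f : Jet n s → ℝ} (hf : JSmooth U f) :
    IsLocalOn (cyl U) fun j => algebraMap ℝ (VAlg n s) (f j) := by
  simp only [Algebra.algebraMap_eq_smul_one]
  exact hf.smul_isLocalOn_const 1

theorem totalDeriv_algebraMap (hU : IsOpen U) (v : Base n) {f : Jet n s → ℝ} (hf : JSmooth U f)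
    {j : Jet n s} (hj : j ∈ cyl U) :
    totalDeriv v (fun j => algebraMap ℝ (VAlg n s) (f j)) j =
      algebraMap ℝ (VAlg n s) (totalDeriv₀ v f j) := by
  simp only [Algebra.algebraMap_eq_smul_one]
  rw [totalDeriv_smul hU v hf (isLocalOn_const 1) hj, totalDeriv_const]
  simp [shiftDer_one, totalDeriv₀]

end Families

/-! ### Prolonged changes of coordinates and naturality of total derivatives. -/

section JetChange

variable {n : ℕ} {s : FibreType} {M : Type*} [TopologicalSpace M] [ChartedSpace (Base n) M]
  {Y : GradedBundle n s M} (c c' : AdaptedChart Y)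

/-- The total derivative with respect to the coordinate `x'^μ` of `c'`. -/
def chartD (μ : Fin n) (f : Jet n s → VAlg n s) : Jet n s → VAlg n s :=
  fun j => totalDeriv (c.partial' c' μ j.1) f j

/-- The jet coordinates of `c'` in the coordinates of `c`. -/
def jc (a : s.Field) (I : MIdx n) : Jet n s → VAlg n s := iterMulti (chartD c c') I (c.coord c' a)

variable {c c'}

theorem isLocalOn_chartD (μ : Fin n) {f : Jet n s → VAlg n s} (hf : IsLocalOn (cyl (ovl c c')) f) :
    IsLocalOn (cyl (ovl c c')) (chartD c c' μ f) :=
  isLocalOn_totalDeriv (isOpen_ovl c c') (jsmooth_partial' μ) hf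

theorem chartD_congr {U : Set (ModelProd (Base n) (Base s.m))} (hU : IsOpen U) (μ : Fin n)
    {f g : Jet n s → VAlg n s} (hg : IsLocalOn (cyl U) g) (h : ∀ j ∈ cyl U, f j = g j) :
    ∀ j ∈ cyl U, chartD c c' μ f j = chartD c c' μ g j :=
  fun _ hj => totalDeriv_congr hU _ hg h hj

theorem chartD_comm (μ ν : Fin n) {f : Jet n s → VAlg n s} (hf : IsLocalOn (cyl (ovl c c')) f) :
    ∀ j ∈ cyl (ovl c c'), chartD c c' μ (chartD c c' ν f) j = chartD c c' ν (chartD c c' μ f) j := by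
  intro j hj
  refine totalDeriv_comm_fields (isOpen_ovl c c') (jsmooth_partial' μ) (jsmooth_partial' ν) hf hj ?_
  rw [lineDeriv_base (isOpen_ovl c c') (isOpen_baseOvl c c') (contDiffOn_partial' ν) hj
    (fst_mem_baseOvl hj), lineDeriv_base (isOpen_ovl c c') (isOpen_baseOvl c c')
    (contDiffOn_partial' μ) hj (fst_mem_baseOvl hj)]
  exact fderiv_partial'_comm (fst_mem_baseOvl hj) ν μ

theorem iterMulti_chartD_add_single (I : MIdx n) (ν : Fin n) {f : Jet n s → VAlg n s}
    (hf : IsLocalOn (cyl (ovl c c')) f) : ∀ j ∈ cyl (ovl c c'),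
    iterMulti (chartD c c') (I + Finsupp.single ν 1) f j =
      chartD c c' ν (iterMulti (chartD c c') I f) j :=
  iterMulti_add_single (D := chartD c c')
    (P := fun f : Jet n s → VAlg n s => IsLocalOn (cyl (ovl c c')) f)
    (R := fun f g => ∀ j ∈ cyl (ovl c c'), f j = g j)
    (fun μ _ h => isLocalOn_chartD μ h) (fun _ _ _ => rfl)
    (fun _ _ _ h h' j hj => (h j hj).trans (h' j hj)) (fun μ _ _ _ hg h => chartD_congr (isOpen_ovl c c') μ hg h)
    (fun μ ν _ h => chartD_comm μ ν h) I ν hf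

theorem isLocalOn_iterMulti_chartD (I : MIdx n) {f : Jet n s → VAlg n s}
    (hf : IsLocalOn (cyl (ovl c c')) f) :
    IsLocalOn (cyl (ovl c c')) (iterMulti (chartD c c') I f) :=
  iterMulti_mem (Q := fun f : Jet n s → VAlg n s => IsLocalOn (cyl (ovl c c')) f)
    (fun μ _ h => isLocalOn_chartD μ h) I hf

theorem totalDeriv_eq_sum_chartD {f : Jet n s → VAlg n s} (hf : IsLocalOn (cyl (ovl c c')) f)
    {j : Jet n s} (hj : j ∈ cyl (ovl c c')) (v : Base n) :
    totalDeriv v f j = ∑ μ, (fderiv ℝ (c.baseChange c') j.1 v) μ • chartD c c' μ f j := by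
  obtain ⟨L, hL⟩ := exists_totalDeriv_linear (isOpen_ovl c c') hf hj
  simp only [chartD, hL]
  conv_lhs => rw [eq_sum_partial' (fst_mem_baseOvl hj) v, map_sum]
  simp only [map_smul]

theorem isLocalOn_coord (a : s.Field) : IsLocalOn (cyl (ovl c c')) (c.coord c' a) := by
  rcases a with a | a
  · exact (jsmooth_coord₀ a).isLocalOn_algebraMap
  · exact isLocalOn_coord₁ a

theorem isLocalOn_jc (a : s.Field) (I : MIdx n) : IsLocalOn (cyl (ovl c c')) (jc c c' a I) :=
  isLocalOn_iterMulti_chartD I (isLocalOn_coord a)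

/-- The real and the algebra-valued recursions for the jet coordinates run in parallel, so that
coordinates of zero and nonzero degree can be treated uniformly through `jc`. -/
theorem jetCoord₀_spec (a : Fin s.m) (I : MIdx n) : JSmooth (ovl c c') (c.jetCoord₀ c' a I) ∧
    ∀ j ∈ cyl (ovl c c'), jc c c' (Sum.inl a) I j = algebraMap ℝ _ (c.jetCoord₀ c' a I j) := by
  refine iterMulti_rel (Q := fun (f : Jet n s → ℝ) (f' : Jet n s → VAlg n s) =>
    JSmooth (ovl c c') f ∧ ∀ j ∈ cyl (ovl c c'), f' j = algebraMap ℝ _ (f j)) ?_ I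
    ⟨jsmooth_coord₀ a, fun _ _ => rfl⟩
  rintro μ f f' ⟨hf, hf'⟩
  refine ⟨hf.lineDeriv_field (isOpen_ovl c c') (jfield_cartanLift (jsmooth_partial' μ)),
    fun j hj => ?_⟩
  rw [chartD, totalDeriv_congr (isOpen_ovl c c') _ hf.isLocalOn_algebraMap hf' hj,
    totalDeriv_algebraMap (isOpen_ovl c c') _ hf hj]

theorem genChange_inr (a : s.Field) (I : MIdx n) {j : Jet n s} (hj : j ∈ cyl (ovl c c')) :
    c.genChange c' (Sum.inr (a, I)) j = vertD (jc c c' a I) j := by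
  rcases a with a | a
  · exact (vertD_congr (isOpen_ovl c c') (jetCoord₀_spec a I).1.isLocalOn_algebraMap
      (jetCoord₀_spec a I).2 hj).symm
  · rfl

theorem isLocalOn_genChange (g : Gen n s) : IsLocalOn (cyl (ovl c c')) (c.genChange c' g) := by
  rcases g with ⟨a, I⟩ | ⟨a, I⟩
  · exact isLocalOn_jc (Sum.inr a) I
  · exact (isLocalOn_vertD (isOpen_ovl c c') (isLocalOn_jc a I)).congr fun j hj =>
      genChange_inr a I hj

/-- In its own coordinates `c'` has `D'_μ u'_I = u'_{I+μ}` by construction; for the `δu'_I` it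
follows since `d_v` commutes with `D'_μ`. -/
theorem chartD_genChange (μ : Fin n) (g : Gen n s) : ∀ j ∈ cyl (ovl c c'),
    chartD c c' μ (c.genChange c' g) j = c.genChange c' (g.shift μ) j := by
  intro j hj
  rcases g with ⟨a, I⟩ | ⟨a, I⟩
  · exact (iterMulti_chartD_add_single I μ (isLocalOn_coord (Sum.inr a)) j hj).symm
  · have h1 := isLocalOn_jc (c := c) (c' := c') a I
    rw [chartD_congr (isOpen_ovl c c') μ (isLocalOn_vertD (isOpen_ovl c c') h1)
      (fun j hj => genChange_inr a I hj) j hj]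
    change _ = c.genChange c' (Sum.inr (a, I + Finsupp.single μ 1)) j
    rw [genChange_inr a _ hj]
    refine (vertD_totalDeriv (isOpen_ovl c c') (jsmooth_partial' μ) h1 hj).symm.trans ?_
    exact (vertD_congr (isOpen_ovl c c') (isLocalOn_chartD μ h1)
      (iterMulti_chartD_add_single I μ (isLocalOn_coord a)) hj).symm

theorem jetChange_pt {j : Jet n s} (hj : j ∈ cyl (ovl c c')) :
    (c.jetChange c' j).pt = c'.ψ (c.toY₀ j) := by
  have h1 : (c'.ψ (c.toY₀ j)).1 = c.baseChange c' j.1 := by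
    rw [(c'.fibred (c.toY₀ j) hj.2).2, AdaptedChart.baseChange, symm_fst hj.1]
  refine Prod.ext h1.symm ?_
  ext a
  change c.jetCoord₀ c' a 0 j = _
  rw [AdaptedChart.jetCoord₀, iterMulti_zero]
  rfl

theorem jetChange_mem : ∀ j ∈ cyl (ovl c c'), c.jetChange c' j ∈ cyl c'.ψ.target := by
  intro j hj
  change (c.jetChange c' j).pt ∈ c'.ψ.target
  rw [jetChange_pt hj]
  exact c'.ψ.map_source hj.2

theorem jfield_jetChange : JField (ovl c c') (c.jetChange c') :=
  ⟨jsmooth_base (contDiffOn_baseChange c c') fun _ hj => fst_mem_baseOvl hj,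
    fun a I => (jetCoord₀_spec a I).1⟩

/-- Prolonged maps preserve the Cartan distribution: writing `D_v` in terms of the `D'_μ` turns the
derivative of `u'_I` into a combination of the `u'_{I+μ}`. -/
theorem fieldDeriv_jetChange {j : Jet n s} (hj : j ∈ cyl (ovl c c')) (v : Base n) :
    fieldDeriv (c.jetChange c') j (cartanLift v j) =
      cartanLift (fderiv ℝ (c.baseChange c') j.1 v) (c.jetChange c' j) := by
  have hU := isOpen_ovl c c'
  refine Prod.ext ?_ ?_
  · exact lineDeriv_base hU (isOpen_baseOvl c c') (contDiffOn_baseChange c c') hj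
      (fst_mem_baseOvl hj) _
  · funext a I
    refine algebraMap_VAlg_injective (n := n) (s := s) ?_
    refine (totalDeriv_algebraMap hU v (jetCoord₀_spec a I).1 hj).symm.trans ?_
    rw [← totalDeriv_congr hU v (jetCoord₀_spec a I).1.isLocalOn_algebraMap
      (jetCoord₀_spec a I).2 hj, totalDeriv_eq_sum_chartD (isLocalOn_jc _ _) hj]
    simp only [cartanLift, map_sum, map_mul, Algebra.smul_def]
    refine Finset.sum_congr rfl fun ν _ => ?_
    congr 1
    rw [jc, ← iterMulti_chartD_add_single I ν (isLocalOn_coord _) j hj]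
    exact (jetCoord₀_spec a _).2 j hj

theorem _root_.AdaptedChart.IsSubst.unique {j : Jet n s} {T T' : VAlg n s →ₐ[ℝ] VAlg n s}
    (hT : c.IsSubst c' j T) (hT' : c.IsSubst c' j T') : T = T' := by
  refine AlgHom.ext fun x => ?_
  induction x using VAlg_induction with
  | zero => simp
  | add x y hx hy => rw [map_add, map_add, hx, hy]
  | smul r x hx => rw [map_smul, map_smul, hx]
  | one => simp
  | gen_mul g x hx => rw [map_mul, map_mul, hx, hT g, hT' g]

variable {T : Jet n s → VAlg n s →ₐ[ℝ] VAlg n s}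

/-- Both assertions are stable under products, so they reduce to generators, where the second is
`chartD_genChange` combined over the components of `v`. -/
theorem subst_const (hT : ∀ j ∈ cyl (ovl c c'), c.IsSubst c' j (T j)) (b : VAlg n s) :
    IsLocalOn (cyl (ovl c c')) (fun j => T j b) ∧ ∀ j ∈ cyl (ovl c c'), ∀ v : Base n,
      totalDeriv v (fun j => T j b) j =
        T j (∑ ν, (fderiv ℝ (c.baseChange c') j.1 v) ν • shiftDer ν b) := by
  have hU := isOpen_ovl c c'
  induction b using VAlg_induction with
  | zero =>
    refine ⟨(isLocalOn_const 0).congr fun j _ => map_zero _, fun j hj v => ?_⟩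
    rw [totalDeriv_congr hU v (isLocalOn_const 0) (fun j _ => map_zero _) hj, totalDeriv_const]
    simp
  | add x y hx hy =>
    refine ⟨(hx.1.add hy.1).congr fun j _ => map_add _ _ _, fun j hj v => ?_⟩
    rw [totalDeriv_congr hU v (hx.1.add hy.1) (fun j _ => map_add _ _ _) hj,
      totalDeriv_add hU v hx.1 hy.1 hj, hx.2 j hj, hy.2 j hj]
    simp only [map_add, smul_add, Finset.sum_add_distrib]
  | smul r x hx =>
    refine ⟨(hx.1.const_smul r).congr fun j _ => map_smul _ _ _, fun j hj v => ?_⟩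
    rw [totalDeriv_congr hU v (hx.1.const_smul r) (fun j _ => map_smul _ _ _) hj,
      totalDeriv_const_smul hU v r hx.1 hj, hx.2 j hj, ← map_smul, Finset.smul_sum]
    simp only [map_smul, smul_comm r]
  | one =>
    refine ⟨(isLocalOn_const 1).congr fun j _ => map_one _, fun j hj v => ?_⟩
    rw [totalDeriv_congr hU v (isLocalOn_const 1) (fun j _ => map_one _) hj, totalDeriv_const]
    simp [shiftDer_one]
  | gen_mul g x hx =>
    have e : ∀ j ∈ cyl (ovl c c'), T j (gen g * x) = c.genChange c' g j * T j x := fun j hj => by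
      rw [map_mul, hT j hj g]
    have l := (isLocalOn_genChange (c := c) (c' := c') g).mul hx.1
    refine ⟨l.congr e, fun j hj v => ?_⟩
    rw [totalDeriv_congr hU v l e hj, totalDeriv_mul hU v (isLocalOn_genChange g) hx.1 hj,
      hx.2 j hj, totalDeriv_eq_sum_chartD (isLocalOn_genChange g) hj]
    simp only [chartD_genChange _ g j hj, isDer_shiftDer _ (gen g), shiftDer_gen, smul_add,
      Finset.sum_add_distrib, map_add, map_sum, map_smul, map_mul, hT j hj _, Finset.sum_mul,
      Finset.mul_sum, smul_mul_assoc, mul_smul_comm]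

variable {U V : Set (ModelProd (Base n) (Base s.m))}

theorem isLocalOn_subst (hT : ∀ j ∈ cyl (ovl c c'), c.IsSubst c' j (T j)) (hUo : U ⊆ ovl c c')
    (hm : ∀ j ∈ cyl U, c.jetChange c' j ∈ cyl V) {f : Jet n s → VAlg n s}
    (hf : IsLocalOn (cyl V) f) : IsLocalOn (cyl U) fun j => T j (f (c.jetChange c' j)) :=
  isLocalOn_family (φ := fun j => (T j).toLinearMap) (jfield_jetChange.mono hUo) hm
    (fun b => (subst_const hT b).1.mono hUo) hf

/-- Naturality of the total derivative. -/
theorem totalDeriv_subst (hT : ∀ j ∈ cyl (ovl c c'), c.IsSubst c' j (T j)) (hU : IsOpen U)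
    (hV : IsOpen V) (hUo : U ⊆ ovl c c') (hm : ∀ j ∈ cyl U, c.jetChange c' j ∈ cyl V)
    {f : Jet n s → VAlg n s} (hf : IsLocalOn (cyl V) f) {j : Jet n s} (hj : j ∈ cyl U)
    (v : Base n) :
    totalDeriv v (fun j => T j (f (c.jetChange c' j))) j =
      T j (totalDeriv (fderiv ℝ (c.baseChange c') j.1 v) f (c.jetChange c' j)) :=
  totalDeriv_family (φ := fun j => (T j).toLinearMap) hU hV (jfield_jetChange.mono hUo) hm
    (fun b => (subst_const hT b).1.mono hUo) hf hj (fieldDeriv_jetChange (hUo hj) v)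
    fun b => (subst_const hT b).2 j (hUo hj) v

theorem totalDerivMulti_subst (hT : ∀ j ∈ cyl (ovl c c'), c.IsSubst c' j (T j)) (hU : IsOpen U)
    (hV : IsOpen V) (hUo : U ⊆ ovl c c') (hm : ∀ j ∈ cyl U, c.jetChange c' j ∈ cyl V) (I : MIdx n)
    {f f' : Jet n s → VAlg n s} (hf : IsLocalOn (cyl V) f)
    (hff' : ∀ j ∈ cyl U, f' j = T j (f (c.jetChange c' j))) :
    ∀ j ∈ cyl U, iterMulti (chartD c c') I f' j =
      T j (totalDerivMulti I f (c.jetChange c' j)) := by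
  refine (iterMulti_rel (Q := fun (f f' : Jet n s → VAlg n s) => IsLocalOn (cyl V) f ∧
    ∀ j ∈ cyl U, f' j = T j (f (c.jetChange c' j))) ?_ I ⟨hf, hff'⟩).2
  rintro μ f f' ⟨hf, hf'⟩
  refine ⟨isLocalOn_totalDeriv_const hV _ hf, fun j hj => ?_⟩
  rw [chartD_congr hU μ (isLocalOn_subst hT hUo hm hf) hf' j hj, chartD,
    totalDeriv_subst hT hU hV hUo hm hf hj, fderiv_baseChange_partial' (fst_mem_baseOvl (hUo hj))]

end JetChange

/-! ### Multiplication of the vertical generators by functions on the base -/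

section Lowering

variable {n : ℕ} {s : FibreType}

/-- A version of the transfer principle in which the invariant may depend on the multi-index
accumulated so far. -/
theorem iterMulti_induction {F F' : Type*} {D : Fin n → F → F} {D' : Fin n → F' → F'}
    {Q : MIdx n → F → F' → Prop}
    (h : ∀ μ I f f', Q I f f' → Q (I + Finsupp.single μ 1) (D μ f) (D' μ f')) (I : MIdx n)
    {f : F} {f' : F'} (hf : Q 0 f f') : Q I (iterMulti D I f) (iterMulti D' I f') := by
  have hit : ∀ μ k J f f', Q J f f' → Q (J + Finsupp.single μ k) ((D μ)^[k] f) ((D' μ)^[k] f') := by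
    intro μ k
    induction k with
    | zero => intro J f f' hf; simpa using hf
    | succ k ih =>
      intro J f f' hf
      have := ih _ _ _ (h μ J f f' hf)
      rwa [add_assoc, ← Finsupp.single_add, add_comm 1 k] at this
  have key : ∀ l : List (Fin n), Q ((l.map fun μ => Finsupp.single μ (I μ)).sum)
      (l.foldr (fun μ h => (D μ)^[I μ] h) f) (l.foldr (fun μ h => (D' μ)^[I μ] h) f') := by
    intro l
    induction l with
    | nil => exact hf
    | cons μ l ih =>
      rw [List.map_cons, List.sum_cons, add_comm]
      exact hit _ _ _ _ _ ih
  have e : ((List.finRange n).map fun μ => Finsupp.single μ (I μ)).sum = I := by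
    rw [← Fin.sum_univ_def, Finsupp.univ_sum_single]
  have := key (List.finRange n)
  rwa [e] at this

/-- `f ↦ ∂_ν f` on the coefficients of `∑_J h_J u_J`. -/
def cfStep (ν : Fin n) (h : MIdx n → Base n → ℝ) (J : MIdx n) (x : Base n) : ℝ :=
  fderiv ℝ (h J) x (EuclideanSpace.single ν 1) +
    if J ν = 0 then 0 else h (J - Finsupp.single ν 1) x

open Classical in
/-- The coefficients of `u_J` in `D_I (f u)`. -/
def cf (f : Base n → ℝ) (I : MIdx n) : MIdx n → Base n → ℝ :=
  iterMulti cfStep I fun J => if J = 0 then f else 0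

theorem fderiv_eq_zero_of_eqOn {W : Set (Base n)} (hW : IsOpen W) {g : Base n → ℝ} {x : Base n}
    (hx : x ∈ W) (hg : ∀ y ∈ W, g y = 0) (v : Base n) : fderiv ℝ g x v = 0 := by
  have : g =ᶠ[nhds x] fun _ => 0 := by
    filter_upwards [hW.mem_nhds hx] with y hy using hg y hy
  rw [this.fderiv_eq]; simp

theorem contDiffOn_cfStep {W : Set (Base n)} (hW : IsOpen W) {h : MIdx n → Base n → ℝ}
    (hh : ∀ J, ContDiffOn ℝ ∞ (h J) W) (ν : Fin n) (J : MIdx n) :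
    ContDiffOn ℝ ∞ (cfStep ν h J) W := by
  refine ContDiffOn.add (((hh J).fderiv_of_isOpen hW (m := ∞) (by simp)).clm_apply
    contDiffOn_const) ?_
  by_cases h0 : J ν = 0
  · simpa [h0] using contDiffOn_const
  · simpa [h0] using hh _

theorem cfStep_eq_zero {W : Set (Base n)} (hW : IsOpen W) {h : MIdx n → Base n → ℝ} {I : MIdx n}
    (hh : ∀ J, ¬ J ≤ I → ∀ x ∈ W, h J x = 0) (ν : Fin n) (J : MIdx n)
    (hJ : ¬ J ≤ I + Finsupp.single ν 1) : ∀ x ∈ W, cfStep ν h J x = 0 := by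
  intro x hx
  have hJ' : ¬ J ≤ I := fun h => hJ (h.trans le_self_add)
  rw [cfStep, fderiv_eq_zero_of_eqOn hW hx (hh J hJ'), zero_add]
  split_ifs with h0
  · rfl
  · refine hh _ (fun h => hJ ?_) x hx
    have := add_le_add_left h (Finsupp.single ν 1)
    rwa [tsub_add_cancel_of_le (single_le h0)] at this

/-- The two leading terms of the Leibniz formula for `D_I (f u)`: `f u_I` and `I_μ (∂_μ f) u_{I-μ}`.
Deeper coefficients matter only through their smoothness. -/
theorem cf_spec {f : Base n → ℝ} {W : Set (Base n)} (hW : IsOpen W) (hf : ContDiffOn ℝ ∞ f W)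
    (I : MIdx n) : (∀ J, ContDiffOn ℝ ∞ (cf f I J) W) ∧
    (∀ J, ¬ J ≤ I → ∀ x ∈ W, cf f I J x = 0) ∧ (∀ x ∈ W, cf f I I x = f x) ∧
    ∀ J μ, J + Finsupp.single μ 1 = I → ∀ x ∈ W,
      cf f I J x = (I μ : ℝ) * fderiv ℝ f x (EuclideanSpace.single μ 1) := by
  classical
  refine iterMulti_induction (D' := fun (_ : Fin n) (u : Unit) => u) (f' := ())
    (Q := fun I (h : MIdx n → Base n → ℝ) _ =>
    (∀ J, ContDiffOn ℝ ∞ (h J) W) ∧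
    (∀ J, ¬ J ≤ I → ∀ x ∈ W, h J x = 0) ∧ (∀ x ∈ W, h I x = f x) ∧
    ∀ J μ, J + Finsupp.single μ 1 = I → ∀ x ∈ W,
      h J x = (I μ : ℝ) * fderiv ℝ f x (EuclideanSpace.single μ 1)) ?_ I ?_
  · rintro ν I h - ⟨h1, h2, h3, h4⟩
    have hnot : ¬ I + Finsupp.single ν 1 ≤ I := fun h => by
      have := h ν; simp at this
    refine ⟨contDiffOn_cfStep hW h1 ν, cfStep_eq_zero hW h2 ν, fun x hx => ?_,
      fun J μ hJ x hx => ?_⟩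
    · rw [cfStep, fderiv_eq_zero_of_eqOn hW hx (h2 _ hnot), zero_add, if_neg (by simp), add_tsub_cancel_right, h3 x hx]
    · by_cases hμ : μ = ν
      · subst hμ
        have hJI : J = I := add_right_cancel hJ
        subst hJI
        have e : (fderiv ℝ (h J) x : Base n →L[ℝ] ℝ) = fderiv ℝ f x := by
          refine Filter.EventuallyEq.fderiv_eq ?_
          filter_upwards [hW.mem_nhds hx] with y hy using h3 y hy
        rw [cfStep, e]
        split_ifs with h0
        · simp [h0]
        · rw [h4 _ μ (tsub_add_cancel_of_le (single_le h0)) x hx]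
          simp; ring
      · have e1 : J ν = I ν + 1 := by
          have := DFunLike.congr_fun hJ ν
          simpa [Finsupp.single_apply, hμ] using this
        have hJ' : ¬ J ≤ I := fun h => by have := h ν; omega
        rw [cfStep, fderiv_eq_zero_of_eqOn hW hx (h2 J hJ'), zero_add, if_neg (by omega)]
        rw [h4 _ μ _ x hx]
        · simp [Ne.symm hμ]
        · have h0 : J ν ≠ 0 := by omega
          rw [add_single_sub_single h0, hJ, add_tsub_cancel_right]
  · refine ⟨fun J => ?_, fun J hJ x _ => ?_, fun x _ => by simp, fun J μ hJ => ?_⟩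
    · by_cases h : J = 0
      · simpa [h] using hf
      · simp only [h, if_false]
        exact contDiffOn_const (c := (0 : ℝ))
    · have : J ≠ 0 := fun h => hJ h.le
      simp [this]
    · have := DFunLike.congr_fun hJ μ
      simp at this

/-- The derivation of the vertical algebra with `δu^a_I ↦ ∑_{J < I} ζ I J δu^a_J`. -/
def lowZ (ζ : MIdx n → MIdx n → ℝ) : Gen n s → VAlg n s :=
  Sum.elim (fun _ => 0) fun p => ∑ J ∈ Finset.Iio p.2, ζ p.2 J • gen (Sum.inr (p.1, J))

/-- The derivation `lowZ` as a linear operator. -/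
def lowOp (ζ : MIdx n → MIdx n → ℝ) : VAlg n s →ₗ[ℝ] VAlg n s := der (lowZ ζ)

theorem sameParity_lowZ (ζ : MIdx n → MIdx n → ℝ) (g : Gen n s) : SameParity g (lowZ ζ g) := by
  rcases g with p | p
  · exact SameParity.zero _
  · exact SameParity.sum _ fun J _ => (SameParity.gen Iff.rfl).smul _

theorem lowOp_mem_bideg (ζ : MIdx n → MIdx n → ℝ) {q : ℕ} {r : ℤ} {x : VAlg n s}
    (hx : x ∈ bideg n s q r) : lowOp ζ x ∈ bideg n s q r := by
  refine der_mem_bideg (isDer_der (sameParity_lowZ ζ)) (der_one _) (fun g => ?_) hx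
  rw [der_gen]
  rcases g with p | p
  · exact zero_mem _
  · exact sum_mem fun J _ => Submodule.smul_mem _ _ (gen_mem_bideg (Sum.inr (p.1, J)))

theorem pd_lowOp (ζ : MIdx n → MIdx n → ℝ) (a : s.Field) (J : MIdx n) {x : VAlg n s}
    (hx : x ∈ vdegPart n s 1) : pd (Sum.inr (a, J)) (lowOp ζ x) =
      ∑ᶠ I, (if J < I then ζ I J else 0) • pd (Sum.inr (a, I)) x := by
  classical
  have hfin : (Function.support fun p : s.Field × MIdx n =>
      lowZ ζ (Sum.inr p) * pd (Sum.inr p) x).Finite :=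
    ((mul_pd_support_finite (lowZ ζ) x).preimage Sum.inr_injective.injOn)
  rw [lowOp, der_eq_finsum_inr (fun p => rfl), map_finsum _ hfin]
  have e : ∀ p : s.Field × MIdx n, pd (Sum.inr (a, J)) (lowZ ζ (Sum.inr p) * pd (Sum.inr p) x) =
      if p.1 = a then (if J < p.2 then ζ p.2 J else 0) • pd (Sum.inr p) x else 0 := by
    intro p
    have h0 := pd_inr_mem_vdegPart (p := p) hx
    rw [lowZ, Sum.elim_inr, Finset.sum_mul, map_sum]
    have e2 : ∀ K ∈ Finset.Iio p.2, pd (Sum.inr (a, J))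
        (ζ p.2 K • gen (Sum.inr (p.1, K)) * pd (Sum.inr p) x) =
        if K = J then (if p.1 = a then ζ p.2 J • pd (Sum.inr p) x else 0) else 0 := by
      intro K _
      rw [smul_mul_assoc, map_smul, pd_gen_mul, pd_inr_eq_zero h0, mul_zero, smul_zero, add_zero]
      by_cases hK : K = J
      · subst hK
        by_cases ha : p.1 = a
        · simp [ha]
        · simp [ha, Ne.symm ha]
      · simp [hK, Ne.symm hK]
    rw [Finset.sum_congr rfl e2, Finset.sum_ite_eq']
    by_cases ha : p.1 = a <;> by_cases hJ : J < p.2 <;> simp [ha, hJ]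
  rw [finsum_congr e]
  have hinj : Function.Injective fun I : MIdx n => (a, I) := fun I J h => by simpa using h
  rw [← finsum_mem_univ, ← finsum_mem_range (f := fun p : s.Field × MIdx n => if p.1 = a then
    (if J < p.2 then ζ p.2 J else 0) • pd (Sum.inr p) x else 0) hinj |>.trans
      (finsum_congr fun I => if_pos rfl)]
  refine finsum_mem_inter_support_eq _ _ _ ?_
  ext p
  refine and_congr_left fun hp => ⟨fun _ => ?_, fun _ => trivial⟩
  by_cases ha : p.1 = a
  · exact ⟨p.2, Prod.ext ha.symm rfl⟩
  · exact absurd (by simp [ha]) hp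

variable {U : Set (ModelProd (Base n) (Base s.m))}

theorem isLocalOn_der {Z : Gen n s → Jet n s → VAlg n s} (hZ : ∀ g, IsLocalOn (cyl U) (Z g))
    (b : VAlg n s) : IsLocalOn (cyl U) fun j => der (fun g => Z g j) b := by
  have h := pd_support_finite b
  refine (IsLocalOn.sum h.toFinset fun g _ => (hZ g).mul (isLocalOn_const (pd g b))).congr
    fun j _ => ?_
  rw [der_apply]
  refine finsum_eq_sum_of_support_subset _ fun g hg => ?_
  simp only [Set.Finite.coe_toFinset, Set.mem_ofPred_eq]
  intro h0
  exact hg (by simp [h0])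

theorem _root_.Finsupp.exists_add_of_lt {I J : MIdx n} (h : J < I) :
    ∃ K, I = J + K ∧ 1 ≤ K.degree := by
  refine ⟨I - J, (add_tsub_cancel_of_le h.le).symm, Nat.one_le_iff_ne_zero.mpr fun h0 => h.ne ?_⟩
  rw [Finsupp.degree_eq_zero_iff] at h0
  exact h.le.antisymm (tsub_eq_zero_iff_le.mp h0)

theorem _root_.Finsupp.exists_single_of_degree_eq_one {K : MIdx n} (h : K.degree = 1) :
    ∃ ν, K = Finsupp.single ν 1 := by
  have h0 : K ≠ 0 := by rintro rfl; simp at h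
  obtain ⟨ν, hν⟩ := Finsupp.ne_iff.mp h0
  refine ⟨ν, ?_⟩
  have e := tsub_add_cancel_of_le (single_le (I := K) hν)
  have hd := congrArg Finsupp.degree e
  rw [map_add, Finsupp.degree_single, h, Nat.add_eq_right, Finsupp.degree_eq_zero_iff] at hd
  rw [← e, hd, zero_add]

/-- Only pairs `J < I` occur, so the order drops by at least one; `hlead` prescribes the
coefficients where it drops by exactly one. -/
theorem isLowering_lowOp {ζ : Fin n → MIdx n → MIdx n → Base n → ℝ} {W : Set (Base n)}
    (hUW : ∀ j ∈ cyl U, j.1 ∈ W) (hζ : ∀ μ I J, ContDiffOn ℝ ∞ (ζ μ I J) W)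
    (hlead : ∀ μ ν J, ∀ x ∈ W,
      ζ μ (J + Finsupp.single ν 1) J x = if ν = μ then (J μ : ℝ) + 1 else 0) :
    IsLowering U fun μ (j : Jet n s) => lowOp fun I J => ζ μ I J j.1 where
  isLocal μ f hf := by
    refine isLocalOn_family (Θ := fun j => j) (V := U) jfield_id (fun _ h => h) (fun b => ?_) hf
    refine isLocalOn_der (Z := fun g (j : Jet n s) => lowZ (fun I J => ζ μ I J j.1) g) (fun g => ?_) b
    rcases g with p | p
    · exact isLocalOn_const 0
    · exact IsLocalOn.sum _ fun J _ =>
        (jsmooth_base (hζ μ p.2 J) hUW).smul_isLocalOn (isLocalOn_const _)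
  mem_bideg μ j _ r x hx := lowOp_mem_bideg _ hx
  mem_ordLT μ j _ r x hx hr a J hJ := by
    rw [pd_lowOp _ _ _ hx]
    refine (finsum_congr fun I => ?_).trans finsum_zero
    split_ifs with h
    · obtain ⟨K, rfl, hK⟩ := Finsupp.exists_add_of_lt h
      rw [hr a (J + K) (by rw [map_add]; omega), smul_zero]
    · rw [zero_smul]
  pd_eq μ j hj a J x hx hr := by
    rw [pd_lowOp _ _ _ hx, finsum_eq_single _ (J + Finsupp.single μ 1)]
    · rw [if_pos (lt_add_of_pos_right _ (pos_iff_ne_zero.mpr (by simp))),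
        hlead _ _ _ _ (hUW j hj), if_pos rfl]
    · intro I hI
      split_ifs with h
      -- Indices at least two above `J` are excluded by the order of `x`; otherwise `I` is `J` plus
      -- a unit index, where `hlead` decides.
      · by_cases hd : J.degree + 2 ≤ I.degree
        · rw [hr a I hd, smul_zero]
        · obtain ⟨ν, rfl⟩ : ∃ ν, I = J + Finsupp.single ν 1 := by
            obtain ⟨K, rfl, hK⟩ := Finsupp.exists_add_of_lt h
            obtain ⟨ν, rfl⟩ := Finsupp.exists_single_of_degree_eq_one (K := K)
              (by rw [map_add] at hd; omega)
            exact ⟨ν, rfl⟩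
          rw [hlead _ _ _ _ (hUW j hj), if_neg (fun h => hI (by rw [h])), zero_smul]
      · rw [zero_smul]

end Lowering

/-! ### Naturality of the multiplication operators -/

section MulOp

variable {n : ℕ} {s : FibreType} {U V : Set (ModelProd (Base n) (Base s.m))} {W : Set (Base n)}
  {f : Base n → ℝ}

/-- The derivation of the vertical algebra with `δu^a_I ↦ D_I (f δu^a)`. -/
def mulZ (f : Base n → ℝ) (x : Base n) : Gen n s → VAlg n s :=
  Sum.elim (fun _ => 0) fun p => ∑ J ∈ Finset.Iic p.2, cf f p.2 J x • gen (Sum.inr (p.1, J))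

/-- The derivation `mulZ` as a linear operator. -/
def mulOp (f : Base n → ℝ) (x : Base n) : VAlg n s →ₗ[ℝ] VAlg n s := der (mulZ f x)

theorem isDer_mulOp (f : Base n → ℝ) (x : Base n) : IsDer (mulOp (s := s) f x) := by
  refine isDer_der fun g => ?_
  rcases g with p | p
  · exact SameParity.zero _
  · exact SameParity.sum _ fun J _ => (SameParity.gen Iff.rfl).smul _

theorem der_smul_add (r : ℝ) (Z Z' : Gen n s → VAlg n s) (y : VAlg n s) :
    der (fun g => r • Z g + Z' g) y = r • der Z y + der Z' y := by
  rw [der_apply, der_apply, der_apply, smul_finsum' r (mul_pd_support_finite Z y)]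
  refine Eq.trans ?_ (finsum_add_distrib ((mul_pd_support_finite Z y).subset
      (Function.support_const_smul_subset r _)) (mul_pd_support_finite Z' y))
  exact finsum_congr fun g => by rw [add_mul, smul_mul_assoc]

/-- The diagonal coefficients are all `f`, so they contribute `f` times the derivation counting
vertical one-forms, which is the identity in vertical degree one. -/
theorem mulOp_eq (hW : IsOpen W) (hf : ContDiffOn ℝ ∞ f W) {x : Base n} (hx : x ∈ W)
    {y : VAlg n s} (hy : y ∈ vdegPart n s 1) :
    mulOp f x y = f x • y + lowOp (fun I J => cf f I J x) y := by
  have e : mulZ (s := s) f x = fun g =>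
      f x • ((g.vdeg : ℝ) • gen g) + lowZ (fun I J => cf f I J x) g := by
    funext g
    rcases g with p | ⟨a, I⟩
    · simp [mulZ, lowZ, Gen.vdeg]
    · simp only [mulZ, lowZ, Sum.elim_inr, Gen.vdeg, Nat.cast_one, one_smul,
        ← Finset.Iio_insert]
      rw [Finset.sum_insert (by simp), (cf_spec hW hf I).2.2.1 x hx]
  rw [mulOp, e, der_smul_add]
  change f x • vertNum y + _ = _
  rw [vertNum_of_mem hy, Nat.cast_one, one_smul]
  rfl

theorem lowOp_undiff (ζ : MIdx n → MIdx n → ℝ) {y : VAlg n s} (hy : y ∈ undiff n s) :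
    lowOp ζ y = 0 := by
  rw [lowOp, der_eq_finsum_inr (fun _ => rfl)]
  refine (finsum_congr fun p => ?_).trans finsum_zero
  by_cases hp : p.2 = 0
  · have : Finset.Iio (0 : MIdx n) = ∅ := by
      ext J; simp
    simp [lowZ, hp, this]
  · obtain ⟨a, I⟩ := p
    rw [pd_undiff_eq_zero hp hy, mul_zero]

theorem mulOp_vdegPart_zero (x : Base n) {y : VAlg n s} (hy : y ∈ vdegPart n s 0) :
    mulOp f x y = 0 := by
  rw [mulOp, der_eq_finsum_inr (fun _ => rfl)]
  exact (finsum_congr fun p => by rw [pd_inr_eq_zero hy, mul_zero]).trans finsum_zero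

theorem sum_Iic_cfStep (hW : IsOpen W) {h : MIdx n → Base n → ℝ} {I : MIdx n}
    (hh : ∀ J, ¬ J ≤ I → ∀ x ∈ W, h J x = 0) (ν : Fin n) (u : MIdx n → VAlg n s) {x : Base n}
    (hx : x ∈ W) : ∑ J ∈ Finset.Iic (I + Finsupp.single ν 1 : MIdx n), cfStep ν h J x • u J =
      ∑ J ∈ Finset.Iic I, (fderiv ℝ (h J) x (EuclideanSpace.single ν 1) • u J +
        h J x • u (J + Finsupp.single ν 1)) := by
  simp only [cfStep, add_smul, Finset.sum_add_distrib]
  congr 1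
  · refine (Finset.sum_subset (Finset.Iic_subset_Iic.mpr le_self_add) fun J _ hJ => ?_).symm
    rw [fderiv_eq_zero_of_eqOn hW hx (hh J (by simpa using hJ)), zero_smul]
  · refine (Finset.sum_of_injOn (fun J => J + Finsupp.single ν 1) (fun _ _ _ _ h => add_right_cancel h)
      (fun J hJ => ?_) (fun J hJ hJ' => ?_) fun J _ => ?_).symm
    · simp only [Finset.coe_Iic, Set.mem_Iic] at hJ ⊢
      exact add_le_add_left hJ _
    · by_cases h0 : J ν = 0
      · simp [h0]
      · refine absurd ⟨J - Finsupp.single ν 1, ?_, tsub_add_cancel_of_le (single_le h0)⟩ hJ'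
        simp only [Finset.mem_Iic, Finset.coe_Iic, Set.mem_Iic] at hJ ⊢
        rwa [tsub_le_iff_right]
    · rw [if_neg (by simp), add_tsub_cancel_right]

/-- The recursion for `cf` mirrors the Leibniz rule for the total derivative; this identifies `mulZ`
with its description as `D_I (f δu^a)`. -/
theorem totalDerivMulti_mulZ (hU : IsOpen U) (hW : IsOpen W) (hUW : ∀ j ∈ cyl U, j.1 ∈ W)
    (hf : ContDiffOn ℝ ∞ f W) (a : s.Field) (I : MIdx n) :
    ∀ j ∈ cyl U, totalDerivMulti I (fun j : Jet n s => f j.1 • gen (Sum.inr (a, 0))) j =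
      mulZ f j.1 (Sum.inr (a, I)) := by
  classical
  refine (iterMulti_induction (D := cfStep)
    (D' := fun μ => totalDeriv (EuclideanSpace.single μ (1 : ℝ)))
    (Q := fun I (h : MIdx n → Base n → ℝ) (F : Jet n s → VAlg n s) =>
      (∀ J, ContDiffOn ℝ ∞ (h J) W) ∧ (∀ J, ¬ J ≤ I → ∀ x ∈ W, h J x = 0) ∧
      ∀ j ∈ cyl U, F j = ∑ J ∈ Finset.Iic I, h J j.1 • gen (Sum.inr (a, J))) ?_ I
    (f := fun J => if J = 0 then f else 0) ⟨fun J => ?_, fun J hJ x _ => ?_, fun j _ => ?_⟩).2.2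
  · rintro ν I h F ⟨h1, h2, h3⟩
    refine ⟨contDiffOn_cfStep hW h1 ν, cfStep_eq_zero hW h2 ν, fun j hj => ?_⟩
    have l : ∀ J ∈ Finset.Iic I, IsLocalOn (cyl U) fun j : Jet n s =>
        h J j.1 • (gen (Sum.inr (a, J)) : VAlg n s) := fun J _ =>
      (jsmooth_base (h1 J) hUW).smul_isLocalOn_const _
    rw [totalDeriv_congr hU _ (IsLocalOn.sum _ l) h3 hj, totalDeriv_sum hU _ _ l hj,
      sum_Iic_cfStep hW h2 ν (fun J => gen (Sum.inr (a, J))) (hUW j hj)]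
    refine Finset.sum_congr rfl fun J _ => ?_
    rw [totalDeriv_smul hU _ (jsmooth_base (h1 J) hUW) (isLocalOn_const _) hj,
      lineDeriv_base hU hW (h1 J) hj (hUW j hj), totalDeriv_const]
    congr 2
    rw [Finset.sum_eq_single ν (fun μ _ hμ => by simp [hμ]) (by simp), shiftDer_gen]
    simp [Gen.shift]
  · by_cases h : J = 0
    · simpa [h] using hf
    · simp only [h, if_false]
      exact contDiffOn_const (c := (0 : ℝ))
  · have : J ≠ 0 := fun h => hJ h.le
    simp [this]
  · have : Finset.Iic (0 : MIdx n) = {0} := by ext J; simp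
    simp [this]

theorem isLocalOn_mulZ (hW : IsOpen W) (hUW : ∀ j ∈ cyl U, j.1 ∈ W) (hf : ContDiffOn ℝ ∞ f W)
    (g : Gen n s) : IsLocalOn (cyl U) fun j : Jet n s => mulZ f j.1 g := by
  rcases g with p | p
  · exact isLocalOn_const 0
  · exact IsLocalOn.sum _ fun J _ =>
      (jsmooth_base ((cf_spec hW hf p.2).1 J) hUW).smul_isLocalOn_const _

theorem isLocalOn_mulOp_const (hW : IsOpen W) (hUW : ∀ j ∈ cyl U, j.1 ∈ W)
    (hf : ContDiffOn ℝ ∞ f W) (b : VAlg n s) :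
    IsLocalOn (cyl U) fun j : Jet n s => mulOp f j.1 b :=
  isLocalOn_der (isLocalOn_mulZ hW hUW hf) b

theorem isLocalOn_mulOp (hW : IsOpen W) (hUW : ∀ j ∈ cyl U, j.1 ∈ W)
    (hf : ContDiffOn ℝ ∞ f W) {x : Jet n s → VAlg n s} (hx : IsLocalOn (cyl U) x) :
    IsLocalOn (cyl U) fun j : Jet n s => mulOp f j.1 (x j) :=
  isLocalOn_family jfield_id (fun _ h => h) (isLocalOn_mulOp_const hW hUW hf) hx

theorem totalDeriv_mulZ (hU : IsOpen U) (hW : IsOpen W) (hUW : ∀ j ∈ cyl U, j.1 ∈ W)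
    (hf : ContDiffOn ℝ ∞ f W) (v : Base n) (g : Gen n s) {j : Jet n s} (hj : j ∈ cyl U) :
    totalDeriv v (fun j => mulZ f j.1 g) j = ∑ ν, v ν • mulZ f j.1 (g.shift ν) := by
  rw [totalDeriv_eq_sum hU (isLocalOn_mulZ hW hUW hf g) hj]
  refine Finset.sum_congr rfl fun ν _ => ?_
  congr 1
  rcases g with p | ⟨a, I⟩
  · change totalDeriv _ (fun _ => 0) j = 0
    rw [totalDeriv_const]; simp
  · have l : IsLocalOn (cyl U) fun j : Jet n s => f j.1 • (gen (Sum.inr (a, 0)) : VAlg n s) :=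
      (jsmooth_base hf hUW).smul_isLocalOn_const _
    change _ = mulZ f j.1 (Sum.inr (a, I + Finsupp.single ν 1))
    rw [← totalDerivMulti_mulZ hU hW hUW hf a _ j hj, totalDerivMulti_add_single hU I ν l j hj]
    exact totalDeriv_congr hU _ (isLocalOn_totalDerivMulti hU I l)
      (fun j hj => (totalDerivMulti_mulZ hU hW hUW hf a I j hj).symm) hj

theorem totalDeriv_mulOp_const (hU : IsOpen U) (hW : IsOpen W) (hUW : ∀ j ∈ cyl U, j.1 ∈ W)
    (hf : ContDiffOn ℝ ∞ f W) (v : Base n) (b : VAlg n s) : ∀ j ∈ cyl U,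
    totalDeriv v (fun j : Jet n s => mulOp f j.1 b) j =
      mulOp f j.1 (∑ ν, v ν • shiftDer ν b) := by
  have l := fun b => isLocalOn_mulOp_const (s := s) hW hUW hf b
  intro j hj
  induction b using VAlg_induction with
  | zero =>
    simp only [map_zero, totalDeriv_const]
    simp
  | add x y hx hy =>
    simp only [map_add]
    rw [totalDeriv_add hU v (l x) (l y) hj, hx, hy]
    simp only [smul_add, Finset.sum_add_distrib, map_add]
  | smul r x hx =>
    simp only [map_smul]
    rw [totalDeriv_const_smul hU v r (l x) hj, hx, ← map_smul, Finset.smul_sum]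
    simp only [smul_comm r]
  | one =>
    simp only [mulOp, der_one, totalDeriv_const, shiftDer_one]
    simp
  | gen_mul g x hx =>
    have lZ := isLocalOn_mulZ (s := s) hW hUW hf
    have e : ∀ j : Jet n s, mulOp f j.1 (gen g * x) = mulZ f j.1 g * x + gen g * mulOp f j.1 x :=
      fun j => by rw [isDer_mulOp, mulOp, der_gen]
    simp only [e]
    rw [totalDeriv_add hU v ((lZ g).mul (isLocalOn_const _)) ((isLocalOn_const _).mul (l x)) hj,
      totalDeriv_mul hU v (lZ g) (isLocalOn_const _) hj,
      totalDeriv_mul hU v (isLocalOn_const _) (l x) hj, hx, totalDeriv_const, totalDeriv_const,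
      totalDeriv_mulZ hU hW hUW hf v g hj]
    have e2 : ∀ g, mulOp f j.1 (gen g) = mulZ (s := s) f j.1 g := fun g => der_gen _ _
    simp only [isDer_shiftDer _ (gen g), shiftDer_gen, smul_add, Finset.sum_add_distrib, map_add,
      map_sum, map_smul, isDer_mulOp f j.1 _ _, e2, Finset.sum_mul, Finset.mul_sum, smul_mul_assoc,
      mul_smul_comm]
    abel

/-- This commutation is why the multiplication operators are natural: their values on the `δu'^a_I`
are determined by those on the undifferentiated `δu'^a`. -/
theorem totalDeriv_mulOp (hU : IsOpen U) (hW : IsOpen W) (hUW : ∀ j ∈ cyl U, j.1 ∈ W)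
    (hf : ContDiffOn ℝ ∞ f W) (v : Base n) {x : Jet n s → VAlg n s} (hx : IsLocalOn (cyl U) x)
    {j : Jet n s} (hj : j ∈ cyl U) :
    totalDeriv v (fun j : Jet n s => mulOp f j.1 (x j)) j = mulOp f j.1 (totalDeriv v x j) :=
  totalDeriv_family (φ := fun j : Jet n s => mulOp f j.1) hU hU jfield_id (fun _ h => h)
    (isLocalOn_mulOp_const hW hUW hf) hx hj (fieldDeriv_id hU hj _)
    fun b => totalDeriv_mulOp_const hU hW hUW hf v b j hj

end MulOp

/-! ### Multiplication operators under changes of adapted coordinates. -/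

section MulOpSubst

variable {n : ℕ} {s : FibreType} {M : Type*} [TopologicalSpace M] [ChartedSpace (Base n) M]
  {Y : GradedBundle n s M} {c c' : AdaptedChart Y}

theorem coord_mem_vdegPart (a : s.Field) (j : Jet n s) : c.coord c' a j ∈ vdegPart n s 0 := by
  rcases a with a | a
  · change algebraMap ℝ (VAlg n s) _ ∈ _
    rw [Algebra.algebraMap_eq_smul_one]
    exact Submodule.smul_mem _ _ (Submodule.subset_span ⟨[], rfl, rfl⟩)
  · rw [AdaptedChart.coord, AdaptedChart.coord₁]
    exact sum_mem fun b _ => Submodule.smul_mem _ _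
      (bideg_le_vdegPart _ _ (gen_mem_bideg (Sum.inl (⟨a.1, b⟩, 0))))

theorem gDeriv_coord_eq_zero (a : s.Field) (j : Jet n s) {p : Fin s.m × MIdx n} (hp : p.2 ≠ 0) :
    gDeriv (c.coord c' a) j (eP p) = 0 := by
  have hpt : ∀ t : ℝ, (j + t • eP p).pt = j.pt := by
    intro t
    refine Prod.ext (by simp [Jet.pt, eP]) ?_
    ext b
    have : (Pi.single p.1 (Pi.single p.2 (1 : ℝ)) : Fin s.m → MIdx n → ℝ) b 0 = 0 := by
      by_cases hb : b = p.1
      · subst hb; simp [Ne.symm hp]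
      · simp [hb]
    simp [Jet.pt, eP, this]
  refine gDeriv_eq_zero fun t => ?_
  rcases a with a | a
  · simp only [AdaptedChart.coord, AdaptedChart.coord₀, AdaptedChart.toY₀, hpt]
  · simp only [AdaptedChart.coord, AdaptedChart.coord₁, AdaptedChart.toY₀, hpt]

/-- The new fibre coordinates do not involve derivatives, so `δu'^a` is a combination of
undifferentiated `δu^b`. A general submodule `P` covers both `undiff` and `vdegPart`. -/
theorem vertD_coord_mem (a : s.Field) {j : Jet n s} (hj : j ∈ cyl (ovl c c'))
    (P : Submodule ℝ (VAlg n s))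
    (hP : ∀ b, ∀ y ∈ vdegPart n s 0, gen (Sum.inr (b, 0)) * y ∈ P) :
    vertD (c.coord c' a) j ∈ P := by
  rw [vertD_apply]
  refine add_mem (finsum_induction (fun y => y ∈ P) (zero_mem _) (fun _ _ => add_mem)
    fun p => ?_) ?_
  · by_cases hp : p.2 = 0
    · rw [hp]
      exact hP _ _ (gDeriv_mem (isOpen_ovl c c') (isLocalOn_coord a) _
        (fun j _ => coord_mem_vdegPart a j) hj _)
    · rw [gDeriv_coord_eq_zero a j hp, mul_zero]
      exact zero_mem _
  · rcases a with a | a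
    · simp only [AdaptedChart.coord, Algebra.algebraMap_eq_smul_one, map_smul, vertAlg_one,
        smul_zero]
      exact zero_mem _
    · simp only [AdaptedChart.coord, AdaptedChart.coord₁, map_sum, map_smul, vertAlg_inl]
      refine sum_mem fun b _ => Submodule.smul_mem _ _ ?_
      have := hP (Sum.inr ⟨a.1, b⟩) 1 (Submodule.subset_span ⟨[], rfl, rfl⟩)
      rwa [mul_one] at this

theorem genChange_inl_mem (p : s.Graded × MIdx n) {j : Jet n s} (hj : j ∈ cyl (ovl c c')) :
    c.genChange c' (Sum.inl p) j ∈ vdegPart n s 0 := by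
  have h := iterMulti_mem (D := chartD c c') (Q := fun f : Jet n s → VAlg n s =>
    IsLocalOn (cyl (ovl c c')) f ∧ ∀ j ∈ cyl (ovl c c'), f j ∈ bideg n s 0 (s.deg (Sum.inr p.1)))
    (fun μ f h => ⟨isLocalOn_chartD μ h.1, fun j hj =>
      totalDeriv_mem_bideg (isOpen_ovl c c') _ h.1 h.2 hj⟩) p.2
    (f := c.coord₁ c' p.1) ⟨isLocalOn_coord₁ _, fun j _ => sum_mem fun b _ =>
      Submodule.smul_mem _ _ (gen_mem_bideg (Sum.inl (⟨p.1.1, b⟩, 0)))⟩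
  exact bideg_le_vdegPart _ _ (h.2 j hj)

variable {T : Jet n s → VAlg n s →ₐ[ℝ] VAlg n s}
  {U V : Set (ModelProd (Base n) (Base s.m))} {W W' : Set (Base n)} {f f' : Base n → ℝ}

theorem gen_mul_mem_vdegPart (b : s.Field) {y : VAlg n s} (hy : y ∈ vdegPart n s 0) :
    gen (Sum.inr (b, 0)) * y ∈ vdegPart n s 1 := by
  have h : (gen (Sum.inr (b, 0)) : VAlg n s) ∈ vdegPart n s 1 :=
    Submodule.subset_span ⟨[Sum.inr (b, 0)], rfl, by simp⟩
  exact mul_mem_vdegPart (q := 1) (q' := 0) h hy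

/-- On undifferentiated one-forms the lowering part vanishes, as there is no multi-index below zero.
-/
theorem mulOp_genChange_zero (hW : IsOpen W) (hf : ContDiffOn ℝ ∞ f W) (a : s.Field) {j : Jet n s}
    (hj : j ∈ cyl (ovl c c')) (hjW : j.1 ∈ W) :
    mulOp f j.1 (c.genChange c' (Sum.inr (a, 0)) j) =
      f j.1 • c.genChange c' (Sum.inr (a, 0)) j := by
  have h1 := vertD_coord_mem (c := c) (c' := c') a hj (undiff n s) fun b y hy =>
    mul_mem_undiff (gen_mem_undiff b) (vdegPart_zero_le_undiff hy)
  have h2 := vertD_coord_mem (c := c) (c' := c') a hj (vdegPart n s 1)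
    fun b _ hy => gen_mul_mem_vdegPart b hy
  rw [genChange_inr a 0 hj, jc, iterMulti_zero, mulOp_eq hW hf hjW h2, lowOp_undiff _ h1, add_zero]

theorem mulOp_genChange (hU : IsOpen U) (hUo : U ⊆ ovl c c') (hW : IsOpen W)
    (hUW : ∀ j ∈ cyl U, j.1 ∈ W) (hf : ContDiffOn ℝ ∞ f W) (a : s.Field) (I : MIdx n) :
    ∀ j ∈ cyl U, iterMulti (chartD c c') I
      (fun j => mulOp f j.1 (c.genChange c' (Sum.inr (a, 0)) j)) j =
        mulOp f j.1 (c.genChange c' (Sum.inr (a, I)) j) := by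
  refine iterMulti_induction (D := chartD c c') (D' := fun (_ : Fin n) (u : Unit) => u)
    (f' := ()) (Q := fun I F _ => ∀ j ∈ cyl U,
      F j = mulOp f j.1 (c.genChange c' (Sum.inr (a, I)) j)) (fun μ I F _ h j hj => ?_) I
      (fun _ _ => rfl)
  have lg : IsLocalOn (cyl U) (c.genChange c' (Sum.inr (a, I))) :=
    (isLocalOn_genChange _).mono hUo
  rw [chartD_congr hU μ (isLocalOn_mulOp hW hUW hf lg) h j hj, chartD,
    totalDeriv_mulOp hU hW hUW hf _ lg hj]
  congr 1
  exact chartD_genChange μ (Sum.inr (a, I)) j (hUo hj)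

/-- Both sides are obtained from the common value `f δu'^a` by iterating the total derivatives of
`c'`: substitution intertwines these with the ones computed in `c`, and multiplication operators
commute with them. -/
theorem subst_mulZ (hT : ∀ j ∈ cyl (ovl c c'), c.IsSubst c' j (T j)) (hU : IsOpen U)
    (hV : IsOpen V) (hUo : U ⊆ ovl c c') (hm : ∀ j ∈ cyl U, c.jetChange c' j ∈ cyl V)
    (hW : IsOpen W) (hUW : ∀ j ∈ cyl U, j.1 ∈ W) (hf : ContDiffOn ℝ ∞ f W)
    (hW' : IsOpen W') (hVW : ∀ j ∈ cyl V, j.1 ∈ W') (hf' : ContDiffOn ℝ ∞ f' W')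
    (hff' : ∀ j ∈ cyl U, f' (c.baseChange c' j.1) = f j.1) (g : Gen n s) {j : Jet n s}
    (hj : j ∈ cyl U) :
    T j (mulZ f' (c.jetChange c' j).1 g) = mulOp f j.1 (c.genChange c' g j) := by
  rcases g with p | ⟨a, I⟩
  · rw [mulOp_vdegPart_zero _ (genChange_inl_mem p (hUo hj))]
    exact map_zero _
  · have l : IsLocalOn (cyl V) fun j : Jet n s => f' j.1 • (gen (Sum.inr (a, 0)) : VAlg n s) :=
      (jsmooth_base hf' hVW).smul_isLocalOn_const _
    have h0 : ∀ j ∈ cyl U, mulOp f j.1 (c.genChange c' (Sum.inr (a, 0)) j) =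
        T j (f' (c.jetChange c' j).1 • gen (Sum.inr (a, 0))) := fun j hj => by
      rw [mulOp_genChange_zero hW hf a (hUo hj) (hUW j hj), map_smul, hT j (hUo hj)]
      exact congrArg (· • _) (hff' j hj).symm
    rw [← totalDerivMulti_mulZ hV hW' hVW hf' a I _ (hm j hj),
      ← totalDerivMulti_subst hT hU hV hUo hm I l h0 j hj]
    exact mulOp_genChange hU hUo hW hUW hf a I j hj

theorem mulOp_subst (hT : ∀ j ∈ cyl (ovl c c'), c.IsSubst c' j (T j)) (hU : IsOpen U)
    (hV : IsOpen V) (hUo : U ⊆ ovl c c') (hm : ∀ j ∈ cyl U, c.jetChange c' j ∈ cyl V)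
    (hW : IsOpen W) (hUW : ∀ j ∈ cyl U, j.1 ∈ W) (hf : ContDiffOn ℝ ∞ f W)
    (hW' : IsOpen W') (hVW : ∀ j ∈ cyl V, j.1 ∈ W') (hf' : ContDiffOn ℝ ∞ f' W')
    (hff' : ∀ j ∈ cyl U, f' (c.baseChange c' j.1) = f j.1) (y : VAlg n s) :
    ∀ j ∈ cyl U, T j (mulOp f' (c.jetChange c' j).1 y) = mulOp f j.1 (T j y) := by
  intro j hj
  induction y using VAlg_induction with
  | zero => simp only [map_zero]
  | add x y hx hy => simp only [map_add, hx, hy]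
  | smul r x hx => simp only [map_smul, hx]
  | one => simp only [mulOp, der_one, map_one, map_zero]
  | gen_mul g x hx =>
    have key := subst_mulZ hT hU hV hUo hm hW hUW hf hW' hVW hf' hff' g hj
    rw [← hT j (hUo hj) g] at key
    rw [isDer_mulOp, map_add, map_mul, map_mul, hx, map_mul, isDer_mulOp, ← key, mulOp, der_gen]

/-- Naturality of the lowering part of the multiplication operators. -/
theorem lowOp_subst (hT : ∀ j ∈ cyl (ovl c c'), c.IsSubst c' j (T j)) (hU : IsOpen U)
    (hV : IsOpen V) (hUo : U ⊆ ovl c c') (hm : ∀ j ∈ cyl U, c.jetChange c' j ∈ cyl V)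
    (hW : IsOpen W) (hUW : ∀ j ∈ cyl U, j.1 ∈ W) (hf : ContDiffOn ℝ ∞ f W)
    (hW' : IsOpen W') (hVW : ∀ j ∈ cyl V, j.1 ∈ W') (hf' : ContDiffOn ℝ ∞ f' W')
    (hff' : ∀ j ∈ cyl U, f' (c.baseChange c' j.1) = f j.1) {j : Jet n s} (hj : j ∈ cyl U)
    {y : VAlg n s} (hy : y ∈ vdegPart n s 1) (hTy : T j y ∈ vdegPart n s 1) :
    T j (lowOp (fun I J => cf f' I J (c.jetChange c' j).1) y) =
      lowOp (fun I J => cf f I J j.1) (T j y) := by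
  have h := mulOp_subst hT hU hV hUo hm hW hUW hf hW' hVW hf' hff' y j hj
  rw [mulOp_eq hW hf (hUW j hj) hTy, mulOp_eq hW' hf' (hVW _ (hm j hj)) hy, map_add, map_smul] at h
  have e : f' (c.jetChange c' j).1 = f j.1 := hff' j hj
  rw [e] at h
  exact add_left_cancel h

end MulOpSubst

/-! ### The lowering operators of a partition of unity -/

section Globalization

variable {n : ℕ} {s : FibreType}

theorem lowOp_smul_add (r : ℝ) (ζ ζ' : MIdx n → MIdx n → ℝ) (y : VAlg n s) :
    lowOp (fun I J => r * ζ I J + ζ' I J) y = r • lowOp ζ y + lowOp ζ' y := by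
  have e : lowZ (s := s) (fun I J => r * ζ I J + ζ' I J) = fun g => r • lowZ ζ g + lowZ ζ' g := by
    funext g
    rcases g with p | p
    · simp [lowZ]
    · simp only [lowZ, Sum.elim_inr, add_smul, Finset.sum_add_distrib, mul_smul, Finset.smul_sum]
  rw [lowOp, e, der_smul_add]
  rfl

theorem lowOp_zero (y : VAlg n s) : lowOp (fun _ _ => 0) y = 0 := by
  have := lowOp_smul_add (-1) (fun _ _ => 0) (fun _ _ => 0) y
  simpa using this

theorem lowOp_sum {ι : Type*} (t : Finset ι) (r : ι → ℝ) (ζ : ι → MIdx n → MIdx n → ℝ)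
    (y : VAlg n s) :
    lowOp (fun I J => ∑ i ∈ t, r i * ζ i I J) y = ∑ i ∈ t, r i • lowOp (ζ i) y := by
  classical
  induction t using Finset.induction_on with
  | empty => simpa using lowOp_zero y
  | insert i t hi ih =>
    simp only [Finset.sum_insert hi]
    rw [lowOp_smul_add, ih]

variable {M : Type*} [TopologicalSpace M] [ChartedSpace (Base n) M]

/-- The coordinate functions of `e'` in the coordinates of `e`. -/
def chgCoord (e e' : OpenPartialHomeomorph M (Base n)) (κ : Fin n) (x : Base n) : ℝ := chg e e' x κ

theorem contDiffOn_chgCoord {e e' : OpenPartialHomeomorph M (Base n)}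
    (he : e ∈ IsManifold.maximalAtlas (𝓡 n) ∞ M) (he' : e' ∈ IsManifold.maximalAtlas (𝓡 n) ∞ M)
    (κ : Fin n) : ContDiffOn ℝ ∞ (chgCoord e e' κ) (chgDom e e') :=
  (EuclideanSpace.proj (𝕜 := ℝ) κ : Base n →L[ℝ] ℝ).contDiff.comp_contDiffOn (contDiffOn_chg he he')

theorem fderiv_chgCoord {e e' : OpenPartialHomeomorph M (Base n)}
    (he : e ∈ IsManifold.maximalAtlas (𝓡 n) ∞ M) (he' : e' ∈ IsManifold.maximalAtlas (𝓡 n) ∞ M)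
    (κ : Fin n) {x : Base n} (hx : x ∈ chgDom e e') (v : Base n) :
    fderiv ℝ (chgCoord e e' κ) x v = fderiv ℝ (chg e e') x v κ := by
  have h := (EuclideanSpace.proj (𝕜 := ℝ) κ : Base n →L[ℝ] ℝ).hasFDerivAt.comp x
    (hasFDerivAt_chg he he' hx)
  have h' : HasFDerivAt (chgCoord e e' κ) _ x := h
  rw [h'.fderiv]
  rfl

/-- The coefficients of the lowering operator of two charts: `∑_κ (∂/∂y^κ)^μ` times the coefficients
of the multiplication with `y^κ`, for the coordinates `y` of `e'`. -/
def chgZeta (e e' : OpenPartialHomeomorph M (Base n)) (μ : Fin n) (I J : MIdx n) (x : Base n) : ℝ :=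
  ∑ κ, chgPartial e e' κ x μ * cf (chgCoord e e' κ) I J x

theorem contDiffOn_chgZeta {e e' : OpenPartialHomeomorph M (Base n)}
    (he : e ∈ IsManifold.maximalAtlas (𝓡 n) ∞ M) (he' : e' ∈ IsManifold.maximalAtlas (𝓡 n) ∞ M)
    (μ : Fin n) (I J : MIdx n) : ContDiffOn ℝ ∞ (chgZeta e e' μ I J) (chgDom e e') :=
  ContDiffOn.sum fun κ _ => ContDiffOn.mul
    ((EuclideanSpace.proj (𝕜 := ℝ) μ : Base n →L[ℝ] ℝ).contDiff.comp_contDiffOn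
      (contDiffOn_chgPartial he he' κ))
    ((cf_spec (isOpen_chgDom e e') (contDiffOn_chgCoord he he' κ) I).1 J)

/-- The first-order coefficient for `y^κ` is `(J_ν + 1) ∂_ν y^κ`; contraction with the components of
`∂/∂y^κ` multiplies the two mutually inverse Jacobians, leaving a Kronecker delta. -/
theorem chgZeta_lead {e e' : OpenPartialHomeomorph M (Base n)}
    (he : e ∈ IsManifold.maximalAtlas (𝓡 n) ∞ M) (he' : e' ∈ IsManifold.maximalAtlas (𝓡 n) ∞ M)
    (μ ν : Fin n) (J : MIdx n) {x : Base n} (hx : x ∈ chgDom e e') :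
    chgZeta e e' μ (J + Finsupp.single ν 1) J x = if ν = μ then (J μ : ℝ) + 1 else 0 := by
  have h := congrArg (fun v : Base n => v μ)
    (eq_sum_chgPartial he he' hx (EuclideanSpace.single ν (1 : ℝ)))
  simp only [WithLp.ofLp_sum, Finset.sum_apply, PiLp.smul_apply, smul_eq_mul] at h
  have e1 : ∀ κ, chgPartial e e' κ x μ * cf (chgCoord e e' κ) (J + Finsupp.single ν 1) J x =
      ((J ν : ℝ) + 1) * (fderiv ℝ (chg e e') x (EuclideanSpace.single ν 1) κ *
        chgPartial e e' κ x μ) := by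
    intro κ
    rw [(cf_spec (isOpen_chgDom e e') (contDiffOn_chgCoord he he' κ) _).2.2.2 J ν rfl x hx,
      fderiv_chgCoord he he' κ hx]
    simp
    ring
  simp only [chgZeta, e1]
  rw [← Finset.mul_sum, ← h]
  by_cases hν : ν = μ
  · simp [hν]
  · simp [hν]

variable (ρ : SmoothPartitionOfUnity M (𝓡 n) M Set.univ)

/-- The coefficients of the lowering operator of a partition of unity. -/
def puZeta (e : OpenPartialHomeomorph M (Base n)) (μ : Fin n) (I J : MIdx n) (x : Base n) : ℝ :=
  ∑ᶠ i, ρ i (e.symm x) * chgZeta e (chartAt (Base n) i) μ I J x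

variable {ρ}

theorem mem_chgDom_of_ne_zero {e : OpenPartialHomeomorph M (Base n)}
    (hρ : ρ.IsSubordinate fun x => (chartAt (Base n) x).source)
    {x : Base n} (hx : x ∈ e.target) {i : M} (hi : ρ i (e.symm x) ≠ 0) :
    x ∈ chgDom e (chartAt (Base n) i) :=
  ⟨hx, hρ i (subset_tsupport _ hi)⟩

/-- Each `h i` is smooth only over the `i`-th chart; off the support of `ρ i` the product vanishes
identically, and local finiteness reduces to a finite sum. -/
theorem contDiffOn_finsum_mul {e : OpenPartialHomeomorph M (Base n)}
    (he : e ∈ IsManifold.maximalAtlas (𝓡 n) ∞ M)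
    (hρ : ρ.IsSubordinate fun x => (chartAt (Base n) x).source) {h : M → Base n → ℝ}
    (hh : ∀ i, ContDiffOn ℝ ∞ (h i) (chgDom e (chartAt (Base n) i))) :
    ContDiffOn ℝ ∞ (fun x => ∑ᶠ i, ρ i (e.symm x) * h i x) e.target := by
  intro x hx
  refine ContDiffAt.contDiffWithinAt ?_
  obtain ⟨O, hO, hfin⟩ := ρ.locallyFinite (e.symm x)
  have hc : ContinuousAt e.symm x := e.continuousAt_symm hx
  have hev : (fun x => ∑ᶠ i, ρ i (e.symm x) * h i x) =ᶠ[nhds x]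
      fun x => ∑ i ∈ hfin.toFinset, ρ i (e.symm x) * h i x := by
    filter_upwards [hc.preimage_mem_nhds hO] with y hy
    refine finsum_eq_sum_of_support_subset _ fun i hi => ?_
    rw [Set.Finite.coe_toFinset]
    exact ⟨e.symm y, left_ne_zero_of_mul hi, hy⟩
  refine ContDiffAt.congr_of_eventuallyEq (ContDiffAt.sum fun i _ => ?_) hev
  have hsm : ContDiffAt ℝ ∞ (fun x => ρ i (e.symm x)) x := by
    have h1 := (ρ i).contMDiff.comp_contMDiffOn (contMDiffOn_symm_of_mem_maximalAtlas he)
    exact (contMDiffOn_iff_contDiffOn.1 h1).contDiffAt (e.open_target.mem_nhds hx)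
  by_cases hi : e.symm x ∈ tsupport (ρ i)
  · exact hsm.mul ((hh i).contDiffAt ((isOpen_chgDom _ _).mem_nhds ⟨hx, hρ i hi⟩))
  · have h0 : (fun x => ρ i (e.symm x) * h i x) =ᶠ[nhds x] fun _ => 0 := by
      filter_upwards [hc.preimage_mem_nhds ((isClosed_tsupport (ρ i)).isOpen_compl.mem_nhds hi)]
        with y hy
      have : ρ i (e.symm y) = 0 := by
        by_contra h
        exact hy (subset_tsupport _ h)
      rw [this, zero_mul]
    exact contDiffAt_const.congr_of_eventuallyEq h0

theorem puZeta_lead [IsManifold (𝓡 n) ∞ M] {e : OpenPartialHomeomorph M (Base n)}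
    (he : e ∈ IsManifold.maximalAtlas (𝓡 n) ∞ M)
    (hρ : ρ.IsSubordinate fun x => (chartAt (Base n) x).source)
    (μ ν : Fin n) (J : MIdx n) {x : Base n} (hx : x ∈ e.target) :
    puZeta ρ e μ (J + Finsupp.single ν 1) J x = if ν = μ then (J μ : ℝ) + 1 else 0 := by
  have h : ∀ i, ρ i (e.symm x) * chgZeta e (chartAt (Base n) i) μ (J + Finsupp.single ν 1) J x =
      ρ i (e.symm x) * if ν = μ then (J μ : ℝ) + 1 else 0 := by
    intro i
    by_cases hi : ρ i (e.symm x) = 0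
    · rw [hi, zero_mul, zero_mul]
    · rw [chgZeta_lead he (IsManifold.chart_mem_maximalAtlas i) μ ν J
        (mem_chgDom_of_ne_zero hρ hx hi)]
  rw [puZeta, finsum_congr h, ← finsum_mul, ρ.sum_eq_one (Set.mem_univ _), one_mul]

variable {Y : GradedBundle n s M}

/-- The lowering operators of a partition of unity, in an adapted chart. -/
def puLow (ρ : SmoothPartitionOfUnity M (𝓡 n) M Set.univ) (c : AdaptedChart Y) (μ : Fin n)
    (j : Jet n s) : VAlg n s →ₗ[ℝ] VAlg n s :=
  lowOp fun I J => puZeta ρ c.φ μ I J j.1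

theorem isLowering_puLow [IsManifold (𝓡 n) ∞ M]
    (hρ : ρ.IsSubordinate fun x => (chartAt (Base n) x).source)
    (c : AdaptedChart Y) : IsLowering c.ψ.target (puLow ρ c) :=
  isLowering_lowOp (fun _ hj => fst_mem_target hj)
    (fun μ I J => contDiffOn_finsum_mul c.φ_mem hρ fun i =>
      contDiffOn_chgZeta c.φ_mem (IsManifold.chart_mem_maximalAtlas i) μ I J)
    fun μ ν J _ hx => puZeta_lead c.φ_mem hρ μ ν J hx

/-- The components of `∂/∂y^κ` are absorbed into the contracted argument. What remains is built from
the functions `ρ_i`, the coordinate functions `y_i^κ` and their vector fields, none of which depends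
on `c`. -/
theorem lowK_puLow (c : AdaptedChart Y) {p : ℕ}
    (a : Jet n s → (Base n) [⋀^Fin (p + 1)]→ₗ[ℝ] VAlg n s) (j : Jet n s) (v : Fin p → Base n) :
    lowK (puLow ρ c) a j v =
      ∑ i ∈ (ρ.locallyFinite.point_finite (c.φ.symm j.1)).toFinset, ρ i (c.φ.symm j.1) •
        ∑ κ, lowOp (fun I J => cf (chgCoord c.φ (chartAt (Base n) i) κ) I J j.1)
          (a j (Fin.cons (chgPartial c.φ (chartAt (Base n) i) κ j.1) v)) := by
  set t := (ρ.locallyFinite.point_finite (c.φ.symm j.1)).toFinset with ht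
  have e1 : ∀ μ y, puLow ρ c μ j y = ∑ i ∈ t, ρ i (c.φ.symm j.1) • ∑ κ,
      chgPartial c.φ (chartAt (Base n) i) κ j.1 μ •
        lowOp (fun I J => cf (chgCoord c.φ (chartAt (Base n) i) κ) I J j.1) y := by
    intro μ y
    have : (fun I J => puZeta ρ c.φ μ I J j.1) = fun I J => ∑ i ∈ t, ρ i (c.φ.symm j.1) *
        chgZeta c.φ (chartAt (Base n) i) μ I J j.1 := by
      funext I J
      refine finsum_eq_sum_of_support_subset _ fun i hi => ?_
      rw [ht, Set.Finite.coe_toFinset]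
      exact left_ne_zero_of_mul hi
    rw [puLow, this, lowOp_sum]
    refine Finset.sum_congr rfl fun i _ => ?_
    congr 1
    exact lowOp_sum _ _ _ _
  have e2 : ∀ X : Base n, a j (Fin.cons X v) =
      ∑ μ, X μ • a j (Fin.cons (EuclideanSpace.single μ 1) v) := by
    intro X
    have h1 : ∀ X : Base n, a j (Fin.cons X v) = evalAlt v ((a j).curryLeft X) := fun _ => rfl
    simp only [h1]
    conv_lhs => rw [base_eq_sum X, map_sum, map_sum]
    simp only [map_smul]
  rw [lowK_apply]
  simp only [e1]
  rw [Finset.sum_comm]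
  refine Finset.sum_congr rfl fun i _ => ?_
  rw [← Finset.smul_sum, Finset.sum_comm]
  congr 1
  refine Finset.sum_congr rfl fun κ _ => ?_
  rw [e2, map_sum]
  simp only [map_smul]

end Globalization

/-! ### Naturality of the horizontal differential -/

section AltPullback

variable {n p : ℕ} {s : FibreType} {U : Set (ModelProd (Base n) (Base s.m))}

theorem continuous_multilinear (φ : MultilinearMap ℝ (fun _ : Fin p => Base n) ℝ) :
    Continuous φ := by
  have h : ∀ x : Fin p → Base n, φ x = ∑ f : Fin p → Fin n,
      (∏ l, x l (f l)) * φ fun l => EuclideanSpace.single (f l) 1 := by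
    intro x
    conv_lhs => rw [show x = fun l => ∑ ν, x l ν • EuclideanSpace.single ν (1 : ℝ) from
      funext fun l => base_eq_sum (x l)]
    rw [φ.map_sum]
    exact Finset.sum_congr rfl fun f _ => φ.map_smul_univ _ _
  rw [show (φ : (Fin p → Base n) → ℝ) = _ from funext h]
  fun_prop

theorem hasDerivAt_multilinear (φ : MultilinearMap ℝ (fun _ : Fin p => Base n) ℝ)
    {x : Fin p → ℝ → Base n} {x' : Fin p → Base n} {t : ℝ} (hx : ∀ l, HasDerivAt (x l) (x' l) t) :
    HasDerivAt (fun t => φ fun l => x l t)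
      (∑ l, φ (Function.update (fun l => x l t) l (x' l))) t := by
  let φc : ContinuousMultilinearMap ℝ (fun _ : Fin p => Base n) ℝ := ⟨φ, continuous_multilinear φ⟩
  have h := (φc.hasFDerivAt (fun l => x l t)).comp_hasDerivAt t (hasDerivAt_pi.2 hx)
  rw [ContinuousMultilinearMap.linearDeriv_apply] at h
  exact h

/-- The product rule when the arguments vary as well; it is needed because the Jacobian of a change
of coordinates enters every argument. -/
theorem gDeriv_alt_apply (hU : IsOpen U) {a : Jet n s → (Base n) [⋀^Fin p]→ₗ[ℝ] VAlg n s}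
    (ha : IsLocalOn (cyl U) a) {x : Fin p → Jet n s → Base n} (hx : ∀ l, JSmooth U (x l))
    {j : Jet n s} (hj : j ∈ cyl U) (w : Jet n s) :
    gDeriv (fun j => a j fun l => x l j) j w = gDeriv a j w (fun l => x l j) +
      ∑ l, a j (Function.update (fun l => x l j) l (lineDeriv ℝ (x l) j w)) := by
  obtain ⟨N, u, b, hu, hab⟩ := ha.exists_sum
  have ev : ∀ (r : Fin N → ℝ) v, (∑ i, r i • b i) v = ∑ i, r i • b i v := fun r v =>
    map_sum (evalAlt v) (fun i => r i • b i) _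
  rw [gDeriv_of_sum hU hu hab hj, ev]
  simp only [hab j hj, ev]
  refine gDeriv_unique fun φ => ?_
  have hd : HasDerivAt (fun t : ℝ => ∑ i, u i (j + t • w) * φ (b i fun l => x l (j + t • w)))
      (∑ i, (lineDeriv ℝ (u i) j w * φ (b i fun l => x l j) + u i j * ∑ l, φ (b i
        (Function.update (fun l => x l j) l (lineDeriv ℝ (x l) j w))))) 0 := by
    refine HasDerivAt.fun_sum fun i _ => ?_
    have h1 := (hu i).hasLineDerivAt hU hj w
    have h2 := hasDerivAt_multilinear (φ.compMultilinearMap (b i).toMultilinearMap)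
      fun l => (hx l).hasLineDerivAt hU hj w
    have h3 := HasDerivAt.mul h1 h2
    simp only [zero_smul, add_zero] at h3
    exact h3
  have e : φ (∑ i, lineDeriv ℝ (u i) j w • b i (fun l => x l j) + ∑ l, ∑ i, u i j •
      b i (Function.update (fun l => x l j) l (lineDeriv ℝ (x l) j w))) =
      ∑ i, (lineDeriv ℝ (u i) j w * φ (b i fun l => x l j) + u i j * ∑ l, φ (b i
        (Function.update (fun l => x l j) l (lineDeriv ℝ (x l) j w)))) := by
    rw [Finset.sum_comm]
    simp only [map_add, map_sum, map_smul, smul_eq_mul, Finset.sum_add_distrib, Finset.mul_sum]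
  rw [e]
  refine HasDerivAt.congr_of_eventuallyEq hd ?_
  filter_upwards [eventually_mem_cyl hU hj w] with t ht
  rw [hab _ ht, ev, map_sum]
  simp only [map_smul, smul_eq_mul]

theorem totalDeriv_alt_apply (hU : IsOpen U)
    {a : Jet n s → (Base n) [⋀^Fin p]→ₗ[ℝ] VAlg n s} (ha : IsLocalOn (cyl U) a)
    {x : Fin p → Jet n s → Base n} (hx : ∀ l, JSmooth U (x l)) {j : Jet n s} (hj : j ∈ cyl U)
    (v : Base n) :
    totalDeriv v (fun j => a j fun l => x l j) j = altD v a j (fun l => x l j) +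
      ∑ l, a j (Function.update (fun l => x l j) l (lineDeriv ℝ (x l) j (cartanLift v j))) := by
  rw [totalDeriv_apply, gDeriv_alt_apply hU ha hx hj, altD, AlternatingMap.add_apply]
  have : (∑ ν, v ν • (shiftDer ν).compAlternatingMap (a j)) (fun l => x l j) =
      ∑ ν, v ν • shiftDer ν (a j fun l => x l j) :=
    map_sum (evalAlt fun l => x l j) (fun ν => v ν • (shiftDer ν).compAlternatingMap (a j)) _
  rw [this]
  abel

/-- Two arguments are fed into a symmetric `H` and the result is alternated. With `H` the Hessian
and `A` the Jacobian of a change of coordinates, these are the unwanted terms in the transformation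
of `d_h`. -/
theorem alternating_symmetric_eq_zero (α : (Base n) [⋀^Fin p]→ₗ[ℝ] VAlg n s)
    (A : Base n →ₗ[ℝ] Base n) (H : Base n →ₗ[ℝ] Base n →ₗ[ℝ] Base n) (hH : ∀ x y, H x y = H y x)
    (v : Fin (p + 1) → Base n) :
    ∑ i : Fin (p + 1), (-1 : ℝ) ^ (i : ℕ) • ∑ l, α (Function.update
      (fun m => A (v (i.succAbove m))) l (H (v i) (v (i.succAbove l)))) = 0 := by
  rcases p with _ | p
  · simp
  · let B : Base n →ₗ[ℝ] (Base n) [⋀^Fin p]→ₗ[ℝ] VAlg n s :=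
      
      { toFun := fun y => (α.curryLeft y).compLinearMap A
        map_add' := fun x y => by rw [map_add, AlternatingMap.add_compLinearMap]
        map_smul' := fun r y => by rw [map_smul]; rfl }
    let f : Base n →ₗ[ℝ] Base n →ₗ[ℝ] (Base n) [⋀^Fin p]→ₗ[ℝ] VAlg n s :=
      (LinearMap.llcomp ℝ (Base n) (Base n) _ B) ∘ₗ H
    have hf : ∀ x y, f x y = f y x := fun x y => congrArg B (hH x y)
    have h := congrArg (fun β => β v)
      (AlternatingMap.alternatizeUncurryFin_alternatizeUncurryFinLM_comp_of_symmetric hf)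
    refine Eq.trans ?_ h
    simp only [AlternatingMap.alternatizeUncurryFin_apply]
    refine Finset.sum_congr rfl fun i _ => ?_
    rw [← Int.cast_smul_eq_zsmul ℝ]
    push_cast
    congr 1
    change _ = (AlternatingMap.alternatizeUncurryFin (f (v i))) (i.removeNth v)
    rw [AlternatingMap.alternatizeUncurryFin_apply]
    refine Finset.sum_congr rfl fun l _ => ?_
    have e : Function.update (fun m => A (v (i.succAbove m))) l (H (v i) (v (i.succAbove l))) =
        l.insertNth (H (v i) (v (i.succAbove l)))
          (l.removeNth fun m => A (v (i.succAbove m))) := by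
      rw [Fin.insertNth_removeNth]
    rw [e, AlternatingMap.map_insertNth]
    rfl

end AltPullback

/-! ### Naturality of `d_h` and of the homotopy operator. -/

section AltSubst

variable {n p : ℕ} {s : FibreType} {M : Type*} [TopologicalSpace M] [ChartedSpace (Base n) M]
  {Y : GradedBundle n s M} {c c' : AdaptedChart Y} {T : Jet n s → VAlg n s →ₐ[ℝ] VAlg n s}
  {a a' : Jet n s → (Base n) [⋀^Fin p]→ₗ[ℝ] VAlg n s}

/-- Naturality of the horizontal differential. -/
theorem altDh_subst (hT : ∀ j ∈ cyl (ovl c c'), c.IsSubst c' j (T j))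
    (ha : IsLocalOn (cyl (ovl c c')) a) (ha' : IsLocalOn (cyl c'.ψ.target) a')
    (h : ∀ j ∈ cyl (ovl c c'), ∀ v, a j v =
      T j (a' (c.jetChange c' j) fun l => fderiv ℝ (c.baseChange c') j.1 (v l)))
    {j : Jet n s} (hj : j ∈ cyl (ovl c c')) (v : Fin (p + 1) → Base n) :
    altDh a j v =
      T j (altDh a' (c.jetChange c' j) fun l => fderiv ℝ (c.baseChange c') j.1 (v l)) := by
  have hU := isOpen_ovl c c'
  have hV := c'.ψ.open_target
  have hb := isOpen_baseOvl c c'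
  have hjb := fst_mem_baseOvl hj
  have hfd : ContDiffOn ℝ ∞ (fderiv ℝ (c.baseChange c')) (baseOvl c c') :=
    (contDiffOn_baseChange c c').fderiv_of_isOpen hb (by simp)
  have hw : ∀ w : Base n, ContDiffOn ℝ ∞ (fun x => fderiv ℝ (c.baseChange c') x w)
      (baseOvl c c') := fun w => hfd.clm_apply contDiffOn_const
  have hx : ∀ w : Base n, JSmooth (ovl c c') fun j : Jet n s =>
      fderiv ℝ (c.baseChange c') j.1 w := fun w =>
    jsmooth_base (hw w) fun _ hj => fst_mem_baseOvl hj
  have hdx : ∀ w u : Base n, lineDeriv ℝ (fun j : Jet n s => fderiv ℝ (c.baseChange c') j.1 w) j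
      (cartanLift u j) = fderiv ℝ (fderiv ℝ (c.baseChange c')) j.1 u w := by
    intro w u
    rw [lineDeriv_base hU hb (hw w) hj hjb]
    have hd := ((hfd.contDiffAt (hb.mem_nhds hjb)).differentiableAt (by simp)).hasFDerivAt
    rw [(hd.clm_apply (hasFDerivAt_const w j.1)).fderiv]
    simp [cartanLift]
  have hsymm : ∀ x y, fderiv ℝ (fderiv ℝ (c.baseChange c')) j.1 x y =
      fderiv ℝ (fderiv ℝ (c.baseChange c')) j.1 y x := fun x y =>
    (((contDiffOn_baseChange c c').contDiffAt (hb.mem_nhds hjb)).isSymmSndFDerivAt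
      (by rw [minSmoothness_of_isRCLikeNormedField]; exact WithTop.coe_le_coe.2 le_top)) x y
  have ha'' : IsLocalOn (cyl (ovl c c')) fun j =>
      (T j).toLinearMap.compAlternatingMap (a' (c.jetChange c' j)) :=
    isLocalOn_alt fun w => isLocalOn_subst hT subset_rfl jetChange_mem (ha'.eval w)
  -- Besides the transformed derivative, differentiating the Jacobian in each argument produces one
  -- Hessian term per argument.
  have key : ∀ i : Fin (p + 1), totalDeriv (v i) (fun j => a j fun l => v (i.succAbove l)) j =
      T j (totalDeriv (fderiv ℝ (c.baseChange c') j.1 (v i)) (fun j' => a' j' fun l =>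
        fderiv ℝ (c.baseChange c') j.1 (v (i.succAbove l))) (c.jetChange c' j)) +
      ∑ l, (T j).toLinearMap.compAlternatingMap (a' (c.jetChange c' j)) (Function.update
        (fun m => fderiv ℝ (c.baseChange c') j.1 (v (i.succAbove m))) l
        (fderiv ℝ (fderiv ℝ (c.baseChange c')) j.1 (v i) (v (i.succAbove l)))) := by
    intro i
    have h1 : ∀ j ∈ cyl (ovl c c'), (T j).toLinearMap.compAlternatingMap (a' (c.jetChange c' j))
        (fun l => fderiv ℝ (c.baseChange c') j.1 (v (i.succAbove l))) =
        a j fun l => v (i.succAbove l) := fun j hj => (h j hj _).symm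
    rw [← totalDeriv_congr hU _ (ha.eval _) h1 hj,
      totalDeriv_alt_apply hU ha'' (fun l => hx (v (i.succAbove l))) hj]
    simp only [hdx]
    congr 1
    rw [altD_apply hU _ ha'' hj]
    exact totalDeriv_subst hT hU hV subset_rfl jetChange_mem (ha'.eval _) hj (v i)
  rw [altDh_apply hU ha hj, altDh_apply hV ha' (jetChange_mem j hj), map_sum]
  simp only [key, smul_add, Finset.sum_add_distrib, map_smul]
  rw [add_eq_left]
  exact alternating_symmetric_eq_zero
    ((T j).toLinearMap.compAlternatingMap (a' (c.jetChange c' j)))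
    (fderiv ℝ (c.baseChange c') j.1).toLinearMap
    ((ContinuousLinearMap.coeLM ℝ) ∘ₗ (fderiv ℝ (fderiv ℝ (c.baseChange c')) j.1).toLinearMap)
    hsymm v

/-- Naturality of the contraction with the lowering operators. -/
theorem lowK_subst {a a' : Jet n s → (Base n) [⋀^Fin (p + 1)]→ₗ[ℝ] VAlg n s} [IsManifold (𝓡 n) ∞ M]
    {ρ : SmoothPartitionOfUnity M (𝓡 n) M Set.univ}
    (hρ : ρ.IsSubordinate fun x => (chartAt (Base n) x).source)
    (hT : ∀ j ∈ cyl (ovl c c'), c.IsSubst c' j (T j))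
    (hv : ∀ j ∈ cyl (ovl c c'), ∀ v, a j v ∈ vdegPart n s 1)
    (hv' : ∀ j ∈ cyl c'.ψ.target, ∀ v, a' j v ∈ vdegPart n s 1)
    (h : ∀ j ∈ cyl (ovl c c'), ∀ v, a j v =
      T j (a' (c.jetChange c' j) fun l => fderiv ℝ (c.baseChange c') j.1 (v l)))
    {j : Jet n s} (hj : j ∈ cyl (ovl c c')) (v : Fin p → Base n) :
    lowK (puLow ρ c) a j v = T j (lowK (puLow ρ c') a' (c.jetChange c' j)
      fun l => fderiv ℝ (c.baseChange c') j.1 (v l)) := by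
  have hjb := fst_mem_baseOvl hj
  have hz : c'.φ.symm (c.jetChange c' j).1 = c.φ.symm j.1 := c'.φ.left_inv hjb.2
  rw [lowK_puLow, lowK_puLow, hz, map_sum]
  refine Finset.sum_congr rfl fun i hi => ?_
  rw [map_smul, map_sum]
  congr 1
  refine Finset.sum_congr rfl fun κ _ => ?_
  have hi' : ρ i (c.φ.symm j.1) ≠ 0 := (Set.Finite.mem_toFinset _).1 hi
  have hi₀ : j.1 ∈ chgDom c.φ (chartAt (Base n) i) := mem_chgDom_of_ne_zero hρ hjb.1 hi'
  have hcm := IsManifold.chart_mem_maximalAtlas (I := 𝓡 n) (n := ∞) i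
  set W := chgDom c.φ (chartAt (Base n) i)
  set W' := chgDom c'.φ (chartAt (Base n) i)
  -- The coordinates of the `i`-th chart are smooth only over that chart, so the comparison is made
  -- on the part of the overlap lying above it; the jet lies there because `ρ i` does not vanish.
  have hU : IsOpen (ovl c c' ∩ Prod.fst ⁻¹' W) :=
    (isOpen_ovl c c').inter ((isOpen_chgDom _ _).preimage continuous_fst)
  have hV : IsOpen (c'.ψ.target ∩ Prod.fst ⁻¹' W') :=
    c'.ψ.open_target.inter ((isOpen_chgDom _ _).preimage continuous_fst)
  have hm : ∀ j ∈ cyl (ovl c c' ∩ Prod.fst ⁻¹' W),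
      c.jetChange c' j ∈ cyl (c'.ψ.target ∩ Prod.fst ⁻¹' W') := by
    intro j hj
    refine ⟨jetChange_mem j hj.1, fst_mem_target (jetChange_mem j hj.1), ?_⟩
    have hz : c'.φ.symm (c.jetChange c' j).1 = c.φ.symm j.1 :=
      c'.φ.left_inv (fst_mem_baseOvl hj.1).2
    change c'.φ.symm (c.jetChange c' j).1 ∈ (chartAt (Base n) i).source
    rw [hz]
    exact hj.2.2
  have hff' : ∀ j ∈ cyl (ovl c c' ∩ Prod.fst ⁻¹' W),
      chgCoord c'.φ (chartAt (Base n) i) κ (c.baseChange c' j.1) =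
        chgCoord c.φ (chartAt (Base n) i) κ j.1 := by
    intro j hj
    simp only [chgCoord, chg, AdaptedChart.baseChange]
    rw [c'.φ.left_inv (fst_mem_baseOvl hj.1).2]
  have hX := chgPartial_chg c.φ_mem c'.φ_mem hcm hjb hi₀ κ
  have ec : (Fin.cons (chgPartial c'.φ (chartAt (Base n) i) κ (c.jetChange c' j).1)
      fun l => fderiv ℝ (c.baseChange c') j.1 (v l) : Fin (p + 1) → Base n) =
      fun l => fderiv ℝ (c.baseChange c') j.1
        ((Fin.cons (chgPartial c.φ (chartAt (Base n) i) κ j.1) v : Fin (p + 1) → Base n) l) := by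
    funext l
    refine Fin.cases ?_ (fun l => ?_) l
    · exact hX
    · rfl
  have hh := h j hj (Fin.cons (chgPartial c.φ (chartAt (Base n) i) κ j.1) v)
  rw [ec, lowOp_subst hT hU hV Set.inter_subset_left hm (isOpen_chgDom _ _) (fun _ h => h.2)
    (contDiffOn_chgCoord c.φ_mem hcm κ) (isOpen_chgDom _ _) (fun _ h => h.2)
    (contDiffOn_chgCoord c'.φ_mem hcm κ) hff' ⟨hj, hi₀⟩ (hv' _ (jetChange_mem j hj) _)
    (by rw [← hh]; exact hv j hj _), ← hh]

end AltSubst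

/-! ### Closed forms of vertical degree one are exact -/

section Primitive

variable {n p : ℕ} {s : FibreType} {U : Set (ModelProd (Base n) (Base s.m))}
  {Λ : Fin n → Jet n s → VAlg n s →ₗ[ℝ] VAlg n s}
  {a : Jet n s → (Base n) [⋀^Fin (p + 1)]→ₗ[ℝ] VAlg n s} {r : ℤ}

/-- The partial sums of the primitive of a closed form. -/
def hprim (Λ : Fin n → Jet n s → VAlg n s →ₗ[ℝ] VAlg n s)
    (a : Jet n s → (Base n) [⋀^Fin (p + 1)]→ₗ[ℝ] VAlg n s) (N : ℕ) (j : Jet n s) :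
    (Base n) [⋀^Fin p]→ₗ[ℝ] VAlg n s :=
  ∑ i ∈ Finset.range N, ((i : ℝ) + 1)⁻¹ • lowK Λ (hiter Λ a i) j

theorem hprim_apply (N : ℕ) (j : Jet n s) (v : Fin p → Base n) :
    hprim Λ a N j v = ∑ i ∈ Finset.range N, ((i : ℝ) + 1)⁻¹ • lowK Λ (hiter Λ a i) j v :=
  map_sum (evalAlt v) (fun i : ℕ => ((i : ℝ) + 1)⁻¹ • lowK Λ (hiter Λ a i) j) _

theorem hprim_mem_bideg (hU : IsOpen U) (hΛ : IsLowering U Λ) (h : IsClosedForm U r a) (N : ℕ)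
    {j : Jet n s} (hj : j ∈ cyl U) (v : Fin p → Base n) : hprim Λ a N j v ∈ bideg n s 1 r := by
  rw [hprim_apply]
  exact sum_mem fun i _ => Submodule.smul_mem _ _
    (lowK_mem_bideg hΛ hj ((h.hiter hU hΛ i).mem j hj) v)

theorem isLocalOn_hprim (hU : IsOpen U) (hΛ : IsLowering U Λ) (h : IsClosedForm U r a) (N : ℕ) :
    IsLocalOn (cyl U) (hprim Λ a N) :=
  IsLocalOn.sum _ fun i _ => (isLocalOn_lowK hΛ (h.hiter hU hΛ i).isLocal).const_smul _

theorem altDh_zero (j : Jet n s) :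
    altDh (fun _ => (0 : (Base n) [⋀^Fin p]→ₗ[ℝ] VAlg n s)) j = 0 := by
  have := altDh_sub_smul isOpen_univ (isLocalOn_const (0 : (Base n) [⋀^Fin p]→ₗ[ℝ] VAlg n s))
    (isLocalOn_const 0) 1 (j := j) trivial
  simpa using this

/-- Each step of `hiter` subtracts precisely `d_h` of the next summand of `hprim`, so the sum
telescopes. -/
theorem altDh_hprim (hU : IsOpen U) (hΛ : IsLowering U Λ) (h : IsClosedForm U r a) (N : ℕ)
    {j : Jet n s} (hj : j ∈ cyl U) : altDh (hprim Λ a N) j = a j - hiter Λ a N j := by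
  induction N with
  | zero => exact (altDh_zero j).trans (sub_self _).symm
  | succ N ih =>
    have e : hprim Λ a (N + 1) = fun j =>
        hprim Λ a N j - (-((N : ℝ) + 1)⁻¹) • lowK Λ (hiter Λ a N) j := by
      funext j
      rw [hprim, Finset.sum_range_succ, ← hprim]
      module
    rw [e, altDh_sub_smul hU (isLocalOn_hprim hU hΛ h N)
      (isLocalOn_lowK hΛ (h.hiter hU hΛ N).isLocal) _ hj, ih]
    change _ = a j - (hiter Λ a N j - ((N : ℝ) + 1)⁻¹ • altDh (lowK Λ (hiter Λ a N)) j)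
    module

/-- Once the iterates vanish the partial sums are stationary, so the primitive does not depend on
the cut-off. -/
theorem hprim_eq_of_le {N K : ℕ} (hNK : N ≤ K) {j : Jet n s}
    (h : ∀ i ≥ N, hiter Λ a i j = 0) : hprim Λ a K j = hprim Λ a N j := by
  refine (Finset.sum_subset (Finset.range_subset_range.2 hNK) fun i _ hi => ?_).symm
  have h0 := h i (by simpa using hi)
  have : lowK Λ (hiter Λ a i) j = 0 := by
    ext v
    rw [lowK_apply, h0]
    simp
  rw [this, smul_zero]

end Primitive

/-! ### Global primitives. -/

section Global

variable {n p : ℕ} {s : FibreType} {M : Type*} [TopologicalSpace M] [ChartedSpace (Base n) M]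
  {Y : GradedBundle n s M}

/-- The existence of substitution homomorphisms is part of the compatibility of any local form. They
are unique, so those found for one form serve for all others. -/
theorem exists_substitution (α : LocalForm Y p) (c c' : AdaptedChart Y) :
    ∃ T : Jet n s → VAlg n s →ₐ[ℝ] VAlg n s, ∀ j ∈ cyl (ovl c c'), c.IsSubst c' j (T j) := by
  classical
  choose T hT using α.compat c c'
  exact ⟨fun j => if h : j ∈ c.overlap c' then T j h else AlgHom.id ℝ _, fun j hj => by
    have hj' : j ∈ c.overlap c' := hj
    simp only [dif_pos hj']
    exact (hT j hj').1⟩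

theorem _root_.LocalForm.rep_eq (α : LocalForm Y p) {c c' : AdaptedChart Y} {j : Jet n s}
    (hj : j ∈ c.overlap c') {T : VAlg n s →ₐ[ℝ] VAlg n s} (hT : c.IsSubst c' j T)
    (v : Fin p → Base n) : α.rep c j v =
      T (α.rep c' (c.jetChange c' j) fun l => fderiv ℝ (c.baseChange c') j.1 (v l)) := by
  obtain ⟨T', hT', h⟩ := α.compat c c' j hj
  rw [h, hT'.unique hT]

theorem dh_raw (α : LocalForm Y p) {c : AdaptedChart Y} {j : Jet n s} (hj : j ∈ c.dom)
    (v : Fin (p + 1) → Base n) : RawForm.dh α.raw c j v = altDh (α.rep c) j v :=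
  (altDh_apply c.ψ.open_target (α.isLocal c) hj v).symm

/-- The sum of two local forms. -/
def _root_.LocalForm.add (α β : LocalForm Y p) : LocalForm Y p where
  rep c j := α.rep c j + β.rep c j
  isLocal c := (show IsLocalOn (cyl c.ψ.target) (α.rep c) from α.isLocal c).add (β.isLocal c)
  compat c c' j hj := by
    obtain ⟨T, hT, h⟩ := α.compat c c' j hj
    refine ⟨T, hT, fun v => ?_⟩
    rw [AlternatingMap.add_apply, AlternatingMap.add_apply, map_add, ← h, ← β.rep_eq hj hT]

variable [IsManifold (𝓡 n) ∞ M] {ρ : SmoothPartitionOfUnity M (𝓡 n) M Set.univ} {r : ℤ}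

theorem hiter_subst (hρ : ρ.IsSubordinate fun x => (chartAt (Base n) x).source)
    {α : LocalForm Y (p + 1)} (hα : ∀ c : AdaptedChart Y, IsClosedForm c.ψ.target r (α.rep c))
    {c c' : AdaptedChart Y} {T : Jet n s → VAlg n s →ₐ[ℝ] VAlg n s}
    (hT : ∀ j ∈ cyl (ovl c c'), c.IsSubst c' j (T j)) (N : ℕ) :
    ∀ j ∈ cyl (ovl c c'), ∀ v, hiter (puLow ρ c) (α.rep c) N j v =
      T j (hiter (puLow ρ c') (α.rep c') N (c.jetChange c' j)
        fun l => fderiv ℝ (c.baseChange c') j.1 (v l)) := by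
  induction N with
  | zero => exact fun j hj v => α.rep_eq hj (hT j hj) v
  | succ N ih =>
    intro j hj v
    have hN := fun c => (hα c).hiter c.ψ.open_target (isLowering_puLow hρ c) N
    have hK := altDh_subst hT ((isLocalOn_lowK (isLowering_puLow hρ c) (hN c).isLocal).mono
      ovl_subset) (isLocalOn_lowK (isLowering_puLow hρ c') (hN c').isLocal)
      (fun j hj v => lowK_subst hρ hT
        (fun j hj v => bideg_le_vdegPart _ _ ((hN c).mem j (ovl_subset hj) v))
        (fun j hj v => bideg_le_vdegPart _ _ ((hN c').mem j hj v)) ih hj v) hj v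
    change (_ - _ • _ : (Base n) [⋀^Fin (p + 1)]→ₗ[ℝ] VAlg n s) _ =
      T j ((_ - _ • _ : (Base n) [⋀^Fin (p + 1)]→ₗ[ℝ] VAlg n s) _)
    rw [AlternatingMap.sub_apply, AlternatingMap.sub_apply, AlternatingMap.smul_apply,
      AlternatingMap.smul_apply, map_sub, map_smul, ih j hj, hK]

theorem hprim_subst (hρ : ρ.IsSubordinate fun x => (chartAt (Base n) x).source)
    {α : LocalForm Y (p + 1)} (hα : ∀ c : AdaptedChart Y, IsClosedForm c.ψ.target r (α.rep c))
    {c c' : AdaptedChart Y} {T : Jet n s → VAlg n s →ₐ[ℝ] VAlg n s}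
    (hT : ∀ j ∈ cyl (ovl c c'), c.IsSubst c' j (T j)) (N : ℕ) {j : Jet n s}
    (hj : j ∈ cyl (ovl c c')) (v : Fin p → Base n) : hprim (puLow ρ c) (α.rep c) N j v =
      T j (hprim (puLow ρ c') (α.rep c') N (c.jetChange c' j)
        fun l => fderiv ℝ (c.baseChange c') j.1 (v l)) := by
  have hN := fun i c => (hα c).hiter c.ψ.open_target (isLowering_puLow hρ c) i
  rw [hprim_apply, hprim_apply, map_sum]
  refine Finset.sum_congr rfl fun i _ => ?_
  rw [map_smul, ← lowK_subst hρ hT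
    (fun j hj v => bideg_le_vdegPart _ _ ((hN i c).mem j (ovl_subset hj) v))
    (fun j hj v => bideg_le_vdegPart _ _ ((hN i c').mem j hj v)) (hiter_subst hρ hα hT i) hj v]

/-- Closed local forms of vertical degree one and horizontal degree `n - 1 ≥ 1` are exact. -/
theorem exists_primitive [T2Space M] [SecondCountableTopology M] (hn : n = p + 2)
    {α : LocalForm Y (p + 1)} (hα : ∀ c : AdaptedChart Y, IsClosedForm c.ψ.target r (α.rep c)) :
    ∃ β : LocalForm Y p, RawForm.HasDegree 1 r β.raw ∧ ∀ c, ∀ j ∈ c.dom, ∀ v,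
      RawForm.dh β.raw c j v = α.rep c j v := by
  have := ChartedSpace.locallyCompactSpace (Base n) M
  obtain ⟨ρ, hρ⟩ := SmoothPartitionOfUnity.exists_isSubordinate_chartAt_source (𝓡 n) M
  have hΛ := fun c : AdaptedChart Y => isLowering_puLow hρ c
  have hU := fun c : AdaptedChart Y => c.ψ.open_target
  -- The order is bounded in each chart, with no uniform bound over all charts.
  choose N hN using fun c => exists_ordLT (hα c).isLocal
  have h0 : ∀ c, ∀ j ∈ c.dom, ∀ i ≥ N c, hiter (puLow ρ c) (α.rep c) i j = 0 :=
    fun c j hj i hi => hiter_eq_zero (hU c) (hΛ c) hn i (hα c)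
      (fun j hj v b I hI => hN c j hj v b I (hi.trans hI)) hj
  let β : LocalForm Y p :=
    { rep := fun c => hprim (puLow ρ c) (α.rep c) (N c)
      isLocal := fun c => isLocalOn_hprim (hU c) (hΛ c) (hα c) _
      compat := fun c c' j hj => by
        obtain ⟨T, hT⟩ := exists_substitution α c c'
        refine ⟨T j, hT j hj, fun v => ?_⟩
        -- On an overlap both cut-offs are raised to their maximum, where naturality of the partial
        -- sums applies.
        rw [← hprim_eq_of_le (le_max_left _ (N c')) (h0 c j hj.1),
          ← hprim_eq_of_le (le_max_right (N c) _) (h0 c' _ (jetChange_mem j hj))]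
        exact hprim_subst hρ hα hT _ hj v }
  refine ⟨β, fun c j hj v => ?_, fun c j hj v => ?_⟩
  · exact hprim_mem_bideg (hU c) (hΛ c) (hα c) _ hj v
  · rw [dh_raw β hj]
    change altDh (hprim _ _ _) j v = _
    rw [altDh_hprim (hU c) (hΛ c) (hα c) _ hj, h0 c j hj _ le_rfl, sub_zero]

end Global

end Variational

/-- The canonical boundary form `γ` of the Lagrangian of an extended BV-BFV theory on a manifold of
dimension `k + 1 ≥ 1` is equal to `-γ^{(1)}` up to a `d_h`-exact term. -/
theorem mainTheorem9 {k : ℕ} {s : FibreType} {M : Type*} [TopologicalSpace M] [T2Space M]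
    [SecondCountableTopology M] [ChartedSpace (Base (k + 1)) M] [IsManifold (𝓡 (k + 1)) ∞ M]
    (Y : GradedBundle (k + 1) s M) {m : ℕ} (T : ExtendedBVBFV Y m)
    (ν : VolumeForm (k + 1) M) (hω : HasCanonicalForm (T.Ω (k + 1)) ν)
    (γ : LocalForm Y k) (hγ : IsBoundaryForm (T.L (k + 1)) γ) :
    RawForm.DhEquiv 1 0 γ.raw (-(T.γ k).raw) := by
  have hα : ∀ c : AdaptedChart Y,
      Variational.IsClosedForm c.ψ.target 0 ((γ.add (T.γ k)).rep c) := by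
    intro c
    refine ⟨(γ.add (T.γ k)).isLocal c, fun j hj v => ?_, fun j hj => ?_⟩
    · refine add_mem (hγ.degree c j hj v) ?_
      have h := T.γ_degree k (Nat.le_succ k) c j hj v
      -- `γ^{(1)}` sits at horizontal degree `h = k = n - 1`, hence has ghost degree `n - h - 1 =
      -- 0`.
      have e : (((k + 1 : ℕ) : ℤ) - k - 1) = 0 := by push_cast; ring
      rwa [e] at h
    · ext v
      have h1 := Variational.altDh_sub_smul c.ψ.open_target (γ.isLocal c) ((T.γ k).isLocal c)
        (-1) hj
      have h2 := Variational.dh_boundaryForm_add T ν hω γ hγ c hj v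
      rw [Variational.dh_raw γ hj, Variational.dh_raw (T.γ k) hj] at h2
      have e : (γ.add (T.γ k)).rep c = fun j => γ.rep c j - (-1 : ℝ) • (T.γ k).rep c j := by
        funext j
        change γ.rep c j + (T.γ k).rep c j = _
        module
      rw [e, h1, AlternatingMap.sub_apply, AlternatingMap.smul_apply, neg_smul, one_smul,
        sub_neg_eq_add, h2, AlternatingMap.zero_apply]
  have hsub : ∀ c j v, (γ.raw - -(T.γ k).raw) c j v = (γ.add (T.γ k)).rep c j v :=
    fun c j v => sub_neg_eq_add (γ.raw c j v) ((T.γ k).raw c j v)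
  -- For `n = 1` the closed form is a function of vertical degree one and vanishes; for `n = p + 2`
  -- it has positive horizontal degree `p + 1 = n - 1` and a global primitive exists.
  rcases k with _ | p
  · intro c j hj v
    rw [hsub, (hα c).eq_zero c.ψ.open_target 0 hj]
    rfl
  · obtain ⟨β, hβ, h⟩ := Variational.exists_primitive rfl hα
    exact ⟨β, hβ, fun c j hj v => (h c j hj v).trans (hsub c j v).symm⟩

end
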